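/- Let $\mathcal Z$ be a stationary (simple, locally finite) point process on $\mathbb R$. For an interval $I$ let $\mathcal G_I$ be the event that $\mathcal Z\cap I=\emptyset$, and put $G(r)=\mathbb P[\mathcal G_{[0,r]}]$. For $k\ge 2$ let $\rho^k_{r,s}$ be the least $\varepsilon\in[0,1]$ such that $$\frac{\mathbb P[\bigcap_i\mathcal G_{I_i}]}{\prod_i\mathbb P[\mathcal G_{I_i}]}\in\Big[1-\varepsilon,\frac1{1-\varepsilon}\Big]$$ for all collections $(I_i)_{i\le k}$ of disjoint compact intervals of length at most $r$ that are pairwise at distance at least $s$ (with $1/0=\infty$). Let $\bar{\mathcal Q}^k_{r,\bar r,s}$ be the set of all families $(\mathcal C_\ell)_\ell$ of clusters consisting in total of at most $k$ pairwise disjoint compact intervals of length at most $r$, where each cluster is a contiguous block in the left-to-right ordering of all the intervals and is contained in an interval of length at most $\bar r$, and intervals of different clusters are at distance at least $s$. Let $$\phi_r=\sup\mathbb P[\mathcal G_{I_1}\cap\mathcal G_{I_2}],$$ the supremum being over pairs of compact intervals of length at least $r$ with at most one common point. Suppose that the following hold. 1. (Gap decay) $-\log G(r)/\log r\to\infty$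 as $r\to\infty$; in particular $G>0$. 2. (Regularity) $G$ is convex on $[0,\infty)$ and twice differentiable on $(0,\infty)$, and, as $r\to\infty$, $\log(-G'(r))\sim\log G(r)$ and $\log G''(r)\le(1+o(1))\log G(r)$ (with $\log 0=-\infty$). 3. (Splitting) For every $k\ge2$ and $\delta>0$ there is $\delta'>0$ such that, for all functions $r=R^{o(1)}$ and $s=R^{\delta+o(1)}$ of $R$, $\rho^k_{r,s}\le R^{-\delta'+o(1)}$ as $R\to\infty$. 4. (Clustered decoupling) For every $k\ge2$ and $\delta>0$ there is $c>0$ such that, for all functions $r=R^{o(1)}$ and $s=R^{\delta+o(1)}$ of $R$, as $R\to\infty$, $$\mathbb P\Big[\bigcap_i\mathcal G_{I_i}\Big]\le R^{o(1)}\Big(\Big(\prod_\ell\mathbb P\Big[\bigcap_{I_i\in\mathcal C_\ell}\mathcal G_{I_i}\Big]\Big)^{1+o(1)}+R^{-k}\Big)$$ uniformly over $\bar r\le s/c$ and $(\mathcal C_\ell)_\ell\in\bar{\mathcal Q}^k_{r,\bar r,s}$. 5. (Absence of clustering) There is $\eta>0$ such that $\phi_r\le G(r)^{1+\eta+o(1)}$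 as $r\to\infty$. Let $\theta(r)=-\log(-G'(r))$, and let $(z_i)$ be the points of $\mathcal Z$ in increasing order. Then the largest gaps of $\mathcal Z$ obey the Poisson approximation: as $R\to\infty$ the point processes $$\Psi_R=\sum_{i\,:\,z_i\in[0,R]}\delta_{(z_i/R,\ \theta(z_{i+1}-z_i)-\log R)}$$ converge vaguely (in distribution) on $[0,1]\times(-\infty,+\infty]$ to a Poisson point process with intensity $dx\otimes e^{-y}\,dy$. That is, $\int f\,d\Psi_R$ converges in distribution to $\int f\,d\Psi$ for every continuous compactly supported function $f$ on $[0,1]\times(-\infty,+\infty]$, where $\Psi$ is such a Poisson process. -/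

import Mathlib

open MeasureTheory ProbabilityTheory Filter Asymptotics
open scoped Topology ENNReal

universe u v

namespace LargeGaps

noncomputable section

/-! ### Stationary point processes and gap events -/

/-- The counting measure of a set of points, `B ↦ #(S ∩ B)`. -/
def counting (S : Set ℝ) : Measure ℝ := Measure.count.restrict S

/-- `Z` is a stationary (simple) point process on `ℝ`: a random locally finite set of points, all of
whose counts in Borel sets are random variables, and whose law (that of the random counting measure)
is invariant under translations. -/
structure IsStationaryPointProcess {Ω : Type u} [MeasurableSpace Ω] (P : Measure Ω)
    (Z : Ω → Set ℝ) : Prop where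
  locallyFinite : ∀ (ω : Ω) (a b : ℝ), (Z ω ∩ Set.Icc a b).Finite
  measurable : Measurable fun ω => counting (Z ω)
  stationary : ∀ t : ℝ,
    P.map (fun ω => counting ((fun x => x + t) '' Z ω)) = P.map (fun ω => counting (Z ω))

/-- The gap event: there is no point of `Z` in `I`. -/
def gapEvent {Ω : Type u} (Z : Ω → Set ℝ) (I : Set ℝ) : Set Ω := {ω | Z ω ∩ I = ∅}

/-- The gap probability `G(r)`, the probability that `[0, r]` contains no point. -/
def gapProb {Ω : Type u} [MeasurableSpace Ω] (P : Measure Ω) (Z : Ω → Set ℝ) (r : ℝ) : ℝ :=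
  P.real (gapEvent Z (Set.Icc 0 r))

/-- The scaling function `θ(r) = -log (-G'(r))`. -/
def scaling {Ω : Type u} [MeasurableSpace Ω] (P : Measure Ω) (Z : Ω → Set ℝ) (r : ℝ) : ℝ :=
  -Real.log (-deriv (gapProb P Z) r)

/-! ### The point process of rescaled gaps -/

/-- The real line compactified at `+∞` only, that is `(-∞, +∞]`. -/
abbrev RealTop : Type := Set.Ioi (⊥ : EReal)

/-- The inclusion of the real line into `(-∞, +∞]`. -/
def toRealTop (y : ℝ) : RealTop := ⟨(y : EReal), EReal.bot_lt_coe y⟩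

/-- The state space `[0, 1] × (-∞, +∞]`. -/
abbrev GapSpace : Type := Set.Icc (0 : ℝ) 1 × RealTop

/-- `p` is a pair `(z_i, z_{i+1})` of successive points of `S`. -/
def IsGap (S : Set ℝ) (p : ℝ × ℝ) : Prop :=
  p.1 ∈ S ∧ p.2 ∈ S ∧ p.1 < p.2 ∧ S ∩ Set.Ioo p.1 p.2 = ∅

/-- The point process `Ψ_R` of rescaled gaps: the sum over the successive points `(z, z')` of `Z`
with `z ∈ [0, R]` of the Dirac masses at `(z / R, θ(z' - z) - log R)`. (The projection to `[0, 1]`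
is the identity there, as `z / R ∈ [0, 1]`.) -/
def rescaledGaps {Ω : Type u} [MeasurableSpace Ω] (P : Measure Ω) (Z : Ω → Set ℝ) (R : ℝ)
    (ω : Ω) : Measure GapSpace :=
  Measure.sum fun p : {p : ℝ × ℝ // IsGap (Z ω) p ∧ p.1 ∈ Set.Icc 0 R} =>
    Measure.dirac
      (Set.projIcc (0 : ℝ) 1 zero_le_one (p.1.1 / R),
        toRealTop (scaling P Z (p.1.2 - p.1.1) - Real.log R))

/-- The measure `dx ⊗ e^{-y} dy` on `[0, 1] × (-∞, +∞]`; it does not charge `[0, 1] × {+∞}`. -/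
def limitIntensity : Measure GapSpace :=
  (volume : Measure (Set.Icc (0 : ℝ) 1)).prod
    (((volume : Measure ℝ).withDensity fun y => ENNReal.ofReal (Real.exp (-y))).map toRealTop)

/-- `N` is a Poisson point process with intensity `μ`: a random measure whose values on disjoint
sets are independent, and whose value on each set `B` of finite intensity is a Poisson random
variable of mean `μ B`. -/
structure IsPoissonProcess {E : Type*} [MeasurableSpace E] {Ω : Type v} [MeasurableSpace Ω]
    (P : Measure Ω) (N : Ω → Measure E) (μ : Measure E) : Prop where
  measurable : Measurable N
  poisson : ∀ B : Set E, MeasurableSet B → μ B < ∞ →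
    P.map (fun ω => N ω B) =
      (poissonMeasure (μ B).toNNReal).map (fun n : ℕ => (n : ℝ≥0∞))
  indep : ∀ (n : ℕ) (B : Fin n → Set E), (∀ i, MeasurableSet (B i)) →
    Pairwise (fun i j => Disjoint (B i) (B j)) →
    iIndepFun (fun i ω => N ω (B i)) P

/-- Convergence in law, for the vague topology, of random measures `Ψ R` as `R → ∞` to a random
measure `N`: for every continuous compactly supported `f`, the random variables `∫ f dΨ_R` converge
in distribution to `∫ f dN`. -/
def ConvergesVaguely {E : Type*} [TopologicalSpace E] [MeasurableSpace E]
    {Ω : Type u} [MeasurableSpace Ω] (P : Measure Ω) [IsProbabilityMeasure P]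
    {Ω' : Type v} [MeasurableSpace Ω'] (P' : Measure Ω') [IsProbabilityMeasure P']
    (Ψ : ℝ → Ω → Measure E) (N : Ω' → Measure E) : Prop :=
  ∀ f : E → ℝ, Continuous f → HasCompactSupport f →
    TendstoInDistribution (fun (R : ℝ) ω => ∫ x, f x ∂(Ψ R ω)) atTop
      (fun ω' => ∫ x, f x ∂(N ω')) (fun _ => P) P'

/-- The largest gaps of `Z` obey a Poisson approximation: `Ψ_R` converges vaguely, as `R → ∞`, to a
Poisson point process on `[0, 1] × (-∞, +∞]` with intensity `dx ⊗ e^{-y} dy` (any such process, as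
they all have the same law). -/
def PoissonApproximation {Ω : Type u} [MeasurableSpace Ω] (P : Measure Ω)
    [IsProbabilityMeasure P] (Z : Ω → Set ℝ) : Prop :=
  ∀ (Ω' : Type v) [MeasurableSpace Ω'] (P' : Measure Ω') [IsProbabilityMeasure P']
    (N : Ω' → Measure GapSpace), IsPoissonProcess P' N limitIntensity →
    ConvergesVaguely P P' (rescaledGaps P Z) N

/-! ### Coefficients measuring splitting and clustering -/

/-- The compact intervals `[a i, b i]`, `i < k`, are disjoint, have length at most `r`, and are
pairwise at distance at least `s`. -/
structure WellSeparated (k : ℕ) (r s : ℝ) (a b : Fin k → ℝ) : Prop where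
  le : ∀ i, a i ≤ b i
  length : ∀ i, b i - a i ≤ r
  disjoint : ∀ i j, i ≠ j → Disjoint (Set.Icc (a i) (b i)) (Set.Icc (a j) (b j))
  separated : ∀ i j, i ≠ j →
    ∀ x ∈ Set.Icc (a i) (b i), ∀ y ∈ Set.Icc (a j) (b j), s ≤ |x - y|

/-- The splitting coefficient `ρ^k_{r,s}`: the least `ε ∈ [0, 1]` such that
`P[⋂ gaps] / ∏ P[gap]` lies in `[1 - ε, 1 / (1 - ε)]` for all well separated collections. The bounds
are multiplied out, so that `ε = 1` gives no restriction, as `1 / (1 - ε) = ∞` demands. -/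
def splittingCoeff {Ω : Type u} [MeasurableSpace Ω] (P : Measure Ω) (Z : Ω → Set ℝ)
    (k : ℕ) (r s : ℝ) : ℝ :=
  sInf {ε : ℝ | ε ∈ Set.Icc (0 : ℝ) 1 ∧ ∀ a b : Fin k → ℝ, WellSeparated k r s a b →
    (1 - ε) * ∏ i, P.real (gapEvent Z (Set.Icc (a i) (b i))) ≤
        P.real (⋂ i, gapEvent Z (Set.Icc (a i) (b i))) ∧
      (1 - ε) * P.real (⋂ i, gapEvent Z (Set.Icc (a i) (b i))) ≤
        ∏ i, P.real (gapEvent Z (Set.Icc (a i) (b i)))}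

/-- The gap clustering coefficient `φ_r`: the supremum of `P[gap in I₁ and gap in I₂]` over compact
intervals of length at least `r` that have at most one common point. -/
def clusteringCoeff {Ω : Type u} [MeasurableSpace Ω] (P : Measure Ω) (Z : Ω → Set ℝ)
    (r : ℝ) : ℝ :=
  sSup {p : ℝ | ∃ a₁ b₁ a₂ b₂ : ℝ, a₁ ≤ b₁ ∧ a₂ ≤ b₂ ∧ r ≤ b₁ - a₁ ∧ r ≤ b₂ - a₂ ∧
    (Set.Icc a₁ b₁ ∩ Set.Icc a₂ b₂).Subsingleton ∧
    p = P.real (gapEvent Z (Set.Icc a₁ b₁) ∩ gapEvent Z (Set.Icc a₂ b₂))}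

/-- A clustering of `n` disjoint compact intervals `[left i, right i]`, listed from left to right,
into `m` clusters, also numbered from left to right, each of which is a contiguous block of
intervals. -/
structure Clustering where
  n : ℕ
  m : ℕ
  left : Fin n → ℝ
  right : Fin n → ℝ
  left_le_right : ∀ i, left i ≤ right i
  right_lt_left : ∀ i j, i < j → right i < left j
  cluster : Fin n → Fin m
  cluster_mono : Monotone cluster

/-- The `i`-th interval of a clustering. -/
def Clustering.interval (C : Clustering) (i : Fin C.n) : Set ℝ := Set.Icc (C.left i) (C.right i)

/-- There are at most `k` intervals, all of length at most `r`; each cluster fits in an interval of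
length at most `rbar`; and intervals of different clusters are at distance at least `s`. -/
structure Clustering.Admissible (C : Clustering) (k : ℕ) (r rbar s : ℝ) : Prop where
  card_le : C.n ≤ k
  length : ∀ i, C.right i - C.left i ≤ r
  diam : ∀ l : Fin C.m, ∃ x y : ℝ, y - x ≤ rbar ∧
    ∀ i, C.cluster i = l → C.interval i ⊆ Set.Icc x y
  separated : ∀ i j, C.cluster i ≠ C.cluster j →
    ∀ x ∈ C.interval i, ∀ y ∈ C.interval j, s ≤ |x - y|

/-! ### The assumptions -/

/-- `g(R) = R^{a + o(1)}` as `R → ∞`. -/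
def IsPowerOrder (g : ℝ → ℝ) (a : ℝ) : Prop :=
  ∃ u : ℝ → ℝ, Tendsto u atTop (𝓝 0) ∧ ∀ᶠ R in atTop, g R = R ^ (a + u R)

/-- `-log G(r) / log r → ∞`. -/
def GapDecay {Ω : Type u} [MeasurableSpace Ω] (P : Measure Ω) (Z : Ω → Set ℝ) : Prop :=
  Tendsto (fun r => -Real.log (gapProb P Z r) / Real.log r) atTop atTop

/-- `G` is twice differentiable and convex, `log (-G') ~ log G` and `log G'' ≤ (1 + o(1)) log G`.
(The last bound says nothing where `G'' = 0`, since then `log G'' = -∞`.) -/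
structure GapRegularity {Ω : Type u} [MeasurableSpace Ω] (P : Measure Ω) (Z : Ω → Set ℝ) :
    Prop where
  differentiable : DifferentiableOn ℝ (gapProb P Z) (Set.Ioi 0)
  twice_differentiable : DifferentiableOn ℝ (deriv (gapProb P Z)) (Set.Ioi 0)
  convex : ConvexOn ℝ (Set.Ici 0) (gapProb P Z)
  log_deriv : (fun r => Real.log (-deriv (gapProb P Z) r)) ~[atTop]
    (fun r => Real.log (gapProb P Z r))
  log_deriv_deriv : ∃ u : ℝ → ℝ, Tendsto u atTop (𝓝 0) ∧ ∀ᶠ r in atTop,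
    0 < deriv (deriv (gapProb P Z)) r →
      Real.log (deriv (deriv (gapProb P Z)) r) ≤ Real.log (gapProb P Z r) * (1 + u r)

/-- For every `k` and `δ > 0` there is `δ' > 0` with `ρ^k_{r,s} ≤ R^{-δ' + o(1)}` whenever
`r = R^{o(1)}` and `s = R^{δ + o(1)}`. -/
def PolynomialSplitting {Ω : Type u} [MeasurableSpace Ω] (P : Measure Ω) (Z : Ω → Set ℝ) : Prop :=
  ∀ k : ℕ, 2 ≤ k → ∀ δ : ℝ, 0 < δ → ∃ δ' : ℝ, 0 < δ' ∧
    ∀ r s : ℝ → ℝ, IsPowerOrder r 0 → IsPowerOrder s δ →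
      ∃ u : ℝ → ℝ, Tendsto u atTop (𝓝 0) ∧
        ∀ᶠ R in atTop, splittingCoeff P Z k (r R) (s R) ≤ R ^ (-δ' + u R)

/-- For every `k` and `δ > 0` there is `c > 0` such that, if `r = R^{o(1)}`, `s = R^{δ + o(1)}` and
`rbar ≤ s / c`, then `P[⋂ gaps] ≤ R^{o(1)} ((∏ over clusters of P[⋂ gaps])^{1 + o(1)} + R^{-k})`,
uniformly over the admissible clusterings. -/
def ClusteredDecoupling {Ω : Type u} [MeasurableSpace Ω] (P : Measure Ω) (Z : Ω → Set ℝ) : Prop :=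
  ∀ k : ℕ, 2 ≤ k → ∀ δ : ℝ, 0 < δ → ∃ c : ℝ, 0 < c ∧
    ∀ r s : ℝ → ℝ, IsPowerOrder r 0 → IsPowerOrder s δ →
      ∃ u v : ℝ → ℝ, Tendsto u atTop (𝓝 0) ∧ Tendsto v atTop (𝓝 0) ∧
        ∀ᶠ R in atTop, ∀ rbar : ℝ, rbar ≤ s R / c →
          ∀ C : Clustering, C.Admissible k (r R) rbar (s R) →
            P.real (⋂ i, gapEvent Z (C.interval i)) ≤
              R ^ u R *
                ((∏ l : Fin C.m,
                    P.real (⋂ i, ⋂ _ : C.cluster i = l, gapEvent Z (C.interval i))) ^ (1 + v R) +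
                  R ^ (-(k : ℝ)))

/-- There is `η > 0` with `φ_r ≤ G(r)^{1 + η + o(1)}` as `r → ∞`. -/
def AbsenceOfClustering {Ω : Type u} [MeasurableSpace Ω] (P : Measure Ω) (Z : Ω → Set ℝ) : Prop :=
  ∃ η : ℝ, 0 < η ∧ ∃ u : ℝ → ℝ, Tendsto u atTop (𝓝 0) ∧
    ∀ᶠ r in atTop, clusteringCoeff P Z r ≤ gapProb P Z r ^ (1 + η + u r)

end

end LargeGaps

/-! By Lévy's continuity theorem it is enough to follow the characteristic functions of `∫ f dΨ_R`.
Their limit should be `exp ∫ (e^{if} - 1) dμ`, the characteristic functional of a Poisson process of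
intensity `μ` (`IsPoissonProcess.integral_exp`). In the coordinate `u = e^{-y}` a gap of length `g`
has mark `-R G'(g)`, the limiting intensity is Lebesgue measure `dx du` on `[0, 1] × (0, ∞)`, and
the support of `f` is a region where `u` is bounded.

Cut `[0, R]` into `n ≈ R^{1+β}` cells of length `ε ≤ R^{-β}`. The event that a gap reaching beyond
`iε + r` starts in the `i`-th cell has probability `G(r - ε) - G(r) ≈ -ε G'(r)`, which explains the
scaling by `-G'`. The bound on `G''` makes `-G'` nearly constant over a step `ε` at the relevant
lengths (`GapRegularity.rpow_deriv_sub_le`, `deriv_threshold_sub_le`), and the decay of `G` makes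
these lengths `R^{o(1)}` (`threshold_le_rpow`). Outcome by outcome, `exp(i ∫ f dΨ_R)` is then close
to `∏ (1 + w_i)`, where `w_i` depends on the gap that leaves the `i`-th cell and vanishes unless
that gap is large (`norm_exp_integral_rescaledGaps_sub_prod_le`).

The heart is `norm_integral_prod_sub_prod_le`: `E ∏ (1 + w_i)` is close to `∏ (1 + E w_i)`. The
product is expanded over the leaders, the occupied cells with no occupied cell shortly before them,
and truncated at order `K`. All sets of leaders are separated, so polynomial splitting factorizes
the joint moments. The sum over sets of leaders may be replaced by that over all separated sets
unless a further large gap starts near one of them.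

Such a further gap costs an extra power of `R` (`eventually_real_iInter_insert_cellEvent_le`), for
which two scales `R^{δ₀} ≪ R^{δ₁}` are used. Beyond the smaller scale, splitting makes the further
gap nearly independent of the others. Below it, the close pair forms a cluster separated from the
rest by the larger scale; clustered decoupling isolates the pair, and the absence of clustering
bounds its probability. Finally `∏ (1 + E w_i) ≈ exp ∑ E w_i`, and the exponent is a Riemann sum for
`∫ (e^{if} - 1) dμ`. -/

namespace LargeGaps

/-! ### Truncated expansions of products -/

open Finset in
/-- Truncating the expansion of a product of complex numbers of modulus at most one. -/
lemma norm_prod_sub_sum_powersetCard_le {ι : Type*} [DecidableEq ι] (w : ι → ℂ) (D : Finset ι)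
    (hw : ∀ i ∈ D, ‖1 + w i‖ ≤ 1) (K : ℕ) :
    ‖∏ i ∈ D, (1 + w i) - ∑ k ∈ range K, ∑ S ∈ D.powersetCard k, ∏ i ∈ S, w i‖ ≤
      ∑ S ∈ D.powersetCard K, ∏ i ∈ S, ‖w i‖ := by
  induction D using Finset.induction_on generalizing K with
  | empty =>
    cases K with
    | zero => simp
    | succ K =>
      have h : ∑ k ∈ range (K + 1), ∑ S ∈ (∅ : Finset ι).powersetCard k, ∏ i ∈ S, w i = 1 := by
        rw [sum_range_succ', powersetCard_zero, sum_singleton, prod_empty, sum_eq_zero, zero_add]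
        intro k _
        rw [powersetCard_eq_empty.2 (by simp), sum_empty]
      rw [h, prod_empty, sub_self, norm_zero]
      exact sum_nonneg fun S _ => prod_nonneg fun i _ => norm_nonneg _
  | insert a D ha ih =>
    have hD : ∀ i ∈ D, ‖1 + w i‖ ≤ 1 := fun i hi => hw i (mem_insert_of_mem hi)
    have step : ∀ {R : Type} [CommSemiring R] (g : ι → R) (k : ℕ),
        ∑ S ∈ (insert a D).powersetCard (k + 1), ∏ i ∈ S, g i =
          ∑ S ∈ D.powersetCard (k + 1), ∏ i ∈ S, g i +
            g a * ∑ S ∈ D.powersetCard k, ∏ i ∈ S, g i := by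
      intro R _ g k
      rw [powersetCard_succ_insert ha, sum_union, sum_image, mul_sum]
      · congr 1
        refine sum_congr rfl fun S hS => ?_
        rw [prod_insert fun h => ha ((mem_powersetCard.1 hS).1 h)]
      · intro S hS S' hS' h
        have h1 : a ∉ S := fun h => ha ((mem_powersetCard.1 hS).1 h)
        have h2 : a ∉ S' := fun h => ha ((mem_powersetCard.1 hS').1 h)
        rw [← erase_insert h1, ← erase_insert h2, h]
      · rw [disjoint_left]
        intro S hS hS'
        obtain ⟨S', -, rfl⟩ := mem_image.1 hS'
        exact ha ((mem_powersetCard.1 hS).1 (mem_insert_self a S'))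
    cases K with
    | zero =>
      simp only [range_zero, sum_empty, sub_zero, powersetCard_zero, sum_singleton, prod_empty]
      rw [norm_prod]
      exact prod_le_one (fun i _ => norm_nonneg _) hw
    | succ K =>
      rw [step, prod_insert ha]
      have e : ∑ k ∈ range (K + 1), ∑ S ∈ (insert a D).powersetCard k, ∏ i ∈ S, w i =
          ∑ k ∈ range (K + 1), ∑ S ∈ D.powersetCard k, ∏ i ∈ S, w i +
            w a * ∑ k ∈ range K, ∑ S ∈ D.powersetCard k, ∏ i ∈ S, w i := by
        rw [sum_range_succ', sum_congr rfl fun k _ => step w k, sum_add_distrib, ← mul_sum,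
          sum_range_succ']
        simp only [powersetCard_zero, sum_singleton, prod_empty]
        ring
      rw [e]
      -- The remainder obeys Pascal's rule: at order `K + 1` for `insert a D` it is the one for `D`
      -- plus `w a` times the remainder of order `K` for `D`. The bound obeys the same rule, with
      -- norms.
      calc _ = ‖(∏ i ∈ D, (1 + w i) - ∑ k ∈ range (K + 1), ∑ S ∈ D.powersetCard k, ∏ i ∈ S, w i) +
            w a * (∏ i ∈ D, (1 + w i) - ∑ k ∈ range K, ∑ S ∈ D.powersetCard k, ∏ i ∈ S, w i)‖ := by
              congr 1; ring
        _ ≤ _ := by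
          refine (norm_add_le _ _).trans (add_le_add (ih hD _) ?_)
          rw [norm_mul]
          exact mul_le_mul_of_nonneg_left (ih hD _) (norm_nonneg _)

lemma norm_prod_sub_prod_le {ι : Type*} (s : Finset ι) (a b : ι → ℂ)
    (ha : ∀ i ∈ s, ‖a i‖ ≤ 1) (hb : ∀ i ∈ s, ‖b i‖ ≤ 1) :
    ‖∏ i ∈ s, a i - ∏ i ∈ s, b i‖ ≤ ∑ i ∈ s, ‖a i - b i‖ := by
  classical
  induction s using Finset.induction_on with
  | empty => simp
  | insert j s hj ih =>
    rw [Finset.prod_insert hj, Finset.prod_insert hj, Finset.sum_insert hj]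
    have h1 := ih (fun i hi => ha i (Finset.mem_insert_of_mem hi))
      (fun i hi => hb i (Finset.mem_insert_of_mem hi))
    have h2 : ‖∏ i ∈ s, a i‖ ≤ 1 := by
      rw [norm_prod]
      exact Finset.prod_le_one (fun i _ => norm_nonneg _)
        fun i hi => ha i (Finset.mem_insert_of_mem hi)
    calc _ = ‖(a j - b j) * ∏ i ∈ s, a i + b j * (∏ i ∈ s, a i - ∏ i ∈ s, b i)‖ := by
            congr 1; ring
      _ ≤ ‖a j - b j‖ * ‖∏ i ∈ s, a i‖ + ‖b j‖ * ‖∏ i ∈ s, a i - ∏ i ∈ s, b i‖ := by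
            rw [← norm_mul, ← norm_mul]; exact norm_add_le _ _
      _ ≤ ‖a j - b j‖ * 1 + 1 * ∑ i ∈ s, ‖a i - b i‖ := by
            gcongr
            exact hb j (Finset.mem_insert_self _ _)
      _ = _ := by ring

/-- If `‖1 + a i‖ ≤ 1`, the product of the `1 + a i` is close to the exponential of the sum. -/
lemma norm_prod_one_add_sub_exp_le {ι : Type*} (s : Finset ι) (a : ι → ℂ)
    (h1 : ∀ i ∈ s, ‖1 + a i‖ ≤ 1) (h2 : ∀ i ∈ s, ‖a i‖ ≤ 1) :
    ‖∏ i ∈ s, (1 + a i) - Complex.exp (∑ i ∈ s, a i)‖ ≤ ∑ i ∈ s, ‖a i‖ ^ 2 := by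
  rw [Complex.exp_sum]
  refine (norm_prod_sub_prod_le s _ _ h1 fun i hi => ?_).trans (Finset.sum_le_sum fun i hi => ?_)
  -- The disc `‖1 + z‖ ≤ 1` lies in the half-plane `Re z ≤ 0`, so the exponentials also have norm at
  -- most one.
  · rw [Complex.norm_exp, Real.exp_le_one_iff]
    have := (Complex.abs_re_le_norm (1 + a i)).trans (h1 i hi)
    have := (abs_le.1 this).2
    simp at this
    exact this
  · rw [norm_sub_rev, ← sub_sub]
    exact Complex.norm_exp_sub_one_sub_id_le (h2 i hi)

/-! ### Separated sets of indices and abstract Poisson approximation -/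

/-- Any two elements of `S` are at distance at least `d`. -/
def Separated (d : ℕ) (S : Finset ℕ) : Prop := ∀ i ∈ S, ∀ j ∈ S, i < j → i + d ≤ j

open Classical in
/-- The elements of `T` with no predecessor in `T` at distance less than `d`. -/
noncomputable def leaders (d : ℕ) (T : Finset ℕ) : Finset ℕ :=
  T.filter fun i => ∀ j ∈ T, j < i → j + d ≤ i

open Classical in
/-- The `d`-separated subsets of `{0, …, n - 1}` with `k` elements. -/
noncomputable def sepSets (n d k : ℕ) : Finset (Finset ℕ) :=
  ((Finset.range n).powersetCard k).filter (Separated d)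

open Classical in
/-- The elements of `{0, …, n - 1}` outside `S` at distance less than `d` from `S`. -/
noncomputable def near (n d : ℕ) (S : Finset ℕ) : Finset ℕ :=
  (Finset.range n \ S).filter fun j => ∃ i ∈ S, i < j + d ∧ j < i + d

lemma mem_sepSets {n d k : ℕ} {S : Finset ℕ} :
    S ∈ sepSets n d k ↔ (S ⊆ Finset.range n ∧ S.card = k) ∧ Separated d S := by
  simp [sepSets, Finset.mem_powersetCard]

lemma mem_near {n d j : ℕ} {S : Finset ℕ} :
    j ∈ near n d S ↔ (j < n ∧ j ∉ S) ∧ ∃ i ∈ S, i < j + d ∧ j < i + d := by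
  simp [near]

lemma card_near_le (n d : ℕ) (S : Finset ℕ) : (near n d S).card ≤ 2 * d * S.card := by
  have h : near n d S ⊆ S.biUnion fun i => Finset.Ico (i + 1 - d) (i + d) := by
    intro j hj
    obtain ⟨-, i, hi, h1, h2⟩ := mem_near.1 hj
    exact Finset.mem_biUnion.2 ⟨i, hi, Finset.mem_Ico.2 ⟨by omega, h2⟩⟩
  refine (Finset.card_le_card h).trans ?_
  rw [mul_comm]
  refine Finset.card_biUnion_le_card_mul _ _ _ fun i _ => ?_
  rw [Nat.card_Ico]
  omega

lemma card_sepSets_le (n d k : ℕ) : ((sepSets n d k).card : ℝ) ≤ (n : ℝ) ^ k / k.factorial := by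
  refine le_trans ?_ (Nat.choose_le_pow_div k n)
  have : (sepSets n d k).card ≤ n.choose k := by
    refine (Finset.card_le_card (t := (Finset.range n).powersetCard k) fun S hS =>
      Finset.mem_powersetCard.2 (mem_sepSets.1 hS).1).trans ?_
    rw [Finset.card_powersetCard, Finset.card_range]
  exact_mod_cast this

lemma card_sepSets_le_pow (n d k : ℕ) : ((sepSets n d k).card : ℝ) ≤ (n : ℝ) ^ k :=
  (card_sepSets_le n d k).trans
    (div_le_self (by positivity) (by exact_mod_cast Nat.one_le_iff_ne_zero.2 k.factorial_ne_zero))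

lemma leaders_subset (d : ℕ) (T : Finset ℕ) : leaders d T ⊆ T := Finset.filter_subset _ _

lemma separated_of_subset_leaders {d : ℕ} {S T : Finset ℕ} (h : S ⊆ leaders d T) :
    Separated d S := by
  intro i hi j hj hij
  exact (Finset.mem_filter.1 (h hj)).2 i (leaders_subset d T (h hi)) hij

/-- An element of `S` that is not a leader has a predecessor in `T` at distance less than `d`, and
this predecessor is outside `S` because `S` is separated. So a single extra index witnesses the
failure, however crowded `T` is. -/
lemma exists_near_of_not_mem_leaders {n d : ℕ} {S T : Finset ℕ} (hT : T ⊆ Finset.range n)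
    (hS : Separated d S) (hST : S ⊆ T) (h : ¬ S ⊆ leaders d T) :
    ∃ j ∈ near n d S, insert j S ⊆ T := by
  obtain ⟨i, hi, hi'⟩ := Finset.not_subset.1 h
  simp only [leaders, Finset.mem_filter, not_and, not_forall] at hi'
  obtain ⟨j, hj, hji, hd⟩ := hi' (hST hi)
  refine ⟨j, mem_near.2 ⟨⟨Finset.mem_range.1 (hT hj), fun hjS => hd (hS j hjS i hi hji)⟩, i, hi,
    by omega, by omega⟩, Finset.insert_subset hj hST⟩

/-- The subsets of `{0, …, n - 1}` that are not separated are few. -/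
lemma card_powersetCard_sdiff_sepSets_le (n d k : ℕ) :
    (((Finset.range n).powersetCard k \ sepSets n d k).card : ℝ) * n ≤ 2 * k * d * (n : ℝ) ^ k := by
  classical
  cases k with
  | zero =>
    have : (Finset.range n).powersetCard 0 \ sepSets n d 0 = ∅ := by
      rw [Finset.sdiff_eq_empty_iff_subset, Finset.powersetCard_zero, Finset.singleton_subset_iff]
      exact mem_sepSets.2 ⟨⟨by simp, by simp⟩, by simp [Separated]⟩
    rw [this]
    simp
  | succ k =>
    have h : (Finset.range n).powersetCard (k + 1) \ sepSets n d (k + 1) ⊆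
        ((Finset.range n).powersetCard k).biUnion fun S =>
          (near n d S).image fun j => insert j S := by
      intro S hS
      rw [Finset.mem_sdiff, mem_sepSets, Finset.mem_powersetCard] at hS
      obtain ⟨⟨h1, h2⟩, h3⟩ := hS
      have h4 : ¬ Separated d S := fun h => h3 ⟨⟨h1, h2⟩, h⟩
      simp only [Separated, not_forall, not_le] at h4
      obtain ⟨i, hi, j, hj, hij, hd⟩ := h4
      -- Deleting the larger element of a close pair leaves at most `n ^ k` sets, each with at most
      -- `2 * d * k` nearby indices to restore.
      refine Finset.mem_biUnion.2 ⟨S.erase j, Finset.mem_powersetCard.2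
        ⟨(Finset.erase_subset _ _).trans h1, by rw [Finset.card_erase_of_mem hj, h2]; rfl⟩, ?_⟩
      refine Finset.mem_image.2 ⟨j, mem_near.2 ⟨⟨Finset.mem_range.1 (h1 hj), by simp⟩, i,
        Finset.mem_erase.2 ⟨hij.ne, hi⟩, by omega, by omega⟩, Finset.insert_erase hj⟩
    have h2 : ((Finset.range n).powersetCard (k + 1) \ sepSets n d (k + 1)).card ≤
        n ^ k * (2 * d * k) := by
      refine (Finset.card_le_card h).trans ?_
      refine (Finset.card_biUnion_le_card_mul _ _ (2 * d * k) fun S hS => ?_).trans ?_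
      · refine Finset.card_image_le.trans ((card_near_le n d S).trans ?_)
        rw [(Finset.mem_powersetCard.1 hS).2]
      · rw [Finset.card_powersetCard, Finset.card_range]
        exact Nat.mul_le_mul_right _ (Nat.choose_le_pow n k)
    have h3 : (((Finset.range n).powersetCard (k + 1) \ sepSets n d (k + 1)).card : ℝ) ≤
        (n : ℝ) ^ k * (2 * d * k) := by exact_mod_cast h2
    calc _ ≤ (n : ℝ) ^ k * (2 * d * k) * n := by gcongr
      _ ≤ (n : ℝ) ^ k * (2 * d * (k + 1)) * n := by gcongr; linarith
      _ = _ := by push_cast; ring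

/-- The sum over subsets of the leaders differs little from that over separated subsets. -/
lemma norm_sum_powersetCard_leaders_sub_le (n d k : ℕ) (T : Finset ℕ) (hT : T ⊆ Finset.range n)
    (w : ℕ → ℂ) (hw : ∀ i < n, i ∉ T → w i = 0) (hw2 : ∀ i, ‖w i‖ ≤ 2) :
    ‖∑ S ∈ (leaders d T).powersetCard k, ∏ i ∈ S, w i - ∑ S ∈ sepSets n d k, ∏ i ∈ S, w i‖ ≤
      2 ^ k * ∑ S ∈ sepSets n d k, ∑ j ∈ near n d S, if insert j S ⊆ T then (1 : ℝ) else 0 := by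
  classical
  have hsub : (leaders d T).powersetCard k ⊆ sepSets n d k := by
    intro S hS
    rw [Finset.mem_powersetCard] at hS
    exact mem_sepSets.2 ⟨⟨hS.1.trans ((leaders_subset d T).trans hT), hS.2⟩,
      separated_of_subset_leaders hS.1⟩
  rw [norm_sub_rev, ← Finset.sum_sdiff hsub, add_sub_cancel_right]
  have hnn : ∀ S, 0 ≤ ∑ j ∈ near n d S, if insert j S ⊆ T then (1 : ℝ) else 0 := fun S =>
    Finset.sum_nonneg fun j _ => by split_ifs <;> norm_num
  refine (norm_sum_le _ _).trans ?_
  rw [Finset.mul_sum]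
  refine (Finset.sum_le_sum fun S hS => ?_).trans (Finset.sum_le_sum_of_subset_of_nonneg
    Finset.sdiff_subset fun S _ _ => mul_nonneg (by positivity) (hnn S))
  rw [Finset.mem_sdiff, mem_sepSets, Finset.mem_powersetCard] at hS
  obtain ⟨⟨⟨h1, h2⟩, h3⟩, h4⟩ := hS
  -- Only `S ⊆ T` contributes, as otherwise some factor vanishes; and then the failure to consist of
  -- leaders produces a close index that pays for the term.
  by_cases hST : S ⊆ T
  · obtain ⟨j, hj, hj'⟩ := exists_near_of_not_mem_leaders hT h3 hST fun h => h4 ⟨h, h2⟩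
    have h5 : (1 : ℝ) ≤ ∑ j ∈ near n d S, if insert j S ⊆ T then (1 : ℝ) else 0 := by
      refine le_trans (by rw [if_pos hj']) (Finset.single_le_sum
        (f := fun j => if insert j S ⊆ T then (1 : ℝ) else 0)
        (fun j _ => by split_ifs <;> norm_num) hj)
    have h6 : ‖∏ i ∈ S, w i‖ ≤ 2 ^ k := by
      rw [norm_prod, ← h2]
      exact (Finset.prod_le_prod (fun i _ => norm_nonneg _) fun i _ => hw2 i).trans_eq
        (Finset.prod_const _)
    nlinarith [pow_pos (zero_lt_two (α := ℝ)) k]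
  · obtain ⟨i, hi, hi'⟩ := Finset.not_subset.1 hST
    rw [Finset.prod_eq_zero hi (hw i (Finset.mem_range.1 (h1 hi)) hi'), norm_zero]
    exact mul_nonneg (by positivity) (hnn S)

/-- The three errors come from replacing `T` by its leaders (which matters only if there is a close
pair), from truncating at order `K`, and from replacing sets of leaders by all separated sets.
Expanding over `T` itself would produce crowded sets, whose moments are not under control. -/
lemma norm_prod_sub_sum_sepSets_le (n d K : ℕ) (T : Finset ℕ) (hT : T ⊆ Finset.range n)
    (w : ℕ → ℂ) (hw : ∀ i < n, i ∉ T → w i = 0) (hw1 : ∀ i, ‖1 + w i‖ = 1) :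
    ‖∏ i ∈ Finset.range n, (1 + w i) -
        ∑ k ∈ Finset.range K, ∑ S ∈ sepSets n d k, ∏ i ∈ S, w i‖ ≤
      2 * (∑ S ∈ sepSets n d 1, ∑ j ∈ near n d S, if insert j S ⊆ T then (1 : ℝ) else 0) +
      2 ^ K * (∑ S ∈ sepSets n d K, if S ⊆ T then (1 : ℝ) else 0) +
      ∑ k ∈ Finset.range K, 2 ^ k *
        ∑ S ∈ sepSets n d k, ∑ j ∈ near n d S, if insert j S ⊆ T then (1 : ℝ) else 0 := by
  classical
  have hw2 : ∀ i, ‖w i‖ ≤ 2 := fun i => by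
    have := norm_sub_le (1 + w i) 1
    rw [add_sub_cancel_left, hw1, norm_one] at this
    linarith
  have hle : ∀ U : Finset ℕ, ‖∏ i ∈ U, (1 + w i)‖ = 1 := fun U => by
    rw [norm_prod]
    exact Finset.prod_eq_one fun i _ => hw1 i
  have e1 : ∏ i ∈ Finset.range n, (1 + w i) = ∏ i ∈ T, (1 + w i) := by
    refine (Finset.prod_subset hT fun i hi hi' => ?_).symm
    rw [hw i (Finset.mem_range.1 hi) hi', add_zero]
  have b1 : ‖∏ i ∈ T, (1 + w i) - ∏ i ∈ leaders d T, (1 + w i)‖ ≤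
      2 * (∑ S ∈ sepSets n d 1, ∑ j ∈ near n d S, if insert j S ⊆ T then (1 : ℝ) else 0) := by
    have hnn : ∀ S, 0 ≤ ∑ j ∈ near n d S, if insert j S ⊆ T then (1 : ℝ) else 0 := fun S =>
      Finset.sum_nonneg fun j _ => by split_ifs <;> norm_num
    by_cases h : T ⊆ leaders d T
    · rw [(leaders_subset d T).antisymm h, sub_self, norm_zero]
      exact mul_nonneg (by norm_num) (Finset.sum_nonneg fun S _ => hnn S)
    · obtain ⟨i, hi, hi'⟩ := Finset.not_subset.1 h
      have hs : Separated d {i} := by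
        intro a ha b hb hab
        rw [Finset.mem_singleton] at ha hb
        omega
      obtain ⟨j, hj, hj'⟩ := exists_near_of_not_mem_leaders hT hs
        (Finset.singleton_subset_iff.2 hi) fun h => hi' (h (Finset.mem_singleton_self i))
      have hS : {i} ∈ sepSets n d 1 :=
        mem_sepSets.2 ⟨⟨Finset.singleton_subset_iff.2 (hT hi), by simp⟩, hs⟩
      have h1 := Finset.single_le_sum
        (f := fun S => ∑ j ∈ near n d S, if insert j S ⊆ T then (1 : ℝ) else 0)
        (fun S _ => hnn S) hS
      have h2 : (1 : ℝ) ≤ ∑ j ∈ near n d {i}, if insert j {i} ⊆ T then (1 : ℝ) else 0 :=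
        le_trans (by rw [if_pos hj']) (Finset.single_le_sum
          (f := fun j => if insert j {i} ⊆ T then (1 : ℝ) else 0)
          (fun j _ => by split_ifs <;> norm_num) hj)
      have h3 := norm_sub_le (∏ i ∈ T, (1 + w i)) (∏ i ∈ leaders d T, (1 + w i))
      rw [hle, hle] at h3
      linarith
  have b2 : ‖∏ i ∈ leaders d T, (1 + w i) -
      ∑ k ∈ Finset.range K, ∑ S ∈ (leaders d T).powersetCard k, ∏ i ∈ S, w i‖ ≤
      2 ^ K * (∑ S ∈ sepSets n d K, if S ⊆ T then (1 : ℝ) else 0) := by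
    refine (norm_prod_sub_sum_powersetCard_le w _ (fun i _ => (hw1 i).le) K).trans ?_
    rw [Finset.mul_sum]
    have hsub : (leaders d T).powersetCard K ⊆ sepSets n d K := by
      intro S hS
      rw [Finset.mem_powersetCard] at hS
      exact mem_sepSets.2 ⟨⟨hS.1.trans ((leaders_subset d T).trans hT), hS.2⟩,
        separated_of_subset_leaders hS.1⟩
    refine (Finset.sum_le_sum fun S hS => ?_).trans
      (Finset.sum_le_sum_of_subset_of_nonneg hsub fun S _ _ => ?_)
    · rw [Finset.mem_powersetCard] at hS
      rw [if_pos (hS.1.trans (leaders_subset d T)), mul_one, ← hS.2]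
      exact (Finset.prod_le_prod (fun i _ => norm_nonneg _) fun i _ => hw2 i).trans_eq
        (Finset.prod_const _)
    · split_ifs <;> simp
  have b3 : ‖∑ k ∈ Finset.range K, ∑ S ∈ (leaders d T).powersetCard k, ∏ i ∈ S, w i -
      ∑ k ∈ Finset.range K, ∑ S ∈ sepSets n d k, ∏ i ∈ S, w i‖ ≤
      ∑ k ∈ Finset.range K, 2 ^ k *
        ∑ S ∈ sepSets n d k, ∑ j ∈ near n d S, if insert j S ⊆ T then (1 : ℝ) else 0 := by
    rw [← Finset.sum_sub_distrib]
    exact norm_sum_le_of_le _ fun k _ => norm_sum_powersetCard_leaders_sub_le n d k T hT w hw hw2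
  rw [e1]
  calc _ = ‖(∏ i ∈ T, (1 + w i) - ∏ i ∈ leaders d T, (1 + w i)) +
        (∏ i ∈ leaders d T, (1 + w i) -
          ∑ k ∈ Finset.range K, ∑ S ∈ (leaders d T).powersetCard k, ∏ i ∈ S, w i) +
        (∑ k ∈ Finset.range K, ∑ S ∈ (leaders d T).powersetCard k, ∏ i ∈ S, w i -
          ∑ k ∈ Finset.range K, ∑ S ∈ sepSets n d k, ∏ i ∈ S, w i)‖ := by congr 1; ring
    _ ≤ _ := (norm_add₃_le).trans (add_le_add (add_le_add b1 b2) b3)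

/-- Deterministic counterpart, applied to `a i = E w_i`: each product over a set of size `k` is at
most `(B / n) ^ k`, and only a proportion of order `d / n` of the sets fails to be separated. -/
lemma norm_prod_one_add_sub_sum_sepSets_le (n d K : ℕ) (hn : 0 < n) (a : ℕ → ℂ) (B : ℝ)
    (hB : 0 ≤ B) (h1 : ∀ i < n, ‖1 + a i‖ ≤ 1) (h2 : ∀ i < n, ‖a i‖ * n ≤ B) :
    ‖∏ i ∈ Finset.range n, (1 + a i) -
        ∑ k ∈ Finset.range K, ∑ S ∈ sepSets n d k, ∏ i ∈ S, a i‖ ≤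
      B ^ K / K.factorial + ∑ k ∈ Finset.range K, 2 * k * d * B ^ k / n := by
  have hn' : (0 : ℝ) < n := by exact_mod_cast hn
  have hp : ∀ (k : ℕ) (S : Finset ℕ), S ∈ (Finset.range n).powersetCard k →
      ∏ i ∈ S, ‖a i‖ ≤ (B / n) ^ k := by
    intro k S hS
    rw [Finset.mem_powersetCard] at hS
    rw [← hS.2, ← Finset.prod_const]
    refine Finset.prod_le_prod (fun i _ => norm_nonneg _) fun i hi => ?_
    rw [le_div_iff₀ hn']
    exact h2 i (Finset.mem_range.1 (hS.1 hi))
  have b1 : ‖∏ i ∈ Finset.range n, (1 + a i) -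
      ∑ k ∈ Finset.range K, ∑ S ∈ (Finset.range n).powersetCard k, ∏ i ∈ S, a i‖ ≤
      B ^ K / K.factorial := by
    refine (norm_prod_sub_sum_powersetCard_le a _ (fun i hi => h1 i (Finset.mem_range.1 hi))
      K).trans ((Finset.sum_le_card_nsmul _ _ _ (hp K)).trans ?_)
    rw [Finset.card_powersetCard, Finset.card_range, nsmul_eq_mul]
    calc ((n.choose K : ℕ) : ℝ) * (B / n) ^ K ≤ (n : ℝ) ^ K / K.factorial * (B / n) ^ K := by
          gcongr
          exact Nat.choose_le_pow_div K n
      _ = _ := by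
          rw [div_pow]
          field_simp
  have b2 : ∀ k, ‖∑ S ∈ (Finset.range n).powersetCard k, ∏ i ∈ S, a i -
      ∑ S ∈ sepSets n d k, ∏ i ∈ S, a i‖ ≤ 2 * k * d * B ^ k / n := by
    intro k
    have hsub : sepSets n d k ⊆ (Finset.range n).powersetCard k := fun S hS =>
      Finset.mem_powersetCard.2 (mem_sepSets.1 hS).1
    rw [← Finset.sum_sdiff hsub, add_sub_cancel_right]
    refine (norm_sum_le_of_le _ fun S hS => ?_).trans
      ((Finset.sum_const ((B / n) ^ k)).trans_le ?_)
    · rw [norm_prod]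
      exact hp k S (Finset.sdiff_subset hS)
    · rw [nsmul_eq_mul, le_div_iff₀ hn']
      calc _ = (((Finset.range n).powersetCard k \ sepSets n d k).card : ℝ) * n * (B / n) ^ k := by
            ring
        _ ≤ 2 * k * d * (n : ℝ) ^ k * (B / n) ^ k := by
            exact mul_le_mul_of_nonneg_right (card_powersetCard_sdiff_sepSets_le n d k)
              (by positivity)
        _ = _ := by
            rw [div_pow]
            field_simp
  calc _ = ‖(∏ i ∈ Finset.range n, (1 + a i) -
      ∑ k ∈ Finset.range K, ∑ S ∈ (Finset.range n).powersetCard k, ∏ i ∈ S, a i) +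
      ∑ k ∈ Finset.range K, (∑ S ∈ (Finset.range n).powersetCard k, ∏ i ∈ S, a i -
        ∑ S ∈ sepSets n d k, ∏ i ∈ S, a i)‖ := by
        rw [Finset.sum_sub_distrib]; congr 1; ring
    _ ≤ _ := (norm_add_le _ _).trans (add_le_add b1 (norm_sum_le_of_le _ fun k _ => b2 k))

/-- Poisson approximation for a sum over weakly dependent rare events `A i`, `i < n`, given that
the joint moments factorize over separated sets of indices, and that close pairs are unlikely. -/
lemma norm_integral_prod_sub_prod_le {Ω : Type*} [MeasurableSpace Ω] (P : Measure Ω)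
    [IsProbabilityMeasure P] (n d K : ℕ) (hn : 0 < n) (hd : 0 < d) (hK : 2 ≤ K)
    (A : ℕ → Set Ω) (hA : ∀ i, MeasurableSet (A i))
    (w : ℕ → Ω → ℂ) (hwm : ∀ i, Measurable (w i)) (hw0 : ∀ i ω, ω ∉ A i → w i ω = 0)
    (hw1 : ∀ i ω, ‖1 + w i ω‖ = 1) (B e₁ e₂ : ℝ) (hB : 1 ≤ B) (he₂ : 0 ≤ e₂)
    (H1 : ∀ k < K, ∀ S ∈ sepSets n d k,
      ‖∫ ω, ∏ i ∈ S, w i ω ∂P - ∏ i ∈ S, ∫ ω, w i ω ∂P‖ * n ^ k ≤ e₁)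
    (H2 : ∀ S ∈ sepSets n d K, P.real (⋂ i ∈ S, A i) * n ^ K ≤ B ^ K)
    (H3 : ∀ k < K, ∀ S ∈ sepSets n d k, ∀ j ∈ near n d S,
      P.real (⋂ i ∈ insert j S, A i) * (n ^ k * d) ≤ e₂)
    (H4 : ∀ i < n, ‖∫ ω, w i ω ∂P‖ * n ≤ B) :
    ‖∫ ω, ∏ i ∈ Finset.range n, (1 + w i ω) ∂P -
        ∏ i ∈ Finset.range n, (1 + ∫ ω, w i ω ∂P)‖ ≤
      4 * e₂ + 2 * ((2 * B) ^ K / K.factorial) +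
        K * (2 ^ (K + 1) * K * e₂ + e₁ + 2 * K * d * B ^ K / n) := by
  classical
  have hn' : (0 : ℝ) < n := by exact_mod_cast hn
  have hd' : (0 : ℝ) < d := by exact_mod_cast hd
  have hw2 : ∀ i ω, ‖w i ω‖ ≤ 2 := fun i ω => by
    have := norm_sub_le (1 + w i ω) 1
    rw [add_sub_cancel_left, hw1, norm_one] at this
    linarith
  set T : Ω → Finset ℕ := fun ω => (Finset.range n).filter fun i => ω ∈ A i with hT
  have hTsub : ∀ ω, T ω ⊆ Finset.range n := fun ω => Finset.filter_subset _ _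
  have hTw : ∀ ω, ∀ i < n, i ∉ T ω → w i ω = 0 := fun ω i hi h => hw0 i ω fun hA => h
    (Finset.mem_filter.2 ⟨Finset.mem_range.2 hi, hA⟩)
  have hind : ∀ S : Finset ℕ, S ⊆ Finset.range n →
      (fun ω => if S ⊆ T ω then (1 : ℝ) else 0) = (⋂ i ∈ S, A i).indicator 1 := by
    intro S hS
    ext ω
    rw [Set.indicator_apply]
    congr 1
    rw [Set.mem_iInter₂, eq_iff_iff]
    exact ⟨fun h i hi => (Finset.mem_filter.1 (h hi)).2,
      fun h i hi => Finset.mem_filter.2 ⟨hS hi, h i hi⟩⟩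
  have hmeas : ∀ S : Finset ℕ, MeasurableSet (⋂ i ∈ S, A i) := fun S =>
    S.measurableSet_biInter fun i _ => hA i
  have hint : ∀ S : Finset ℕ, S ⊆ Finset.range n →
      Integrable (fun ω => if S ⊆ T ω then (1 : ℝ) else 0) P := fun S hS => by
    rw [hind S hS]
    exact (integrable_const 1).indicator (hmeas S)
  have hintv : ∀ S : Finset ℕ, S ⊆ Finset.range n →
      ∫ ω, (if S ⊆ T ω then (1 : ℝ) else 0) ∂P = P.real (⋂ i ∈ S, A i) := fun S hS => by
    rw [hind S hS, integral_indicator_one (hmeas S)]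
  have hpw : ∀ S : Finset ℕ, Integrable (fun ω => ∏ i ∈ S, w i ω) P := fun S => by
    refine Integrable.of_bound
      (Finset.measurable_fun_prod S fun i _ => hwm i).aestronglyMeasurable (2 ^ S.card)
      (Eventually.of_forall fun ω => ?_)
    rw [norm_prod, ← Finset.prod_const]
    exact Finset.prod_le_prod (fun i _ => norm_nonneg _) fun i _ => hw2 i ω
  have hp1 : Integrable (fun ω => ∏ i ∈ Finset.range n, (1 + w i ω)) P := by
    refine Integrable.of_bound (Finset.measurable_fun_prod _ fun i _ =>
      (hwm i).const_add 1).aestronglyMeasurable 1 (Eventually.of_forall fun ω => ?_)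
    rw [norm_prod]
    exact Finset.prod_le_one (fun i _ => norm_nonneg _) fun i _ => (hw1 i ω).le
  have hsub : ∀ {k S}, S ∈ sepSets n d k → S ⊆ Finset.range n := fun h => (mem_sepSets.1 h).1.1
  have hsub' : ∀ {k S j}, S ∈ sepSets n d k → j ∈ near n d S → insert j S ⊆ Finset.range n :=
    fun h hj => Finset.insert_subset (Finset.mem_range.2 (mem_near.1 hj).1.1) (hsub h)
  -- the mass of the close pairs
  have hclose : ∀ k, Integrable (fun ω => ∑ S ∈ sepSets n d k, ∑ j ∈ near n d S,
      if insert j S ⊆ T ω then (1 : ℝ) else 0) P := fun k =>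
    integrable_finsetSum _ fun S hS => integrable_finsetSum _ fun j hj => hint _ (hsub' hS hj)
  have hclosev : ∀ k < K, ∫ ω, ∑ S ∈ sepSets n d k, ∑ j ∈ near n d S,
      (if insert j S ⊆ T ω then (1 : ℝ) else 0) ∂P ≤ 2 * k * e₂ := by
    intro k hk
    rw [integral_finsetSum _ fun S hS => integrable_finsetSum _ fun j hj =>
      hint _ (hsub' hS hj)]
    have hS : ∀ S ∈ sepSets n d k, ∫ ω, ∑ j ∈ near n d S,
        (if insert j S ⊆ T ω then (1 : ℝ) else 0) ∂P ≤ 2 * k * e₂ / n ^ k := by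
      intro S hS
      rw [integral_finsetSum _ fun j hj => hint _ (hsub' hS hj)]
      have h1 : ∀ j ∈ near n d S, ∫ ω, (if insert j S ⊆ T ω then (1 : ℝ) else 0) ∂P ≤
          e₂ / (n ^ k * d) := fun j hj => by
        rw [hintv _ (hsub' hS hj), le_div_iff₀ (by positivity)]
        exact H3 k hk S hS j hj
      refine (Finset.sum_le_card_nsmul _ _ _ h1).trans ?_
      have h2 : ((near n d S).card : ℝ) ≤ 2 * d * k := by
        rw [← (mem_sepSets.1 hS).1.2]
        exact_mod_cast card_near_le n d S
      rw [nsmul_eq_mul]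
      calc _ ≤ 2 * d * k * (e₂ / (n ^ k * d)) := by gcongr
        _ = _ := by field_simp
    refine (Finset.sum_le_card_nsmul _ _ _ hS).trans ?_
    rw [nsmul_eq_mul]
    calc _ ≤ (n : ℝ) ^ k * (2 * k * e₂ / n ^ k) := by
          gcongr
          exact card_sepSets_le_pow n d k
      _ = _ := by field_simp
  have htop : Integrable (fun ω => ∑ S ∈ sepSets n d K, if S ⊆ T ω then (1 : ℝ) else 0) P :=
    integrable_finsetSum _ fun S hS => hint _ (hsub hS)
  have htopv : ∫ ω, ∑ S ∈ sepSets n d K, (if S ⊆ T ω then (1 : ℝ) else 0) ∂P ≤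
      B ^ K / K.factorial := by
    rw [integral_finsetSum _ fun S hS => hint _ (hsub hS)]
    have hS : ∀ S ∈ sepSets n d K, ∫ ω, (if S ⊆ T ω then (1 : ℝ) else 0) ∂P ≤ B ^ K / n ^ K := by
      intro S hS
      rw [hintv _ (hsub hS), le_div_iff₀ (by positivity)]
      exact H2 S hS
    refine (Finset.sum_le_card_nsmul _ _ _ hS).trans ?_
    rw [nsmul_eq_mul]
    calc _ ≤ (n : ℝ) ^ K / K.factorial * (B ^ K / n ^ K) := by
          gcongr
          exact card_sepSets_le n d K
      _ = _ := by field_simp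
  -- the random expansion
  have c1 : ‖∫ ω, ∏ i ∈ Finset.range n, (1 + w i ω) ∂P -
      ∑ k ∈ Finset.range K, ∑ S ∈ sepSets n d k, ∫ ω, ∏ i ∈ S, w i ω ∂P‖ ≤
      4 * e₂ + 2 ^ K * (B ^ K / K.factorial) + ∑ k ∈ Finset.range K, 2 ^ k * (2 * k * e₂) := by
    have hs : ∑ k ∈ Finset.range K, ∑ S ∈ sepSets n d k, ∫ ω, ∏ i ∈ S, w i ω ∂P =
        ∫ ω, ∑ k ∈ Finset.range K, ∑ S ∈ sepSets n d k, ∏ i ∈ S, w i ω ∂P := by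
      rw [integral_finsetSum _ fun k _ => integrable_finsetSum _ fun S _ => hpw S]
      exact Finset.sum_congr rfl fun k _ => (integral_finsetSum _ fun S _ => hpw S).symm
    rw [hs, ← integral_sub hp1
      (integrable_finsetSum _ fun k _ => integrable_finsetSum _ fun S _ => hpw S)]
    have htot : Integrable (fun ω => ∑ k ∈ Finset.range K, 2 ^ k * ∑ S ∈ sepSets n d k,
        ∑ j ∈ near n d S, if insert j S ⊆ T ω then (1 : ℝ) else 0) P :=
      integrable_finsetSum _ fun k _ => (hclose k).const_mul _
    refine (norm_integral_le_of_norm_le ?_ (Eventually.of_forall fun ω =>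
      norm_prod_sub_sum_sepSets_le n d K (T ω) (hTsub ω) (fun i => w i ω) (hTw ω)
        fun i => hw1 i ω)).trans ?_
    · exact (((hclose 1).const_mul 2).add (htop.const_mul _)).add
        htot
    · rw [integral_add ?_ htot,
        integral_add ((hclose 1).const_mul 2) (htop.const_mul _), integral_const_mul,
        integral_const_mul,
        integral_finsetSum (Finset.range K) fun k _ => (hclose k).const_mul _]
      · refine add_le_add (add_le_add ?_ ?_) (Finset.sum_le_sum fun k hk => ?_)
        · have := hclosev 1 (by omega)
          push_cast at this
          linarith
        · gcongr
        · rw [integral_const_mul]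
          gcongr
          exact hclosev k (Finset.mem_range.1 hk)
      · exact ((hclose 1).const_mul 2).add (htop.const_mul _)
  have c2 : ‖∑ k ∈ Finset.range K, ∑ S ∈ sepSets n d k, ∫ ω, ∏ i ∈ S, w i ω ∂P -
      ∑ k ∈ Finset.range K, ∑ S ∈ sepSets n d k, ∏ i ∈ S, ∫ ω, w i ω ∂P‖ ≤
      ∑ k ∈ Finset.range K, e₁ := by
    rw [← Finset.sum_sub_distrib]
    refine norm_sum_le_of_le _ fun k hk => ?_
    rw [← Finset.sum_sub_distrib]
    have hS : ∀ S ∈ sepSets n d k,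
        ‖∫ ω, ∏ i ∈ S, w i ω ∂P - ∏ i ∈ S, ∫ ω, w i ω ∂P‖ ≤ e₁ / n ^ k := by
      intro S hS
      rw [le_div_iff₀ (by positivity)]
      exact H1 k (Finset.mem_range.1 hk) S hS
    refine (norm_sum_le_of_le _ hS).trans ?_
    rw [Finset.sum_const, nsmul_eq_mul]
    -- If there is no separated set of size `k`, what is needed is `0 ≤ e₁`; this is read off `H1`
    -- at the empty set.
    rcases (sepSets n d k).eq_empty_or_nonempty with h0 | ⟨S, hS'⟩
    · rw [h0]
      simp only [Finset.card_empty, Nat.cast_zero, zero_mul]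
      exact (mul_nonneg (norm_nonneg _) (by positivity)).trans
        (H1 0 (by omega) ∅ (mem_sepSets.2 ⟨⟨by simp, by simp⟩, by simp [Separated]⟩))
    · have h0 : 0 ≤ e₁ / n ^ k := (norm_nonneg _).trans (hS S hS')
      calc _ ≤ (n : ℝ) ^ k * (e₁ / n ^ k) := by
            gcongr
            exact card_sepSets_le_pow n d k
        _ = _ := by field_simp
  -- `1 + E w_i` is an average of numbers of modulus one, hence in the unit disc.
  have c3 := norm_prod_one_add_sub_sum_sepSets_le n d K hn (fun i => ∫ ω, w i ω ∂P) B
    (by linarith) (fun i _ => by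
      have : (1 : ℂ) + ∫ ω, w i ω ∂P = ∫ ω, (1 + w i ω) ∂P := by
        rw [integral_add (integrable_const _)]
        · simp
        · simpa using hpw {i}
      rw [this]
      refine (norm_integral_le_of_norm_le_const (C := 1)
        (Eventually.of_forall fun ω => (hw1 i ω).le)).trans ?_
      simp) H4
  have d1 : ∑ k ∈ Finset.range K, (2 : ℝ) ^ k * (2 * k * e₂) ≤ K * (2 ^ (K + 1) * K * e₂) := by
    refine (Finset.sum_le_card_nsmul _ _ (2 ^ (K + 1) * K * e₂) fun k hk => ?_).trans ?_
    · have hk' : (k : ℝ) ≤ K := by exact_mod_cast (Finset.mem_range.1 hk).le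
      have : (2 : ℝ) ^ k ≤ 2 ^ K :=
        pow_le_pow_right₀ (by norm_num) (Finset.mem_range.1 hk).le
      calc (2 : ℝ) ^ k * (2 * k * e₂) ≤ 2 ^ K * (2 * K * e₂) := by gcongr
        _ = _ := by ring
    · rw [Finset.card_range, nsmul_eq_mul]
  have d2 : ∑ k ∈ Finset.range K, 2 * k * d * B ^ k / n ≤ K * (2 * K * d * B ^ K / n) := by
    refine (Finset.sum_le_card_nsmul _ _ (2 * K * d * B ^ K / n) fun k hk => ?_).trans ?_
    · have hk' : (k : ℝ) ≤ K := by exact_mod_cast (Finset.mem_range.1 hk).le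
      have : B ^ k ≤ B ^ K := pow_le_pow_right₀ hB (Finset.mem_range.1 hk).le
      gcongr
    · rw [Finset.card_range, nsmul_eq_mul]
  have d3 : B ^ K / K.factorial ≤ (2 * B) ^ K / K.factorial := by
    gcongr
    linarith
  rw [Finset.sum_const, Finset.card_range, nsmul_eq_mul] at c2
  rw [norm_sub_rev] at c3
  rw [← mul_div_assoc, ← mul_pow] at c1
  have htri := norm_add₃_le (a := ∫ ω, ∏ i ∈ Finset.range n, (1 + w i ω) ∂P -
      ∑ k ∈ Finset.range K, ∑ S ∈ sepSets n d k, ∫ ω, ∏ i ∈ S, w i ω ∂P)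
    (b := ∑ k ∈ Finset.range K, ∑ S ∈ sepSets n d k, ∫ ω, ∏ i ∈ S, w i ω ∂P -
      ∑ k ∈ Finset.range K, ∑ S ∈ sepSets n d k, ∏ i ∈ S, ∫ ω, w i ω ∂P)
    (c := ∑ k ∈ Finset.range K, ∑ S ∈ sepSets n d k, ∏ i ∈ S, ∫ ω, w i ω ∂P -
      ∏ i ∈ Finset.range n, (1 + ∫ ω, w i ω ∂P))
  rw [sub_add_sub_cancel, sub_add_sub_cancel] at htri
  linarith

/-! ### Gap events, stationarity and the gap probability -/

section PointProcess

variable {Ω : Type u} [MeasurableSpace Ω] {P : Measure Ω} {Z : Ω → Set ℝ}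

lemma counting_apply (S : Set ℝ) {B : Set ℝ} (hB : MeasurableSet B) :
    counting S B = Measure.count (B ∩ S) := Measure.restrict_apply hB

lemma counting_eq_zero_iff (S : Set ℝ) {B : Set ℝ} (hB : MeasurableSet B) :
    counting S B = 0 ↔ S ∩ B = ∅ := by
  rw [counting_apply S hB, Measure.count_eq_zero_iff, Set.inter_comm]

lemma counting_image_add (S : Set ℝ) (t : ℝ) :
    counting ((fun x => x + t) '' S) = (counting S).map fun x => x + t := by
  ext B hB
  have hm : Measurable fun x : ℝ => x + t := by fun_prop
  rw [Measure.map_apply hm hB, counting_apply _ hB, counting_apply _ (hm hB),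
    ← Set.image_preimage_inter, Measure.count_injective_image (add_left_injective t)]

omit [MeasurableSpace Ω] in
lemma gapEvent_eq (Z : Ω → Set ℝ) {B : Set ℝ} (hB : MeasurableSet B) :
    gapEvent Z B = {ω | counting (Z ω) B = 0} := by
  ext ω
  exact (counting_eq_zero_iff (Z ω) hB).symm

omit [MeasurableSpace Ω] in
lemma gapEvent_anti (Z : Ω → Set ℝ) {I J : Set ℝ} (h : I ⊆ J) : gapEvent Z J ⊆ gapEvent Z I :=
  fun _ hω => Set.eq_empty_of_subset_empty fun _ hx => (Set.eq_empty_iff_forall_notMem.1 hω _)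
    ⟨hx.1, h hx.2⟩

namespace IsStationaryPointProcess

lemma measurableSet_gapEvent (hZ : IsStationaryPointProcess P Z) {B : Set ℝ}
    (hB : MeasurableSet B) : MeasurableSet (gapEvent Z B) := by
  rw [gapEvent_eq Z hB]
  exact (Measure.measurable_coe hB).comp hZ.measurable (measurableSet_singleton 0)

/-- Stationarity under the translation by `-a`, tested on the set of measures that do not charge
`[0, b - a]`. -/
lemma real_gapEvent_Icc (hZ : IsStationaryPointProcess P Z) (a b : ℝ) :
    P.real (gapEvent Z (Set.Icc a b)) = gapProb P Z (b - a) := by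
  have h := congrArg (fun μ => μ {ν : Measure ℝ | ν (Set.Icc 0 (b - a)) = 0}) (hZ.stationary (-a))
  have hm : Measurable fun ω => counting ((fun x => x + -a) '' Z ω) := by
    simp_rw [counting_image_add]
    exact (Measure.measurable_map _ (by fun_prop)).comp hZ.measurable
  have hs : MeasurableSet {ν : Measure ℝ | ν (Set.Icc 0 (b - a)) = 0} :=
    Measure.measurable_coe measurableSet_Icc (measurableSet_singleton 0)
  simp only [Measure.map_apply hm hs, Measure.map_apply hZ.measurable hs] at h
  rw [gapProb, Measure.real, Measure.real, gapEvent_eq Z measurableSet_Icc,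
    gapEvent_eq Z measurableSet_Icc]
  congr 1
  refine Eq.trans ?_ h
  congr 1
  ext ω
  simp only [Set.mem_ofPred_eq, Set.mem_preimage]
  rw [counting_image_add, Measure.map_apply (by fun_prop) measurableSet_Icc]
  simp

end IsStationaryPointProcess

lemma gapProb_antitone [IsFiniteMeasure P] : Antitone (gapProb P Z) := fun _ _ h =>
  measureReal_mono (gapEvent_anti Z (Set.Icc_subset_Icc_right h))

lemma gapProb_nonneg (r : ℝ) : 0 ≤ gapProb P Z r := measureReal_nonneg

lemma gapProb_le_one [IsProbabilityMeasure P] (r : ℝ) : gapProb P Z r ≤ 1 := measureReal_le_one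

section Decay

variable [IsProbabilityMeasure P] (h_decay : GapDecay P Z)

omit [IsProbabilityMeasure P] in
include h_decay in
lemma GapDecay.eventually_le (a : ℝ) :
    ∀ᶠ r in atTop, 0 < gapProb P Z r ∧ Real.log (gapProb P Z r) ≤ -a * Real.log r := by
  -- The lower bound by 1 excludes `G(r) = 0`, for which `Real.log` takes the value 0 and the ratio
  -- would vanish.
  filter_upwards [h_decay.eventually_ge_atTop (max a 1), eventually_gt_atTop 1] with r hr hr1
  have hl : 0 < Real.log r := Real.log_pos hr1
  have h1 := (le_max_left a 1).trans hr
  have h2 := (le_max_right a 1).trans hr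
  rw [le_div_iff₀ hl] at h1 h2
  refine ⟨lt_of_le_of_ne (gapProb_nonneg r) fun h => ?_, by linarith⟩
  rw [← h, Real.log_zero] at h2
  linarith

include h_decay in
lemma GapDecay.pos (r : ℝ) : 0 < gapProb P Z r := by
  obtain ⟨s, hs, hrs⟩ := ((h_decay.eventually_le 1).and (eventually_ge_atTop r)).exists
  exact hs.1.trans_le (gapProb_antitone hrs)

include h_decay in
lemma GapDecay.tendsto_zero : Tendsto (gapProb P Z) atTop (𝓝 0) := by
  refine tendsto_of_tendsto_of_tendsto_of_le_of_le' tendsto_const_nhds tendsto_inv_atTop_zero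
    (Eventually.of_forall fun r => gapProb_nonneg r) ?_
  filter_upwards [h_decay.eventually_le 1, eventually_gt_atTop 0] with r hr hr0
  rw [← Real.log_le_log_iff hr.1 (inv_pos.2 hr0), Real.log_inv]
  linarith [hr.2]

include h_decay in
-- A half-line contains intervals of every length `r`, so it is free of points with probability at
-- most `G(r) → 0`. Hence almost surely every point has a successor.
lemma IsStationaryPointProcess.ae_unbounded (hZ : IsStationaryPointProcess P Z) :
    ∀ᵐ ω ∂P, ∀ a : ℝ, (Z ω ∩ Set.Ioi a).Nonempty := by
  have h : ∀ k : ℕ, ∀ᵐ ω ∂P, (Z ω ∩ Set.Ioi (k : ℝ)).Nonempty := by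
    intro k
    have h0 : P.real (gapEvent Z (Set.Ioi (k : ℝ))) ≤ 0 := by
      refine ge_of_tendsto' h_decay.tendsto_zero fun r => ?_
      have := hZ.real_gapEvent_Icc (k + 1) (k + 1 + r)
      rw [add_sub_cancel_left] at this
      rw [← this]
      exact measureReal_mono (gapEvent_anti Z fun x hx => by
        have := hx.1
        simp only [Set.mem_Ioi]
        linarith)
    have h1 : P (gapEvent Z (Set.Ioi (k : ℝ))) = 0 :=
      (measureReal_eq_zero_iff).1 (le_antisymm h0 measureReal_nonneg)
    filter_upwards [measure_eq_zero_iff_ae_notMem.1 h1] with ω hω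
    rwa [Set.nonempty_iff_ne_empty]
  filter_upwards [ae_all_iff.2 h] with ω hω a
  obtain ⟨k, hk⟩ := exists_nat_gt a
  exact (hω k).mono (Set.inter_subset_inter_right _ (Set.Ioi_subset_Ioi hk.le))

variable (h_regular : GapRegularity P Z)

omit [IsProbabilityMeasure P] in
include h_regular in
lemma GapRegularity.differentiableAt {r : ℝ} (hr : 0 < r) : DifferentiableAt ℝ (gapProb P Z) r :=
  h_regular.differentiable.differentiableAt (Ioi_mem_nhds hr)

omit [IsProbabilityMeasure P] in
include h_regular in
lemma GapRegularity.differentiableAt_deriv {r : ℝ} (hr : 0 < r) :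
    DifferentiableAt ℝ (deriv (gapProb P Z)) r :=
  h_regular.twice_differentiable.differentiableAt (Ioi_mem_nhds hr)

include h_regular in
lemma GapRegularity.monotoneOn_deriv : MonotoneOn (deriv (gapProb P Z)) (Set.Ioi 0) :=
  (h_regular.convex.subset Set.Ioi_subset_Ici_self (convex_Ioi 0)).monotoneOn_deriv
    fun _ hr => h_regular.differentiableAt hr

include h_regular in
/-- The increments of `G` compared with its derivative. -/
lemma GapRegularity.increment_bounds {a b : ℝ} (ha : 0 < a) (hab : a ≤ b) :
    (b - a) * -deriv (gapProb P Z) b ≤ gapProb P Z a - gapProb P Z b ∧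
      gapProb P Z a - gapProb P Z b ≤ (b - a) * -deriv (gapProb P Z) a := by
  rcases hab.eq_or_lt with rfl | hab
  · simp
  obtain ⟨c, hc, hc'⟩ := exists_deriv_eq_slope (gapProb P Z) hab
    (h_regular.differentiable.continuousOn.mono fun x hx => ha.trans_le hx.1)
    (h_regular.differentiable.mono fun x hx => ha.trans hx.1)
  rw [eq_div_iff (sub_pos.2 hab).ne'] at hc'
  have h1 := h_regular.monotoneOn_deriv (ha.trans hc.1) (ha.trans hab) hc.2.le
  have h2 := h_regular.monotoneOn_deriv ha (ha.trans hc.1) hc.1.le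
  constructor <;> nlinarith

include h_decay h_regular in
-- A nonnegative slope at `r` would, by convexity, keep `G` above `G(r) > 0` from there on, against
-- `G → 0`.
lemma GapRegularity.deriv_neg {r : ℝ} (hr : 0 < r) : deriv (gapProb P Z) r < 0 := by
  by_contra! h
  obtain ⟨b, hb, hrb⟩ := ((h_decay.tendsto_zero.eventually_lt_const (h_decay.pos r)).and
    (eventually_ge_atTop r)).exists
  have := (h_regular.increment_bounds hr hrb).2
  nlinarith

include h_decay h_regular in
-- Convexity gives `-G'(r) ≤ G(r - 1) - G(r) ≤ G(r - 1)`.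
lemma GapRegularity.tendsto_deriv : Tendsto (fun r => -deriv (gapProb P Z) r) atTop (𝓝 0) := by
  refine tendsto_of_tendsto_of_tendsto_of_le_of_le' tendsto_const_nhds
    (h_decay.tendsto_zero.comp (tendsto_atTop_add_const_right atTop (-1 : ℝ) tendsto_id)) ?_ ?_
  · filter_upwards [eventually_gt_atTop 0] with r hr
    linarith [h_regular.deriv_neg h_decay hr]
  · filter_upwards [eventually_gt_atTop 1] with r hr
    have := (h_regular.increment_bounds (a := r + -1) (b := r) (by linarith) (by linarith)).1
    have := gapProb_nonneg (P := P) (Z := Z) r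
    simp only [Function.comp, id]
    linarith

end Decay

end PointProcess

/-! ### Successive points, and measurability of the linear statistics -/

/-- The first point of `S` after `z`. -/
noncomputable def nextPoint (S : Set ℝ) (z : ℝ) : ℝ := sInf (S ∩ Set.Ioi z)

lemma isLeast_nextPoint {S : Set ℝ} (hS : ∀ a b : ℝ, (S ∩ Set.Icc a b).Finite)
    (hS' : ∀ a : ℝ, (S ∩ Set.Ioi a).Nonempty) (z : ℝ) :
    IsLeast (S ∩ Set.Ioi z) (nextPoint S z) := by
  obtain ⟨b, hb, hzb⟩ := hS' z
  have hf : (S ∩ Set.Ioc z b).Finite :=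
    (hS z b).subset (Set.inter_subset_inter_right _ Set.Ioc_subset_Icc_self)
  obtain ⟨m, hm, hmin⟩ := Set.exists_min_image _ id hf ⟨b, hb, hzb, le_rfl⟩
  have h : IsLeast (S ∩ Set.Ioi z) m := by
    refine ⟨⟨hm.1, hm.2.1⟩, fun x hx => ?_⟩
    rcases le_total x b with hxb | hxb
    · exact hmin x ⟨hx.1, hx.2, hxb⟩
    · exact hm.2.2.trans hxb
  rw [nextPoint, h.csInf_eq]
  exact h

/-- A gap is determined by its left end, so sums over gaps become sums over points. -/
lemma isGap_iff {S : Set ℝ} (hS : ∀ a b : ℝ, (S ∩ Set.Icc a b).Finite)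
    (hS' : ∀ a : ℝ, (S ∩ Set.Ioi a).Nonempty) (p : ℝ × ℝ) :
    IsGap S p ↔ p.1 ∈ S ∧ p.2 = nextPoint S p.1 := by
  have hl := isLeast_nextPoint hS hS' p.1
  constructor
  · rintro ⟨h1, h2, h3, h4⟩
    refine ⟨h1, le_antisymm (not_lt.1 fun h => ?_) (hl.2 ⟨h2, h3⟩)⟩
    exact Set.eq_empty_iff_forall_notMem.1 h4 _ ⟨hl.1.1, hl.1.2, h⟩
  · rintro ⟨h1, h2⟩
    rw [IsGap, h2]
    refine ⟨h1, hl.1.1, hl.1.2, Set.eq_empty_iff_forall_notMem.2 fun x hx => ?_⟩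
    exact (hl.2 ⟨hx.1, hx.2.1⟩).not_gt hx.2.2

lemma measurable_toRealTop : Measurable toRealTop :=
  Measurable.subtype_mk measurable_coe_real_ereal

section

variable {Ω : Type u} [MeasurableSpace Ω] {P : Measure Ω} {Z : Ω → Set ℝ}

lemma measurable_scaling : Measurable (scaling P Z) :=
  (Real.measurable_log.comp (measurable_deriv _).neg).neg

/-- The position and mark of the rescaled gap of length `g` starting at `z`. -/
noncomputable def gapMark (P : Measure Ω) (Z : Ω → Set ℝ) (R z g : ℝ) : GapSpace :=
  (Set.projIcc (0 : ℝ) 1 zero_le_one (z / R), toRealTop (scaling P Z g - Real.log R))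

lemma measurable_gapMark (R : ℝ) :
    Measurable fun p : ℝ × ℝ => gapMark P Z R p.1 p.2 := by
  refine Measurable.prodMk ?_ ?_
  · exact continuous_projIcc.measurable.comp (measurable_fst.div_const R)
  · exact measurable_toRealTop.comp ((measurable_scaling.comp measurable_snd).sub_const _)

/-- The integral against the process of rescaled gaps is a finite sum. -/
lemma integral_rescaledGaps (f : GapSpace → ℝ) (R : ℝ) {ω : Ω}
    (hS : ∀ a b : ℝ, (Z ω ∩ Set.Icc a b).Finite) (hS' : ∀ a : ℝ, (Z ω ∩ Set.Ioi a).Nonempty) :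
    ∫ x, f x ∂(rescaledGaps P Z R ω) =
      ∑ z ∈ (hS 0 R).toFinset, f (gapMark P Z R z (nextPoint (Z ω) z - z)) := by
  let e : {z : ℝ // z ∈ (hS 0 R).toFinset} ≃
      {p : ℝ × ℝ // IsGap (Z ω) p ∧ p.1 ∈ Set.Icc 0 R} :=
    { toFun := fun z => ⟨(z.1, nextPoint (Z ω) z.1), by
        have h := (hS 0 R).mem_toFinset.1 z.2
        exact ⟨(isGap_iff hS hS' _).2 ⟨h.1, rfl⟩, h.2⟩⟩
      invFun := fun p => ⟨p.1.1, (hS 0 R).mem_toFinset.2 ⟨p.2.1.1, p.2.2⟩⟩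
      left_inv := fun z => rfl
      right_inv := fun p => by
        ext
        · rfl
        · exact ((isGap_iff hS hS' _).1 p.2.1).2.symm }
  have : Fintype {p : ℝ × ℝ // IsGap (Z ω) p ∧ p.1 ∈ Set.Icc 0 R} := Fintype.ofEquiv _ e
  rw [rescaledGaps, Measure.sum_fintype, integral_finsetSum_measure]
  · rw [← Finset.sum_coe_sort (hS 0 R).toFinset, ← e.sum_comp]
    exact Finset.sum_congr rfl fun z _ => integral_dirac _ _
  · intro i _
    exact integrable_dirac (by simp)

/-- The counting measure of the point process, as a kernel. -/
noncomputable def countingKernel (hZ : IsStationaryPointProcess P Z) : Kernel Ω ℝ :=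
  ⟨fun ω => counting (Z ω), hZ.measurable⟩

lemma countingKernel_apply (hZ : IsStationaryPointProcess P Z) (ω : Ω) :
    countingKernel hZ ω = counting (Z ω) := rfl

lemma counting_Ioc_lt_top (hZ : IsStationaryPointProcess P Z) (ω : Ω) (a b : ℝ) :
    ∃ m : ℕ, counting (Z ω) (Set.Ioc a b) = m := by
  have hf : (Set.Ioc a b ∩ Z ω).Finite := (hZ.locallyFinite ω a b).subset fun x hx =>
    ⟨hx.2, Set.Ioc_subset_Icc_self hx.1⟩
  rw [counting_apply _ measurableSet_Ioc, ← hf.coe_toFinset, Measure.count_apply_finset]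
  exact ⟨_, rfl⟩

/-- The kernel is cut along unit intervals, and over each of them along the number of points it
contains. Each piece is finite, with the prescribed count as a bound. S-finiteness is what gives
joint measurability in the outcome and the location. -/
lemma isSFiniteKernel_countingKernel (hZ : IsStationaryPointProcess P Z) :
    IsSFiniteKernel (countingKernel hZ) := by
  classical
  set κ := countingKernel hZ with hκ
  let s : ℤ × ℕ → Set Ω := fun q => {ω | κ ω (Set.Ioc (q.1 : ℝ) (q.1 + 1)) = q.2}
  have hs : ∀ q, MeasurableSet (s q) := fun q =>
    κ.measurable_coe measurableSet_Ioc (measurableSet_singleton _)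
  let κs : ℤ × ℕ → Kernel Ω ℝ := fun q =>
    Kernel.piecewise (hs q) (κ.restrict (measurableSet_Ioc (a := (q.1 : ℝ)) (b := q.1 + 1))) 0
  have hfin : ∀ q, IsSFiniteKernel (κs q) := by
    intro q
    have : IsFiniteKernel (κs q) := by
      refine ⟨⟨q.2, ENNReal.natCast_lt_top _, fun ω => ?_⟩⟩
      rw [Kernel.piecewise_apply]
      split_ifs with h
      · rw [Kernel.restrict_apply, Measure.restrict_apply_univ]
        exact (show κ ω _ = _ from h).le
      · simp
    infer_instance
  have hsum : κ = Kernel.sum κs := by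
    ext ω B hB
    have hB' : B = ⋃ k : ℤ, B ∩ Set.Ioc (k : ℝ) (k + 1) := by
      rw [← Set.inter_iUnion, iUnion_Ioc_intCast, Set.inter_univ]
    have hdis : Pairwise (Function.onFun Disjoint fun k : ℤ => B ∩ Set.Ioc (k : ℝ) (k + 1)) :=
      fun k l hkl => (Set.pairwise_disjoint_Ioc_intCast ℝ hkl).mono Set.inter_subset_right
        Set.inter_subset_right
    rw [Kernel.sum_apply' _ _ hB, ENNReal.tsum_prod (f := fun k m => κs (k, m) ω B), hB',
      measure_iUnion hdis fun k => hB.inter measurableSet_Ioc, ← hB']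
    refine tsum_congr fun k => ?_
    obtain ⟨m, hm⟩ := counting_Ioc_lt_top hZ ω (k : ℝ) (k + 1)
    rw [tsum_eq_single m]
    · rw [Kernel.piecewise_apply, if_pos (show ω ∈ s (k, m) from hm), Kernel.restrict_apply,
        Measure.restrict_apply hB]
    · intro m' hm'
      rw [Kernel.piecewise_apply, if_neg]
      · simp
      · intro h
        have h' : κ ω (Set.Ioc (k : ℝ) (k + 1)) = m' := h
        rw [hκ, countingKernel_apply, hm] at h'
        exact hm' (by exact_mod_cast h'.symm)
  rw [hsum]
  exact Kernel.isSFiniteKernel_sum (hκs := hfin)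

/-- The distance from `z` to the next point of the process. -/
noncomputable def nextDist (Z : Ω → Set ℝ) (p : Ω × ℝ) : ℝ≥0∞ :=
  ⨅ q : {q : ℚ // 0 < q}, if counting (Z p.1) (Set.Ioo p.2 (p.2 + (q.1 : ℝ))) = 0 then ⊤
    else ENNReal.ofReal (q.1 : ℝ)

/-- The infimum runs over rational lengths, hence is countable, and the number of points in a moving
interval is jointly measurable because the counting kernel is s-finite. -/
lemma measurable_nextDist (hZ : IsStationaryPointProcess P Z) : Measurable (nextDist Z) := by
  have := isSFiniteKernel_countingKernel hZ
  refine Measurable.iInf fun q => Measurable.ite ?_ measurable_const measurable_const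
  let κ' : Kernel (Ω × ℝ) ℝ := (countingKernel hZ).comap Prod.fst measurable_fst
  have ht : MeasurableSet {t : (Ω × ℝ) × ℝ | t.1.2 < t.2 ∧ t.2 < t.1.2 + (q.1 : ℝ)} :=
    (measurableSet_lt (by fun_prop) measurable_snd).inter
      (measurableSet_lt measurable_snd ((measurable_snd.comp measurable_fst).add_const _))
  exact Kernel.measurable_kernel_prodMk_left (κ := κ') ht (measurableSet_singleton 0)

omit [MeasurableSpace Ω] in
lemma toReal_nextDist {ω : Ω} (hS : ∀ a b : ℝ, (Z ω ∩ Set.Icc a b).Finite)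
    (hS' : ∀ a : ℝ, (Z ω ∩ Set.Ioi a).Nonempty) (z : ℝ) :
    (nextDist Z (ω, z)).toReal = nextPoint (Z ω) z - z := by
  have hl := isLeast_nextPoint hS hS' z
  have hpos : 0 < nextPoint (Z ω) z - z := sub_pos.2 hl.1.2
  have key : ∀ q : ℝ, counting (Z ω) (Set.Ioo z (z + q)) = 0 ↔ q ≤ nextPoint (Z ω) z - z := by
    intro q
    rw [counting_eq_zero_iff _ measurableSet_Ioo]
    constructor
    · intro h
      by_contra! hq
      exact Set.eq_empty_iff_forall_notMem.1 h _ ⟨hl.1.1, hl.1.2, by linarith⟩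
    · intro h
      refine Set.eq_empty_iff_forall_notMem.2 fun x hx => ?_
      have := hl.2 ⟨hx.1, hx.2.1⟩
      have := hx.2.2
      linarith
  have : nextDist Z (ω, z) = ENNReal.ofReal (nextPoint (Z ω) z - z) := by
    refine le_antisymm ?_ (le_iInf fun q => ?_)
    · refine le_of_forall_gt fun c hc => ?_
      rcases eq_or_ne c ⊤ with rfl | hct
      · obtain ⟨q, hq⟩ := exists_rat_gt (nextPoint (Z ω) z - z)
        refine lt_of_le_of_lt (iInf_le _ ⟨q, by exact_mod_cast hpos.trans hq⟩) ?_
        rw [if_neg (by rw [key]; exact not_le.2 hq)]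
        exact ENNReal.ofReal_lt_top
      · have hc' : nextPoint (Z ω) z - z < c.toReal := by
          rwa [ENNReal.ofReal_lt_iff_lt_toReal hpos.le hct] at hc
        obtain ⟨q, hq, hq'⟩ := exists_rat_btwn hc'
        refine lt_of_le_of_lt (iInf_le _ ⟨q, by exact_mod_cast hpos.trans hq⟩) ?_
        rw [if_neg (by rw [key]; exact not_le.2 hq)]
        rwa [ENNReal.ofReal_lt_iff_lt_toReal (hpos.trans hq).le hct]
    · split_ifs with h
      · exact le_top
      · rw [key] at h
        exact ENNReal.ofReal_le_ofReal (not_le.1 h).le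
  rw [this, ENNReal.toReal_ofReal hpos.le]

/-- Almost surely the statistic is the integral, against the counting kernel, of a jointly
measurable function of the outcome and the point. The measurable `nextDist` replaces `nextPoint`,
with which it agrees when the points are unbounded above. -/
lemma aemeasurable_integral_rescaledGaps [IsProbabilityMeasure P]
    (hZ : IsStationaryPointProcess P Z) (h_decay : GapDecay P Z) {f : GapSpace → ℝ}
    (hf : Measurable f) (R : ℝ) :
    AEMeasurable (fun ω => ∫ x, f x ∂(rescaledGaps P Z R ω)) P := by
  have := isSFiniteKernel_countingKernel hZ
  let g : Ω → ℝ → ℝ := fun ω => (Set.Icc 0 R).indicator fun z =>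
    f (gapMark P Z R z (nextDist Z (ω, z)).toReal)
  have hg : Measurable (Function.uncurry g) := by
    have h1 : Measurable fun p : Ω × ℝ => f (gapMark P Z R p.2 (nextDist Z p).toReal) :=
      hf.comp ((measurable_gapMark R).comp
        (measurable_snd.prodMk (measurable_nextDist hZ).ennreal_toReal))
    exact h1.indicator (measurable_snd measurableSet_Icc)
  refine ⟨fun ω => ∫ z, g ω z ∂(countingKernel hZ ω),
    (StronglyMeasurable.integral_kernel_prod_right hg.stronglyMeasurable).measurable, ?_⟩
  filter_upwards [hZ.ae_unbounded h_decay] with ω hω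
  have hS := hZ.locallyFinite ω
  rw [integral_rescaledGaps f R hS hω, countingKernel_apply]
  simp only [g]
  rw [integral_indicator measurableSet_Icc, counting, Measure.restrict_restrict measurableSet_Icc,
    Set.inter_comm (Set.Icc 0 R) (Z ω)]
  conv_rhs => rw [← (hS 0 R).coe_toFinset]
  rw [setIntegral_finset]
  · refine Finset.sum_congr rfl fun z _ => ?_
    rw [toReal_nextDist hS hω, measureReal_def, Measure.count_singleton]
    simp
  · rw [← ((hS 0 R).toFinset : Set ℝ).biUnion_of_singleton]
    exact integrableOn_finset_iUnion.2 fun z _ =>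
      integrableOn_singleton (by simp) (by simp)

end

/-! ### Asymptotics of the gap probability and of the relevant gap lengths -/

section Asymptotics

variable {Ω : Type u} [MeasurableSpace Ω] {P : Measure Ω} {Z : Ω → Set ℝ}
  [IsProbabilityMeasure P]

lemma GapDecay.eventually_log_neg (h_decay : GapDecay P Z) :
    ∀ᶠ t in atTop, Real.log (gapProb P Z t) < 0 := by
  filter_upwards [h_decay.eventually_le 1, eventually_gt_atTop 1] with t ht h1
  have := Real.log_pos h1
  linarith [ht.2]

lemma GapRegularity.log_deriv_bounds (h_decay : GapDecay P Z) (h_regular : GapRegularity P Z)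
    {c : ℝ} (hc : 0 < c) : ∀ᶠ t in atTop,
      (1 + c) * Real.log (gapProb P Z t) ≤ Real.log (-deriv (gapProb P Z) t) ∧
        Real.log (-deriv (gapProb P Z) t) ≤ (1 - c) * Real.log (gapProb P Z t) := by
  filter_upwards [h_regular.log_deriv.isLittleO.bound hc, h_decay.eventually_log_neg] with t ht hneg
  simp only [Pi.sub_apply, Real.norm_eq_abs, abs_of_neg hneg] at ht
  obtain ⟨h1, h2⟩ := abs_le.1 ht
  constructor <;> linarith

/-- Both sides are compared with `log G < 0`. Since `(1 - κ)(1 + κ) = 1 - κ²`, it suffices that the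
error term in the bound on `log G''` exceeds `-κ²`. -/
lemma GapRegularity.deriv_deriv_le (h_decay : GapDecay P Z) (h_regular : GapRegularity P Z)
    {κ : ℝ} (hκ : 0 < κ) (hκ1 : κ < 1) : ∀ᶠ t in atTop,
      deriv (deriv (gapProb P Z)) t ≤ (-deriv (gapProb P Z) t) ^ (1 - κ) := by
  obtain ⟨v, hv, hv'⟩ := h_regular.log_deriv_deriv
  filter_upwards [hv', h_regular.log_deriv_bounds h_decay hκ, h_decay.eventually_log_neg,
    hv.eventually_const_lt (show -κ ^ 2 < 0 by nlinarith), eventually_gt_atTop 0]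
    with t h1 h2 h3 h4 h5
  have hg : 0 < -deriv (gapProb P Z) t := by linarith [h_regular.deriv_neg h_decay h5]
  rcases le_or_gt (deriv (deriv (gapProb P Z)) t) 0 with h | h
  · exact h.trans (Real.rpow_nonneg hg.le _)
  · rw [← Real.log_le_log_iff h (Real.rpow_pos_of_pos hg _), Real.log_rpow hg]
    refine (h1 h).trans ?_
    have h6 := mul_le_mul_of_nonneg_left h2.1 (show 0 ≤ 1 - κ by linarith)
    nlinarith

/-- The bound `G'' ≤ (-G')^{1-κ}` says that `(-G')^κ` has derivative at least `-κ`, so `(-G')^κ + κ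
x` is nondecreasing. This controls how much `-G'` can exceed its value a short way to the right. -/
lemma GapRegularity.rpow_deriv_sub_le (h_decay : GapDecay P Z) (h_regular : GapRegularity P Z)
    {κ : ℝ} (hκ : 0 < κ) (hκ1 : κ < 1) : ∃ a : ℝ, 0 < a ∧ ∀ s t, a ≤ s → s ≤ t →
      (-deriv (gapProb P Z) s) ^ κ ≤ (-deriv (gapProb P Z) t) ^ κ + κ * (t - s) := by
  obtain ⟨a₀, ha₀⟩ := eventually_atTop.1 (h_regular.deriv_deriv_le h_decay hκ hκ1)
  set a := max a₀ 1
  have ha : 0 < a := lt_of_lt_of_le one_pos (le_max_right _ _)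
  refine ⟨a, ha, fun s t hs hst => ?_⟩
  have hd : ∀ x, a ≤ x → HasDerivAt (fun x => (-deriv (gapProb P Z) x) ^ κ + κ * x)
      (-deriv (deriv (gapProb P Z)) x * κ * (-deriv (gapProb P Z) x) ^ (κ - 1) + κ * 1) x := by
    intro x hx
    have hx0 : 0 < x := ha.trans_le hx
    exact ((h_regular.differentiableAt_deriv hx0).hasDerivAt.neg.rpow_const
      (Or.inl (neg_pos.2 (h_regular.deriv_neg h_decay hx0)).ne')).add
      ((hasDerivAt_id x).const_mul κ)
  have hm : MonotoneOn (fun x => (-deriv (gapProb P Z) x) ^ κ + κ * x) (Set.Ici a) := by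
    refine monotoneOn_of_deriv_nonneg (convex_Ici a)
      (fun x hx => (hd x hx).continuousAt.continuousWithinAt)
      (fun x hx => (hd x (interior_subset hx)).differentiableAt.differentiableWithinAt) ?_
    intro x hx
    have hx : a ≤ x := interior_subset hx
    rw [(hd x hx).deriv]
    have hg : 0 < -deriv (gapProb P Z) x := by
      linarith [h_regular.deriv_neg h_decay (ha.trans_le hx)]
    have h1 := ha₀ x ((le_max_left _ _).trans hx)
    have h2 : (-deriv (gapProb P Z) x) ^ (1 - κ) * (-deriv (gapProb P Z) x) ^ (κ - 1) = 1 := by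
      rw [← Real.rpow_add hg]
      simp
    have h3 := mul_le_mul_of_nonneg_right h1 (Real.rpow_nonneg hg.le (κ - 1))
    rw [h2] at h3
    nlinarith
  have := hm (show s ∈ Set.Ici a from hs) (show t ∈ Set.Ici a from hs.trans hst) hst
  simp only at this
  linarith

open Classical in
/-- A gap length `r` such that the expected number of gaps in `[0, R]` longer than `r` is `u`. -/
noncomputable def threshold (P : Measure Ω) (Z : Ω → Set ℝ) (u R : ℝ) : ℝ :=
  if h : ∃ r : ℝ, 0 < r ∧ R * -deriv (gapProb P Z) r = u then h.choose else 1

/-- Intermediate values of the continuous function `-G'`, which exceeds `u / R` at 1 for large `R`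
and tends to 0. -/
lemma threshold_spec (h_decay : GapDecay P Z) (h_regular : GapRegularity P Z)
    {u : ℝ} (hu : 0 < u) : ∀ᶠ R in atTop, 0 < threshold P Z u R ∧
      R * -deriv (gapProb P Z) (threshold P Z u R) = u := by
  have h1 : 0 < -deriv (gapProb P Z) 1 := by linarith [h_regular.deriv_neg h_decay one_pos]
  filter_upwards [eventually_gt_atTop (u / -deriv (gapProb P Z) 1), eventually_gt_atTop 0]
    with R hR hR0
  replace hR : u / R < -deriv (gapProb P Z) 1 := by
    rw [div_lt_iff₀ h1] at hR
    rw [div_lt_iff₀ hR0]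
    linarith
  have hex : ∃ r : ℝ, 0 < r ∧ R * -deriv (gapProb P Z) r = u := by
    obtain ⟨b, hb, hb1⟩ := (((h_regular.tendsto_deriv h_decay).eventually_lt_const
      (div_pos hu hR0)).and (eventually_ge_atTop 1)).exists
    have hc : ContinuousOn (fun r => -deriv (gapProb P Z) r) (Set.Icc 1 b) :=
      fun x hx => (h_regular.differentiableAt_deriv
        (zero_lt_one.trans_le hx.1)).continuousAt.neg.continuousWithinAt
    obtain ⟨r, hr, hr'⟩ := intermediate_value_Icc' hb1 hc ⟨hb.le, hR.le⟩
    refine ⟨r, zero_lt_one.trans_le hr.1, ?_⟩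
    simp only at hr'
    rw [hr']
    field_simp
  rw [threshold, dif_pos hex]
  exact hex.choose_spec

lemma tendsto_threshold (h_decay : GapDecay P Z) (h_regular : GapRegularity P Z)
    {u : ℝ} (hu : 0 < u) : Tendsto (threshold P Z u) atTop atTop := by
  refine tendsto_atTop.2 fun b => ?_
  have hb : 0 < max b 1 := lt_of_lt_of_le one_pos (le_max_right _ _)
  have hg : 0 < -deriv (gapProb P Z) (max b 1) := by linarith [h_regular.deriv_neg h_decay hb]
  filter_upwards [threshold_spec h_decay h_regular hu,
    eventually_gt_atTop (u / -deriv (gapProb P Z) (max b 1)), eventually_gt_atTop 0]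
    with R ⟨h1, h2⟩ hR hR0
  by_contra! h
  have h3 := h_regular.monotoneOn_deriv h1 hb (h.le.trans (le_max_left b 1))
  rw [div_lt_iff₀ hg] at hR
  nlinarith

lemma threshold_lt_threshold (h_regular : GapRegularity P Z) {r s R u v : ℝ} (hR : 0 < R)
    (hr : 0 < r) (hs : 0 < s) (hu : R * -deriv (gapProb P Z) r = u)
    (hv : R * -deriv (gapProb P Z) s = v) (huv : u < v) : s < r := by
  by_contra! h
  have h3 := h_regular.monotoneOn_deriv hr hs h
  nlinarith

/-- The relevant gap lengths are `R ^ o(1)`. -/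
lemma threshold_le_rpow (h_decay : GapDecay P Z) (h_regular : GapRegularity P Z)
    {u : ℝ} (hu : 0 < u) {κ : ℝ} (hκ : 0 < κ) :
    ∀ᶠ R in atTop, threshold P Z u R ≤ R ^ κ := by
  have ht := tendsto_threshold h_decay h_regular hu
  filter_upwards [threshold_spec h_decay h_regular hu,
    ht.eventually (h_regular.log_deriv_bounds h_decay (c := 1 / 2) (by norm_num)),
    ht.eventually (h_decay.eventually_le (3 / κ)), eventually_gt_atTop 0,
    Real.tendsto_log_atTop.eventually_ge_atTop (-2 * Real.log u)] with R ⟨h1, h2⟩ h3 h4 hR0 h5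
  have hg : 0 < -deriv (gapProb P Z) (threshold P Z u R) := by
    linarith [h_regular.deriv_neg h_decay h1]
  have h6 : Real.log (-deriv (gapProb P Z) (threshold P Z u R)) = Real.log u - Real.log R := by
    have := congrArg Real.log h2
    rw [Real.log_mul hR0.ne' hg.ne'] at this
    linarith
  rw [h6] at h3
  rw [← Real.log_le_log_iff h1 (Real.rpow_pos_of_pos hR0 _), Real.log_rpow hR0]
  -- With `r` the threshold, `(3/κ) log r ≤ -log G(r) ≤ 2 (log R - log u) ≤ 3 log R`; the last step
  -- uses `log R ≥ -2 log u`.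
  have h7 : 3 / κ * Real.log (threshold P Z u R) ≤ 3 * Real.log R := by linarith [h3.2, h4.2]
  rw [div_mul_eq_mul_div, div_le_iff₀ hκ] at h7
  linarith

lemma isPowerOrder_threshold (h_decay : GapDecay P Z) (h_regular : GapRegularity P Z)
    {u : ℝ} (hu : 0 < u) : IsPowerOrder (threshold P Z u) 0 := by
  refine ⟨fun R => Real.log (threshold P Z u R) / Real.log R, ?_, ?_⟩
  · rw [Metric.tendsto_nhds]
    intro κ hκ
    filter_upwards [threshold_le_rpow h_decay h_regular hu (half_pos hκ),
      (tendsto_threshold h_decay h_regular hu).eventually_ge_atTop 1, eventually_gt_atTop 1]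
      with R h1 h2 h3
    have hR : 0 < Real.log R := Real.log_pos h3
    have h4 := Real.log_le_log (by linarith) h1
    rw [Real.log_rpow (by linarith)] at h4
    rw [Real.dist_eq, sub_zero, abs_of_nonneg (div_nonneg (Real.log_nonneg h2) hR.le),
      div_lt_iff₀ hR]
    nlinarith
  · filter_upwards [(tendsto_threshold h_decay h_regular hu).eventually_ge_atTop 1,
      eventually_gt_atTop 1] with R h2 h3
    have hR : 0 < Real.log R := Real.log_pos h3
    rw [zero_add, Real.rpow_def_of_pos (by linarith), mul_div_cancel₀ _ hR.ne',
      Real.exp_log (by linarith)]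

/-- The derivative hardly changes between `r - ε` and `r`. -/
lemma deriv_threshold_sub_le (h_decay : GapDecay P Z) (h_regular : GapRegularity P Z)
    {u : ℝ} (hu : 0 < u) {β τ : ℝ} (hβ : 0 < β) (hτ : 0 < τ) :
    ∀ᶠ R in atTop, ∀ ε : ℝ, 0 ≤ ε → ε ≤ R ^ (-β) → 1 ≤ threshold P Z u R - ε ∧
      R * -deriv (gapProb P Z) (threshold P Z u R - ε) ≤ u + τ := by
  -- `κ < β` makes the increment `κ R^κ R^{-β}` of `(-R G')^κ` vanish in the limit; `κ < 1` is
  -- required by the estimate for `(-G')^κ`.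
  set κ := min β 1 / 2 with hκ_def
  have hκ : 0 < κ := by positivity
  have hκ1 : κ < 1 := by linarith [min_le_right β 1]
  have hκβ : κ < β := by linarith [min_le_left β 1]
  obtain ⟨a, ha, hmono⟩ := h_regular.rpow_deriv_sub_le h_decay hκ hκ1
  have hlim : Tendsto (fun R : ℝ => u ^ κ + κ * R ^ (-(β - κ))) atTop (𝓝 (u ^ κ + κ * 0)) :=
    ((tendsto_rpow_neg_atTop (sub_pos.2 hκβ)).const_mul κ).const_add _
  have hlt : u ^ κ + κ * 0 < (u + τ) ^ κ := by
    rw [mul_zero, add_zero]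
    exact Real.rpow_lt_rpow hu.le (by linarith) hκ
  filter_upwards [threshold_spec h_decay h_regular hu, eventually_ge_atTop 1,
    (tendsto_threshold h_decay h_regular hu).eventually_ge_atTop (max a 1 + 1),
    hlim.eventually_lt_const hlt] with R ⟨h1, h2⟩ hR1 h3 h4 ε hε hεR
  have hR0 : 0 < R := by linarith
  have hε1 : ε ≤ 1 := hεR.trans (Real.rpow_le_one_of_one_le_of_nonpos hR1 (by linarith))
  have hs : max a 1 ≤ threshold P Z u R - ε := by linarith
  have hs1 : 1 ≤ threshold P Z u R - ε := (le_max_right a 1).trans hs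
  refine ⟨hs1, ?_⟩
  have h5 := hmono _ (threshold P Z u R) ((le_max_left a 1).trans hs) (by linarith)
  have hg1 : 0 < -deriv (gapProb P Z) (threshold P Z u R - ε) := by
    linarith [h_regular.deriv_neg h_decay (show 0 < threshold P Z u R - ε by linarith)]
  have hg2 : 0 < -deriv (gapProb P Z) (threshold P Z u R) := by
    linarith [h_regular.deriv_neg h_decay h1]
  rw [← Real.rpow_le_rpow_iff (by positivity) (by positivity) hκ, Real.mul_rpow hR0.le hg1.le]
  have h6 : R ^ κ * (-deriv (gapProb P Z) (threshold P Z u R)) ^ κ = u ^ κ := by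
    rw [← Real.mul_rpow hR0.le hg2.le, h2]
  have h7 : R ^ κ * R ^ (-β) = R ^ (-(β - κ)) := by
    rw [← Real.rpow_add hR0]
    congr 1
    ring
  have h8 := mul_le_mul_of_nonneg_left h5 (Real.rpow_nonneg hR0.le κ)
  have h9 : R ^ κ * (κ * (threshold P Z u R - (threshold P Z u R - ε))) ≤
      R ^ κ * (κ * R ^ (-β)) := by
    gcongr
    linarith
  nlinarith

/-- `-G'` is of order at most `1 / R` at these lengths, and `log G ~ log (-G')`. With error `c` this
gives the exponent `-(1 - c)/(1 + c) ≤ -1 + 2c`, whence the choice `2c ≤ κ`. -/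
lemma gapProb_threshold_sub_le (h_decay : GapDecay P Z) (h_regular : GapRegularity P Z)
    {u : ℝ} (hu : 0 < u) {β κ : ℝ} (hβ : 0 < β) (hκ : 0 < κ) :
    ∀ᶠ R in atTop, ∀ ε : ℝ, 0 ≤ ε → ε ≤ R ^ (-β) →
      gapProb P Z (threshold P Z u R - ε) ≤ R ^ (-1 + κ) := by
  set c := min κ 1 / 2 with hc_def
  have hc : 0 < c := by positivity
  have hc1 : c < 1 := by linarith [min_le_right κ 1]
  have hcκ : 2 * c ≤ κ := by linarith [min_le_left κ 1]
  obtain ⟨a, ha⟩ := eventually_atTop.1 ((h_regular.log_deriv_bounds h_decay hc).and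
    h_decay.eventually_log_neg)
  filter_upwards [deriv_threshold_sub_le h_decay h_regular hu hβ one_pos, eventually_gt_atTop 1,
    (tendsto_threshold h_decay h_regular hu).eventually_ge_atTop (a + 1),
    Real.tendsto_log_atTop.eventually_ge_atTop (Real.log (u + 1) / c)] with R h1 hR1 h2 h3 ε hε hεR
  obtain ⟨h4, h5⟩ := h1 ε hε hεR
  have hR0 : 0 < R := by linarith
  have hlR : 0 < Real.log R := Real.log_pos hR1
  have hε1 : ε ≤ 1 := hεR.trans (Real.rpow_le_one_of_one_le_of_nonpos hR1.le (by linarith))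
  obtain ⟨⟨h6, -⟩, h7⟩ := ha (threshold P Z u R - ε) (by linarith)
  have hg1 : 0 < -deriv (gapProb P Z) (threshold P Z u R - ε) := by
    linarith [h_regular.deriv_neg h_decay (show 0 < threshold P Z u R - ε by linarith)]
  have h8 := Real.log_le_log (by positivity) h5
  rw [Real.log_mul hR0.ne' hg1.ne'] at h8
  rw [div_le_iff₀ hc] at h3
  rw [← Real.log_le_log_iff (h_decay.pos _) (Real.rpow_pos_of_pos hR0 _), Real.log_rpow hR0]
  have h9 : (1 + c) * Real.log (gapProb P Z (threshold P Z u R - ε)) ≤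
      -(1 - c) * Real.log R := by linarith
  have h10 : -(1 - c) * Real.log R ≤ (1 + c) * ((-1 + κ) * Real.log R) := by
    rw [← mul_assoc]
    refine mul_le_mul_of_nonneg_right ?_ hlR.le
    nlinarith
  exact le_of_mul_le_mul_left (h9.trans h10) (by linarith)

end Asymptotics

/-! ### Near independence of distant gap events -/

section Splitting

variable {Ω : Type u} [MeasurableSpace Ω] {P : Measure Ω} {Z : Ω → Set ℝ}

lemma isPowerOrder_rpow (δ : ℝ) : IsPowerOrder (fun R => R ^ δ) δ :=
  ⟨fun _ => 0, tendsto_const_nhds, Eventually.of_forall fun R => by simp⟩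

lemma eventually_rpow_le_rpow {a b : ℝ} (h : a ≤ b) : ∀ᶠ R : ℝ in atTop, R ^ a ≤ R ^ b := by
  filter_upwards [eventually_ge_atTop 1] with R hR
  exact Real.rpow_le_rpow_of_exponent_le hR h

lemma eventually_mul_rpow_le_rpow (C : ℝ) {a b : ℝ} (h : a < b) :
    ∀ᶠ R : ℝ in atTop, C * R ^ a ≤ R ^ b := by
  filter_upwards [(tendsto_rpow_atTop (sub_pos.2 h)).eventually_ge_atTop C, eventually_gt_atTop 0]
    with R hR hR0
  calc C * R ^ a ≤ R ^ (b - a) * R ^ a :=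
        mul_le_mul_of_nonneg_right hR (Real.rpow_nonneg hR0.le _)
    _ = R ^ b := by rw [← Real.rpow_add hR0, sub_add_cancel]

/-- The intervals `[a i, b i]`, `i ∈ S`, lie from left to right, are of length at most `r`, and at
distance at least `s`. -/
structure SpacedOut (S : Finset ℕ) (r s : ℝ) (a b : ℕ → ℝ) : Prop where
  le : ∀ i ∈ S, a i ≤ b i
  length : ∀ i ∈ S, b i - a i ≤ r
  spaced : ∀ i ∈ S, ∀ j ∈ S, i < j → b i + s ≤ a j

lemma SpacedOut.wellSeparated {S : Finset ℕ} {r s : ℝ} {a b : ℕ → ℝ} (h : SpacedOut S r s a b)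
    (hs : 0 < s) {k : ℕ} (hk : S.card = k) :
    WellSeparated k r s (fun i => a (S.orderEmbOfFin hk i)) fun i => b (S.orderEmbOfFin hk i) := by
  have hm := S.orderEmbOfFin_mem hk
  have hsep : ∀ i j, i ≠ j → ∀ x ∈ Set.Icc (a (S.orderEmbOfFin hk i)) (b (S.orderEmbOfFin hk i)),
      ∀ y ∈ Set.Icc (a (S.orderEmbOfFin hk j)) (b (S.orderEmbOfFin hk j)), s ≤ |x - y| := by
    intro i j hij x hx y hy
    rcases lt_or_gt_of_ne hij with h1 | h1
    · have := h.spaced _ (hm i) _ (hm j) ((S.orderEmbOfFin hk).lt_iff_lt.2 h1)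
      rw [abs_sub_comm]
      exact le_abs.2 (Or.inl (by linarith [hx.2, hy.1]))
    · have := h.spaced _ (hm j) _ (hm i) ((S.orderEmbOfFin hk).lt_iff_lt.2 h1)
      exact le_abs.2 (Or.inl (by linarith [hx.1, hy.2]))
  refine ⟨fun i => h.le _ (hm i), fun i => h.length _ (hm i), fun i j hij => ?_, hsep⟩
  refine Set.disjoint_left.2 fun x hx hx' => ?_
  have := hsep i j hij x hx x hx'
  rw [sub_self, abs_zero] at this
  linarith

omit [MeasurableSpace Ω] in
lemma iInter_orderEmbOfFin {S : Finset ℕ} {k : ℕ} (hk : S.card = k) (E : ℕ → Set Ω) :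
    ⋂ i, E (S.orderEmbOfFin hk i) = ⋂ i ∈ S, E i := by
  have h := S.range_orderEmbOfFin hk
  ext ω
  simp only [Set.mem_iInter]
  constructor
  · intro h1 i hi
    rw [← Finset.mem_coe, ← h] at hi
    obtain ⟨p, rfl⟩ := hi
    exact h1 p
  · exact fun h1 i => h1 _ (S.orderEmbOfFin_mem hk i)

lemma prod_orderEmbOfFin {S : Finset ℕ} {k : ℕ} (hk : S.card = k) (g : ℕ → ℝ) :
    ∏ i, g (S.orderEmbOfFin hk i) = ∏ i ∈ S, g i := by
  rw [← Finset.prod_coe_sort S, ← (S.orderIsoOfFin hk).toEquiv.prod_comp]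
  rfl

/-- The gap events of intervals that are far apart are nearly independent. -/
lemma PolynomialSplitting.eventually_abs_sub_le [IsProbabilityMeasure P]
    (h_splitting : PolynomialSplitting P Z) {δ : ℝ} (hδ : 0 < δ) {r : ℝ → ℝ}
    (hr : IsPowerOrder r 0) (K : ℕ) :
    ∃ δ' : ℝ, 0 < δ' ∧ ∀ k ≤ K, ∀ᶠ R in atTop, ∀ (S : Finset ℕ) (a b : ℕ → ℝ), S.card = k →
      SpacedOut S (r R) (R ^ δ) a b →
        |P.real (⋂ i ∈ S, gapEvent Z (Set.Icc (a i) (b i))) -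
          ∏ i ∈ S, P.real (gapEvent Z (Set.Icc (a i) (b i)))| ≤
            R ^ (-δ') * ∏ i ∈ S, P.real (gapEvent Z (Set.Icc (a i) (b i))) := by
  have hone : ∀ k : ℕ, ∃ δ' : ℝ, 0 < δ' ∧ ∀ᶠ R in atTop, ∀ (S : Finset ℕ) (a b : ℕ → ℝ),
      S.card = k → SpacedOut S (r R) (R ^ δ) a b →
        |P.real (⋂ i ∈ S, gapEvent Z (Set.Icc (a i) (b i))) -
          ∏ i ∈ S, P.real (gapEvent Z (Set.Icc (a i) (b i)))| ≤
            R ^ (-δ') * ∏ i ∈ S, P.real (gapEvent Z (Set.Icc (a i) (b i))) := by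
    intro k
    -- The splitting hypothesis starts at `k = 2`; for fewer intervals the two sides agree.
    rcases lt_or_ge k 2 with hk | hk
    · refine ⟨1, one_pos, ?_⟩
      filter_upwards [eventually_gt_atTop 0] with R hR S a b hS _
      have heq : P.real (⋂ i ∈ S, gapEvent Z (Set.Icc (a i) (b i))) =
          ∏ i ∈ S, P.real (gapEvent Z (Set.Icc (a i) (b i))) := by
        rcases Nat.le_one_iff_eq_zero_or_eq_one.1 (Nat.lt_succ_iff.1 hk) with h | h
        · rw [h, Finset.card_eq_zero] at hS
          simp [hS]
        · rw [h, Finset.card_eq_one] at hS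
          obtain ⟨i, rfl⟩ := hS
          simp
      rw [heq, sub_self, abs_zero]
      exact mul_nonneg (Real.rpow_nonneg hR.le _)
        (Finset.prod_nonneg fun i _ => measureReal_nonneg)
    · obtain ⟨δ₁, hδ₁, h⟩ := h_splitting k hk δ hδ
      obtain ⟨v, hv, h'⟩ := h r _ hr (isPowerOrder_rpow δ)
      refine ⟨δ₁ / 4, by positivity, ?_⟩
      filter_upwards [h', hv.eventually_lt_const (show (0 : ℝ) < δ₁ / 4 by positivity),
        eventually_gt_atTop 1, eventually_mul_rpow_le_rpow 2
          (show -(δ₁ / 2) < -(δ₁ / 4) by linarith),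
        eventually_mul_rpow_le_rpow 2 (show -(δ₁ / 2) < 0 by linarith)]
        with R h1 h2 h3 h4 h5 S a b hS hab
      have hR0 : 0 < R := by linarith
      set e := R ^ (-(δ₁ / 2)) with he
      rw [Real.rpow_zero] at h5
      have he0 : 0 < e := Real.rpow_pos_of_pos hR0 _
      have hlt : splittingCoeff P Z k (r R) (R ^ δ) < e :=
        h1.trans_lt (Real.rpow_lt_rpow_of_exponent_lt h3 (by linarith))
      rw [splittingCoeff] at hlt
      -- An admissible `ε < e` is taken instead of the infimum itself; the set is nonempty because
      -- `ε = 1` imposes nothing.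
      obtain ⟨ε, ⟨hε, hε'⟩, hεe⟩ := exists_lt_of_csInf_lt (by
        refine ⟨1, ⟨zero_le_one, le_rfl⟩, fun a b _ => ?_⟩
        simp only [sub_self, zero_mul]
        exact ⟨measureReal_nonneg, Finset.prod_nonneg fun i _ => measureReal_nonneg⟩) hlt
      obtain ⟨h6, h7⟩ := hε' _ _ (hab.wellSeparated (Real.rpow_pos_of_pos hR0 δ) hS)
      rw [prod_orderEmbOfFin hS fun i => P.real (gapEvent Z (Set.Icc (a i) (b i))),
        iInter_orderEmbOfFin hS fun i => gapEvent Z (Set.Icc (a i) (b i))] at h6 h7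
      set p := P.real (⋂ i ∈ S, gapEvent Z (Set.Icc (a i) (b i)))
      set q := ∏ i ∈ S, P.real (gapEvent Z (Set.Icc (a i) (b i)))
      have hp : 0 ≤ p := measureReal_nonneg
      have hq : 0 ≤ q := Finset.prod_nonneg fun i _ => measureReal_nonneg
      have h8 : 2 * e * q ≤ R ^ (-(δ₁ / 4)) * q := mul_le_mul_of_nonneg_right h4 hq
      -- `(1 - ε) p ≤ q` with `ε < 1/2`. Then `p - q ≤ ε p ≤ 2 e q`, so that the error is relative
      -- to `q`.
      have hp2 : p ≤ 2 * q := by nlinarith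
      rw [abs_le]
      constructor <;> nlinarith
  choose δ' hδ' h using hone
  obtain ⟨k₀, hk₀, hmin⟩ := (Finset.range (K + 1)).exists_min_image δ' ⟨0, by simp⟩
  refine ⟨δ' k₀, hδ' _, fun k hk => ?_⟩
  filter_upwards [h k, eventually_rpow_le_rpow (neg_le_neg (hmin k (Finset.mem_range.2 (by omega))))]
    with R h1 h2 S a b hS hab
  exact (h1 S a b hS hab).trans (mul_le_mul_of_nonneg_right h2
    (Finset.prod_nonneg fun i _ => measureReal_nonneg))

/-- Joint moments of linear combinations of nearly independent events. -/
lemma norm_integral_prod_sum_sub_le [IsProbabilityMeasure P] {α ι : Type*} [Fintype α] [Fintype ι]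
    [DecidableEq α] (E : α → ι → Set Ω) (hE : ∀ i t, MeasurableSet (E i t)) (c : α → ι → ℂ) (δ : ℝ)
    (h : ∀ p : α → ι, |P.real (⋂ i, E i (p i)) - ∏ i, P.real (E i (p i))| ≤
      δ * ∏ i, P.real (E i (p i))) :
    ‖∫ ω, ∏ i, ∑ t, c i t * (E i t).indicator 1 ω ∂P -
        ∏ i, ∫ ω, ∑ t, c i t * (E i t).indicator 1 ω ∂P‖ ≤
      δ * ∏ i, ∑ t, ‖c i t‖ * P.real (E i t) := by
  have hind : ∀ (F : Set Ω), MeasurableSet F →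
      Integrable (F.indicator (1 : Ω → ℂ)) P ∧ ∫ ω, F.indicator (1 : Ω → ℂ) ω ∂P = P.real F := by
    intro F hF
    refine ⟨(integrable_const (1 : ℂ)).indicator hF, ?_⟩
    rw [integral_indicator hF]
    simp
  have hprod : ∀ (p : α → ι) (ω : Ω), ∏ i, (c i (p i) * (E i (p i)).indicator (1 : Ω → ℂ) ω) =
      (∏ i, c i (p i)) * (⋂ i, E i (p i)).indicator (1 : Ω → ℂ) ω := by
    intro p ω
    rw [Finset.prod_mul_distrib]
    congr 1
    by_cases hω : ω ∈ ⋂ i, E i (p i)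
    · rw [Set.indicator_of_mem hω]
      exact Finset.prod_eq_one fun i _ => Set.indicator_of_mem (Set.mem_iInter.1 hω i) _
    · rw [Set.indicator_of_notMem hω]
      rw [Set.mem_iInter, not_forall] at hω
      obtain ⟨i, hi⟩ := hω
      exact Finset.prod_eq_zero (Finset.mem_univ i) (Set.indicator_of_notMem hi _)
  have e1 : ∫ ω, ∏ i, ∑ t, c i t * (E i t).indicator 1 ω ∂P =
      ∑ p : α → ι, (∏ i, c i (p i)) * (P.real (⋂ i, E i (p i)) : ℂ) := by
    simp_rw [Finset.prod_univ_sum, Fintype.piFinset_univ, hprod]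
    rw [integral_finsetSum]
    · refine Finset.sum_congr rfl fun p _ => ?_
      rw [integral_const_mul, (hind _ (MeasurableSet.iInter fun i => hE i (p i))).2]
    · exact fun p _ => (hind _ (MeasurableSet.iInter fun i => hE i (p i))).1.const_mul _
  have e2 : ∏ i, ∫ ω, ∑ t, c i t * (E i t).indicator 1 ω ∂P =
      ∑ p : α → ι, (∏ i, c i (p i)) * ((∏ i, P.real (E i (p i)) : ℝ) : ℂ) := by
    have : ∀ i, ∫ ω, ∑ t, c i t * (E i t).indicator 1 ω ∂P = ∑ t, c i t * (P.real (E i t) : ℂ) := by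
      intro i
      rw [integral_finsetSum _ fun t _ => (hind _ (hE i t)).1.const_mul _]
      exact Finset.sum_congr rfl fun t _ => by rw [integral_const_mul, (hind _ (hE i t)).2]
    simp_rw [this, Finset.prod_univ_sum, Fintype.piFinset_univ, Finset.prod_mul_distrib,
      Complex.ofReal_prod]
  have e3 : ∏ i, ∑ t, ‖c i t‖ * P.real (E i t) =
      ∑ p : α → ι, (∏ i, ‖c i (p i)‖) * ∏ i, P.real (E i (p i)) := by
    simp_rw [Finset.prod_univ_sum, Fintype.piFinset_univ, Finset.prod_mul_distrib]
  rw [e1, e2, e3, ← Finset.sum_sub_distrib, Finset.mul_sum]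
  refine norm_sum_le_of_le _ fun p _ => ?_
  rw [← mul_sub, norm_mul, norm_prod, ← Complex.ofReal_sub, Complex.norm_real, Real.norm_eq_abs]
  calc _ ≤ (∏ i, ‖c i (p i)‖) * (δ * ∏ i, P.real (E i (p i))) := by
        gcongr
        exact h p
    _ = _ := by ring

end Splitting

/-! ### The clustering with one pair -/

section Decoupling

variable {Ω : Type u} [MeasurableSpace Ω] {P : Measure Ω} {Z : Ω → Set ℝ}

/-- `predAbove` merges `a.castSucc` and `a.succ` and is injective elsewhere; `a.castSucc.succAbove`
is its section that avoids `a.castSucc`. This describes the clusters of `pairClustering`. -/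
lemma eq_of_predAbove_eq {k : ℕ} {a l : Fin k} {i : Fin (k + 1)} (h : a.predAbove i = l) :
    i = a.castSucc.succAbove l ∨ l = a ∧ i = a.castSucc := by
  by_cases hi : i = a.castSucc
  · right
    rw [hi, Fin.predAbove_castSucc_self] at h
    exact ⟨h.symm, hi⟩
  · left
    obtain ⟨j, rfl⟩ := Fin.exists_succAbove_eq hi
    rw [Fin.predAbove_succAbove] at h
    rw [h]

/-- The clustering of intervals of equal length into one pair and singletons. -/
def pairClustering {k : ℕ} (left right : Fin (k + 1) → ℝ) (hle : ∀ i, left i ≤ right i)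
    (hlt : ∀ i j, i < j → right i < left j) (a : Fin k) : Clustering where
  n := k + 1
  m := k
  left := left
  right := right
  left_le_right := hle
  right_lt_left := hlt
  cluster := a.predAbove
  cluster_mono := Fin.predAbove_right_monotone a

lemma pairClustering_admissible {k : ℕ} {left right : Fin (k + 1) → ℝ}
    {hle : ∀ i, left i ≤ right i} {hlt : ∀ i j, i < j → right i < left j} {a : Fin k}
    {r rbar s : ℝ} (hr : ∀ i, right i - left i ≤ r)
    (hpair : right a.succ - left a.castSucc ≤ rbar) (hone : ∀ i, right i - left i ≤ rbar)
    (hs : ∀ i j, i < j → ¬ (i = a.castSucc ∧ j = a.succ) → right i + s ≤ left j) :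
    (pairClustering left right hle hlt a).Admissible (k + 1) r rbar s where
  card_le := le_rfl
  length := hr
  diam := by
    intro (l : Fin k)
    by_cases hl : l = a
    · refine ⟨left a.castSucc, right a.succ, hpair, fun (i : Fin (k + 1)) hi => ?_⟩
      have h1 := hlt a.castSucc a.succ Fin.castSucc_lt_succ
      rcases eq_of_predAbove_eq hi with h | ⟨-, h⟩
      · rw [hl, Fin.succAbove_castSucc_self] at h
        rw [h]
        exact Set.Icc_subset_Icc_left ((hle _).trans h1.le)
      · rw [h]
        exact Set.Icc_subset_Icc_right (h1.le.trans (hle _))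
    · refine ⟨left (a.castSucc.succAbove l), right (a.castSucc.succAbove l), hone _,
        fun (i : Fin (k + 1)) hi => ?_⟩
      rcases eq_of_predAbove_eq hi with h | ⟨h, -⟩
      · rw [h]
        exact subset_rfl
      · exact absurd h hl
  separated := by
    have key : ∀ i j : Fin (k + 1), i < j → a.predAbove i ≠ a.predAbove j →
        ∀ x ∈ Set.Icc (left i) (right i), ∀ y ∈ Set.Icc (left j) (right j), s ≤ |x - y| := by
      intro i j hij hne x hx y hy
      have := hs i j hij fun h => hne (by
        rw [h.1, h.2, Fin.predAbove_castSucc_self, Fin.predAbove_succ_self])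
      rw [abs_sub_comm]
      exact le_abs.2 (Or.inl (by linarith [hx.2, hy.1]))
    intro (i : Fin (k + 1)) (j : Fin (k + 1)) hne x hx y hy
    rcases lt_trichotomy i j with h | h | h
    · exact key i j h hne x hx y hy
    · exact absurd (congrArg _ h) hne
    · rw [abs_sub_comm]
      exact key j i h (Ne.symm hne) y hy x hx

lemma le_clusteringCoeff [IsProbabilityMeasure P] {r a₁ b₁ a₂ b₂ : ℝ} (h₁ : a₁ ≤ b₁) (h₂ : a₂ ≤ b₂)
    (hr₁ : r ≤ b₁ - a₁) (hr₂ : r ≤ b₂ - a₂) (h : b₁ < a₂) :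
    P.real (gapEvent Z (Set.Icc a₁ b₁) ∩ gapEvent Z (Set.Icc a₂ b₂)) ≤ clusteringCoeff P Z r := by
  refine le_csSup ⟨1, ?_⟩ ⟨a₁, b₁, a₂, b₂, h₁, h₂, hr₁, hr₂, ?_, rfl⟩
  · rintro p ⟨_, _, _, _, _, _, _, _, _, rfl⟩
    exact measureReal_le_one
  · intro x hx
    exact absurd (hx.1.2.trans_lt (h.trans_le hx.2.1)) (lt_irrefl x)

/-- The probability of the gap events in each of the clusters of `pairClustering`. -/
lemma prod_pairClustering_le [IsProbabilityMeasure P] (hZ : IsStationaryPointProcess P Z) {k : ℕ}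
    {left right : Fin (k + 1) → ℝ} {hle : ∀ i, left i ≤ right i}
    {hlt : ∀ i j, i < j → right i < left j} {a : Fin k} {len : ℝ}
    (hlen : ∀ i, right i - left i = len) :
    ∏ l : Fin k, P.real (⋂ i, ⋂ _ : (pairClustering left right hle hlt a).cluster i = l,
        gapEvent Z ((pairClustering left right hle hlt a).interval i)) ≤
      clusteringCoeff P Z len * gapProb P Z len ^ (k - 1) := by
  rw [← Finset.mul_prod_erase _ _ (Finset.mem_univ a)]
  refine mul_le_mul ?_ ?_ (Finset.prod_nonneg fun i _ => measureReal_nonneg)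
    (measureReal_nonneg.trans (le_clusteringCoeff (hle a.castSucc) (hle a.succ)
      (hlen _).ge (hlen _).ge (hlt _ _ Fin.castSucc_lt_succ)))
  · refine le_trans (measureReal_mono ?_) (le_clusteringCoeff (hle a.castSucc) (hle a.succ)
      (hlen _).ge (hlen _).ge (hlt _ _ Fin.castSucc_lt_succ))
    intro ω hω
    rw [Set.mem_iInter] at hω
    exact ⟨Set.mem_iInter.1 (hω a.castSucc) (Fin.predAbove_castSucc_self a),
      Set.mem_iInter.1 (hω a.succ) (Fin.predAbove_succ_self a)⟩
  · calc _ ≤ ∏ l ∈ Finset.univ.erase a, gapProb P Z len := by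
          refine Finset.prod_le_prod (fun i _ => measureReal_nonneg) fun l _ => ?_
          rw [← hlen (a.castSucc.succAbove l), ← hZ.real_gapEvent_Icc]
          refine measureReal_mono fun ω hω => ?_
          rw [Set.mem_iInter] at hω
          exact Set.mem_iInter.1 (hω (a.castSucc.succAbove l)) (Fin.predAbove_succAbove a l)
      _ = _ := by
          rw [Finset.prod_const, Finset.card_erase_of_mem (Finset.mem_univ a), Finset.card_univ,
            Fintype.card_fin]

end Decoupling

/-! ### Large gaps starting in given cells -/

section Cells

variable {Ω : Type u} [MeasurableSpace Ω] {P : Measure Ω} {Z : Ω → Set ℝ}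

/-- There is a point in the `i`-th cell `[iε, iε + ε)`, and none from there up to `iε + r`. -/
def cellEvent (Z : Ω → Set ℝ) (ε r : ℝ) (i : ℕ) : Set Ω :=
  gapEvent Z (Set.Icc (i * ε + ε) (i * ε + r)) \ gapEvent Z (Set.Icc (i * ε) (i * ε + r))

omit [MeasurableSpace Ω] in
lemma mem_cellEvent {ε r : ℝ} (hε : 0 < ε) (hr : ε ≤ r) {i : ℕ} {ω : Ω} :
    ω ∈ cellEvent Z ε r i ↔ (Z ω ∩ Set.Icc (i * ε + ε) (i * ε + r) = ∅) ∧
      (Z ω ∩ Set.Ico (i * ε) (i * ε + ε)).Nonempty := by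
  refine and_congr_right fun h => ?_
  change ¬ (Z ω ∩ Set.Icc (i * ε) (i * ε + r) = ∅) ↔ _
  rw [← ne_eq, ← Set.nonempty_iff_ne_empty]
  constructor
  · rintro ⟨z, hz, hz'⟩
    refine ⟨z, hz, hz'.1, not_le.1 fun hle => ?_⟩
    exact Set.eq_empty_iff_forall_notMem.1 h z ⟨hz, hle, hz'.2⟩
  · rintro ⟨z, hz, hz'⟩
    exact ⟨z, hz, hz'.1, by linarith [hz'.2]⟩

lemma measurableSet_cellEvent (hZ : IsStationaryPointProcess P Z) (ε r : ℝ) (i : ℕ) :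
    MeasurableSet (cellEvent Z ε r i) :=
  (hZ.measurableSet_gapEvent measurableSet_Icc).diff (hZ.measurableSet_gapEvent measurableSet_Icc)

omit [MeasurableSpace Ω] in
lemma gapEvent_cell_subset {ε r : ℝ} (hε : 0 ≤ ε) (i : ℕ) :
    gapEvent Z (Set.Icc (i * ε) (i * ε + r)) ⊆ gapEvent Z (Set.Icc (i * ε + ε) (i * ε + r)) :=
  gapEvent_anti Z (Set.Icc_subset_Icc_left (by linarith))

lemma real_cellEvent [IsProbabilityMeasure P] (hZ : IsStationaryPointProcess P Z) {ε : ℝ}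
    (hε : 0 ≤ ε) (r : ℝ) (i : ℕ) :
    P.real (cellEvent Z ε r i) = gapProb P Z (r - ε) - gapProb P Z r := by
  rw [cellEvent, measureReal_sdiff (gapEvent_cell_subset hε i)
    (hZ.measurableSet_gapEvent measurableSet_Icc), hZ.real_gapEvent_Icc, hZ.real_gapEvent_Icc]
  congr 2 <;> ring

omit [MeasurableSpace Ω] in
-- The point in the `j`-th cell must lie beyond the empty interval that follows the `i`-th cell. So
-- simultaneous large gaps have disjoint empty intervals, as `Clustering` demands.
lemma lt_of_mem_cellEvent {ε r : ℝ} (hε : 0 < ε) (hr : ε ≤ r) {i j : ℕ} (hij : i < j) {ω : Ω}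
    (hi : ω ∈ cellEvent Z ε r i) (hj : ω ∈ cellEvent Z ε r j) : i * ε + r < j * ε + ε := by
  obtain ⟨h1, -⟩ := (mem_cellEvent hε hr).1 hi
  obtain ⟨-, z, hz, hz'⟩ := (mem_cellEvent hε hr).1 hj
  have h2 : (i : ℝ) + 1 ≤ j := by exact_mod_cast hij
  by_contra! h
  refine Set.eq_empty_iff_forall_notMem.1 h1 z ⟨hz, ?_, by linarith [hz'.2]⟩
  nlinarith [hz'.1]

lemma clusteringCoeff_nonneg (r : ℝ) : 0 ≤ clusteringCoeff P Z r :=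
  Real.sSup_nonneg fun _ ⟨_, _, _, _, _, _, _, _, _, hp⟩ => hp ▸ measureReal_nonneg

/-- The probability that large gaps start in each of a set of separated cells and in one more. -/
lemma real_iInter_insert_cellEvent_le [IsProbabilityMeasure P] (hZ : IsStationaryPointProcess P Z)
    {ε r s₀ s₁ c U V W : ℝ} (hε : 0 < ε) (hr : ε ≤ r) (hrs : r ≤ s₀) (hs : 2 * s₀ ≤ s₁)
    (hs' : 3 * s₀ ≤ s₁ / c) (hU : 0 ≤ U) (hV : 0 ≤ V) (hW : 0 ≤ W) {k d : ℕ}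
    (hd : 3 * s₁ ≤ d * ε)
    (hsplit : ∀ (S : Finset ℕ) (a b : ℕ → ℝ), S.card = k + 1 → SpacedOut S r s₀ a b →
      P.real (⋂ i ∈ S, gapEvent Z (Set.Icc (a i) (b i))) ≤
        2 * ∏ i ∈ S, P.real (gapEvent Z (Set.Icc (a i) (b i))))
    (hdec : ∀ rbar : ℝ, rbar ≤ s₁ / c → ∀ C : Clustering, C.Admissible (k + 1) r rbar s₁ →
      P.real (⋂ i, gapEvent Z (C.interval i)) ≤
        U * ((∏ l : Fin C.m,
          P.real (⋂ i, ⋂ _ : C.cluster i = l, gapEvent Z (C.interval i))) ^ V + W))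
    {S : Finset ℕ} (hk : S.card = k) (hS : Separated d S) {j : ℕ} (hj : j ∉ S) :
    P.real (⋂ i ∈ insert j S, cellEvent Z ε r i) ≤ 2 * gapProb P Z (r - ε) ^ (k + 1) +
      U * ((clusteringCoeff P Z (r - ε) * gapProb P Z (r - ε) ^ (k - 1)) ^ V + W) := by
  have hG := gapProb_nonneg (P := P) (Z := Z) (r - ε)
  have hbase : 0 ≤ clusteringCoeff P Z (r - ε) * gapProb P Z (r - ε) ^ (k - 1) :=
    mul_nonneg (clusteringCoeff_nonneg _) (pow_nonneg hG _)
  have hB : 0 ≤ U * ((clusteringCoeff P Z (r - ε) * gapProb P Z (r - ε) ^ (k - 1)) ^ V + W) :=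
    mul_nonneg hU (add_nonneg (Real.rpow_nonneg hbase _) hW)
  have hA : 0 ≤ 2 * gapProb P Z (r - ε) ^ (k + 1) := mul_nonneg (by norm_num) (pow_nonneg hG _)
  -- One outcome in the intersection certifies that the intervals are disjoint, a fact about the
  -- indices alone.
  rcases (⋂ i ∈ insert j S, cellEvent Z ε r i).eq_empty_or_nonempty with h0 | ⟨ω, hω⟩
  · rw [h0, measureReal_empty]
    exact add_nonneg hA hB
  have hω' : ∀ i ∈ insert j S, ω ∈ cellEvent Z ε r i := fun i hi => Set.mem_iInter₂.1 hω i hi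
  have hQ : (insert j S).card = k + 1 := by rw [Finset.card_insert_of_notMem hj, hk]
  have hSsep : ∀ x ∈ S, ∀ y ∈ S, x < y → 3 * s₁ ≤ y * ε - x * ε := by
    intro x hx y hy hxy
    have : (x : ℝ) + d ≤ y := by exact_mod_cast hS x hx y hy hxy
    nlinarith
  have hs₀ : 0 < s₀ := lt_of_lt_of_le (hε.trans_le hr) hrs
  have hsub : (⋂ i ∈ insert j S, cellEvent Z ε r i) ⊆
      ⋂ i ∈ insert j S, gapEvent Z (Set.Icc (i * ε + ε) (i * ε + r)) :=
    Set.iInter₂_mono fun i _ => Set.sdiff_subset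
  -- If the new cell is within `2 s₀` of `S`, it forms a cluster with the cell it is close to, and
  -- decoupling at scale `s₁` applies. Otherwise all cells are spaced enough for splitting at scale
  -- `s₀`.
  by_cases hclose : ∃ i ∈ S, |(i : ℝ) * ε - j * ε| < 2 * s₀
  · obtain ⟨i, hi, hij⟩ := hclose
    refine le_trans ?_ (le_add_of_nonneg_left hA)
    have hne : i ≠ j := fun h => hj (h ▸ hi)
    -- the close pair, from left to right
    obtain ⟨lo, hi', hlohi, hlo, hhi, hpair, hset⟩ : ∃ lo hi' : ℕ, lo < hi' ∧ lo ∈ insert j S ∧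
        hi' ∈ insert j S ∧ hi' * ε - lo * ε < 2 * s₀ ∧
        ((lo = i ∧ hi' = j) ∨ (lo = j ∧ hi' = i)) := by
      rcases lt_or_gt_of_ne hne with h | h
      · exact ⟨i, j, h, Finset.mem_insert_of_mem hi, Finset.mem_insert_self _ _, by
          linarith [(abs_lt.1 hij).1], Or.inl ⟨rfl, rfl⟩⟩
      · exact ⟨j, i, h, Finset.mem_insert_self _ _, Finset.mem_insert_of_mem hi, by
          linarith [(abs_lt.1 hij).2], Or.inr ⟨rfl, rfl⟩⟩
    -- Cells of `S` are `3 s₁` apart and `2 s₀ ≤ s₁`, so the new cell is close to one of them only.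
    have hfar : ∀ y ∈ S, y ≠ i → 2 * s₁ ≤ |(y : ℝ) * ε - j * ε| := by
      intro y hy hyi
      have h1 : 3 * s₁ ≤ |(y : ℝ) * ε - i * ε| := by
        rcases lt_or_gt_of_ne hyi with h | h
        · rw [abs_sub_comm]
          exact (hSsep y hy i hi h).trans (le_abs_self _)
        · exact (hSsep i hi y hy h).trans (le_abs_self _)
      have h2 := abs_sub_le ((y : ℝ) * ε) (j * ε) (i * ε)
      rw [abs_sub_comm ((j : ℝ) * ε)] at h2
      linarith
    have hsep : ∀ x ∈ insert j S, ∀ y ∈ insert j S, x < y → ¬ (x = lo ∧ y = hi') →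
        2 * s₁ ≤ y * ε - x * ε := by
      intro x hx y hy hxy hnp
      have hxy' : (x : ℝ) * ε ≤ y * ε :=
        mul_le_mul_of_nonneg_right (by exact_mod_cast hxy.le) hε.le
      rw [Finset.mem_insert] at hx hy
      rcases hx with rfl | hx
      · rcases hy with rfl | hy
        · exact absurd hxy (lt_irrefl _)
        · rw [← abs_of_nonneg (sub_nonneg.2 hxy')]
          refine hfar y hy fun h => hnp ?_
          omega
      · rcases hy with rfl | hy
        · rw [← abs_of_nonneg (sub_nonneg.2 hxy'), abs_sub_comm]
          refine hfar x hx fun h => hnp ?_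
          omega
        · have := hSsep x hx y hy hxy
          linarith
    set q := (insert j S).orderEmbOfFin hQ with hq
    have hqm : ∀ p, q p ∈ insert j S := (insert j S).orderEmbOfFin_mem hQ
    have hrange : ∀ x ∈ insert j S, ∃ p, q p = x := fun x hx => by
      have := (insert j S).range_orderEmbOfFin hQ
      rw [← Finset.mem_coe, ← this] at hx
      exact hx
    obtain ⟨a, ha1, ha2⟩ : ∃ a : Fin k, q a.castSucc = lo ∧ q a.succ = hi' := by
      obtain ⟨p, hp⟩ := hrange lo hlo
      obtain ⟨p', hp'⟩ := hrange hi' hhi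
      have hpp : p < p' := q.lt_iff_lt.1 (by rw [hp, hp']; exact hlohi)
      obtain ⟨a, rfl⟩ := Fin.exists_castSucc_eq.2 (hpp.trans_le (Fin.le_last p')).ne
      refine ⟨a, hp, ?_⟩
      rcases (Fin.castSucc_lt_iff_succ_le.1 hpp).eq_or_lt with h | h
      · rw [h, hp']
      -- An index strictly between the two of the pair would be less than `2 s₀` away from `lo`, but
      -- every other pair is at least `2 s₁` apart.
      · exfalso
        have h1 : q a.succ < hi' := hp' ▸ q.lt_iff_lt.2 h
        have h2 : lo < q a.succ := hp ▸ q.lt_iff_lt.2 Fin.castSucc_lt_succ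
        have h3 := hsep lo hlo (q a.succ) (hqm _) h2 fun h => h1.ne h.2
        have h4 : ((q a.succ : ℕ) : ℝ) * ε ≤ hi' * ε :=
          mul_le_mul_of_nonneg_right (by exact_mod_cast h1.le) hε.le
        linarith
    let left : Fin (k + 1) → ℝ := fun p => (q p : ℝ) * ε + ε
    let right : Fin (k + 1) → ℝ := fun p => (q p : ℝ) * ε + r
    have hle : ∀ p, left p ≤ right p := fun p => by simp only [left, right]; linarith
    have hlt : ∀ p p', p < p' → right p < left p' := fun p p' h =>
      lt_of_mem_cellEvent hε hr (q.lt_iff_lt.2 h) (hω' _ (hqm p)) (hω' _ (hqm p'))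
    have hlen : ∀ p, right p - left p = r - ε := fun p => by simp only [left, right]; ring
    have hadm : (pairClustering left right hle hlt a).Admissible (k + 1) r (3 * s₀) s₁ := by
      refine pairClustering_admissible (fun p => by rw [hlen]; linarith) ?_
        (fun p => by rw [hlen]; linarith) ?_
      · simp only [left, right, ha1, ha2]
        linarith
      · intro p p' hpp hnp
        have := hsep (q p) (hqm p) (q p') (hqm p') (q.lt_iff_lt.2 hpp) fun h => hnp
          ⟨q.injective (h.1.trans ha1.symm), q.injective (h.2.trans ha2.symm)⟩
        simp only [left, right]
        linarith
    have hfin := hdec _ hs' _ hadm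
    have hinter : ⋂ i, gapEvent Z ((pairClustering left right hle hlt a).interval i) =
        ⋂ i ∈ insert j S, gapEvent Z (Set.Icc (i * ε + ε) (i * ε + r)) :=
      iInter_orderEmbOfFin hQ fun i : ℕ => gapEvent Z (Set.Icc ((i : ℝ) * ε + ε) (i * ε + r))
    rw [hinter] at hfin
    refine (measureReal_mono hsub).trans (hfin.trans ?_)
    refine mul_le_mul_of_nonneg_left (add_le_add (Real.rpow_le_rpow
      (Finset.prod_nonneg fun i _ => measureReal_nonneg) (prod_pairClustering_le hZ hlen) hV)
      le_rfl) hU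
  · push Not at hclose
    refine le_trans ?_ (le_add_of_nonneg_right hB)
    have hsep : ∀ x ∈ insert j S, ∀ y ∈ insert j S, x < y → 2 * s₀ ≤ y * ε - x * ε := by
      intro x hx y hy hxy
      have hxy' : (x : ℝ) * ε ≤ y * ε :=
        mul_le_mul_of_nonneg_right (by exact_mod_cast hxy.le) hε.le
      rw [Finset.mem_insert] at hx hy
      rcases hx with rfl | hx
      · rcases hy with rfl | hy
        · exact absurd hxy (lt_irrefl _)
        · rw [← abs_of_nonneg (sub_nonneg.2 hxy')]
          exact hclose y hy
      · rcases hy with rfl | hy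
        · rw [← abs_of_nonneg (sub_nonneg.2 hxy'), abs_sub_comm]
          exact hclose x hx
        · have := hSsep x hx y hy hxy
          linarith
    refine (measureReal_mono hsub).trans ((hsplit _ _ _ hQ ⟨fun i _ => by linarith,
      fun i _ => by linarith, fun x hx y hy hxy => ?_⟩).trans ?_)
    · have := hsep x hx y hy hxy
      linarith
    · refine mul_le_mul_of_nonneg_left (le_of_eq ?_) (by norm_num)
      rw [← hQ, ← Finset.prod_const]
      refine Finset.prod_congr rfl fun i _ => ?_
      rw [hZ.real_gapEvent_Icc]
      congr 1
      ring

/-- Bookkeeping of exponents. The pair and the `k - 1` single gaps give `g^{k + 3η/4}`. Replacing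
`g` by `R^{-1+κ}` and raising to the power `V` lose at most `2κ(k+1) = η/8` in the exponent, and the
prefactor `R^U` another `η/8`, which leaves at least `k + 3η/8`. -/
lemma pair_bound_le_rpow {R g φ η κ U V : ℝ} {k : ℕ} (hR : 1 ≤ R) (hg : 0 < g)
    (hgR : g ≤ R ^ (-1 + κ)) (hη : 0 < η) (hη1 : η ≤ 1) (hk : 1 ≤ k) (hκ : 0 ≤ κ)
    (hκk : κ * (k + 1) = η / 16) (hφ : 0 ≤ φ) (hφg : φ ≤ g ^ (1 + 3 * η / 4)) (hV : 1 - κ ≤ V)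
    (hU : U ≤ η / 8) :
    2 * g ^ (k + 1) + R ^ U * ((φ * g ^ (k - 1)) ^ V + R ^ (-((k + 1 : ℕ) : ℝ))) ≤
      4 * R ^ (-(k + 3 * η / 8)) := by
  have hR0 : 0 < R := by linarith
  have hk1 : (1 : ℝ) ≤ k := by exact_mod_cast hk
  have hκ1 : κ ≤ 1 := by nlinarith
  have hbase0 : 0 ≤ φ * g ^ (k - 1) := mul_nonneg hφ (pow_nonneg hg.le _)
  have hbase : φ * g ^ (k - 1) ≤ R ^ ((-1 + κ) * (k + 3 * η / 4)) := by
    calc φ * g ^ (k - 1) ≤ g ^ (1 + 3 * η / 4) * g ^ (k - 1) :=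
          mul_le_mul_of_nonneg_right hφg (pow_nonneg hg.le _)
      _ = g ^ ((k : ℝ) + 3 * η / 4) := by
          rw [← Real.rpow_natCast g (k - 1), ← Real.rpow_add hg, Nat.cast_sub hk]
          congr 1
          push_cast
          ring
      _ ≤ (R ^ (-1 + κ)) ^ ((k : ℝ) + 3 * η / 4) :=
          Real.rpow_le_rpow hg.le hgR (by positivity)
      _ = _ := by rw [← Real.rpow_mul hR0.le]
  have hpow : (φ * g ^ (k - 1)) ^ V ≤ R ^ (-(k + η / 2)) := by
    calc _ ≤ (R ^ ((-1 + κ) * (k + 3 * η / 4))) ^ V :=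
          Real.rpow_le_rpow hbase0 hbase (by linarith)
      _ = R ^ ((-1 + κ) * (k + 3 * η / 4) * V) := by rw [← Real.rpow_mul hR0.le]
      _ ≤ _ := by
          refine Real.rpow_le_rpow_of_exponent_le hR ?_
          have e1 : (1 - κ) * (k + 3 * η / 4) * (1 - κ) ≤ (1 - κ) * (k + 3 * η / 4) * V :=
            mul_le_mul_of_nonneg_left hV (mul_nonneg (by linarith) (by positivity))
          have e2 : κ * (k + 3 * η / 4) ≤ κ * (k + 1) :=
            mul_le_mul_of_nonneg_left (by linarith) hκ
          have e3 : 0 ≤ κ * (κ * (k + 3 * η / 4)) := by positivity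
          linarith
  have hW : R ^ (-((k + 1 : ℕ) : ℝ)) ≤ R ^ (-(k + η / 2)) := by
    refine Real.rpow_le_rpow_of_exponent_le hR ?_
    push_cast
    linarith
  have hU' : R ^ U ≤ R ^ (η / 8) := Real.rpow_le_rpow_of_exponent_le hR hU
  have hA : g ^ (k + 1) ≤ R ^ (-(k + 3 * η / 8)) := by
    calc g ^ (k + 1) ≤ (R ^ (-1 + κ)) ^ (k + 1) := pow_le_pow_left₀ hg.le hgR _
      _ = R ^ ((-1 + κ) * (k + 1)) := by
          rw [← Real.rpow_natCast, ← Real.rpow_mul hR0.le]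
          push_cast
          rfl
      _ ≤ _ := Real.rpow_le_rpow_of_exponent_le hR (by linarith)
  have hB : R ^ U * ((φ * g ^ (k - 1)) ^ V + R ^ (-((k + 1 : ℕ) : ℝ))) ≤
      2 * R ^ (-(k + 3 * η / 8)) := by
    calc _ ≤ R ^ (η / 8) * (R ^ (-(k + η / 2)) + R ^ (-(k + η / 2))) :=
          mul_le_mul hU' (add_le_add hpow hW) (add_nonneg (Real.rpow_nonneg hbase0 _)
            (Real.rpow_nonneg hR0.le _)) (Real.rpow_nonneg hR0.le _)
      _ = 2 * R ^ (-(k + 3 * η / 8)) := by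
          rw [← two_mul, mul_left_comm, ← Real.rpow_add hR0]
          congr 2
          ring
  linarith

/-- A further large gap near separated ones costs a power of `R`. -/
lemma eventually_real_iInter_insert_cellEvent_le [IsProbabilityMeasure P]
    (hZ : IsStationaryPointProcess P Z) (h_decay : GapDecay P Z) (h_regular : GapRegularity P Z)
    (h_splitting : PolynomialSplitting P Z) (h_decoupling : ClusteredDecoupling P Z)
    (h_clustering : AbsenceOfClustering P Z) :
    ∃ η : ℝ, 0 < η ∧ ∀ u β δ₀ δ₁ : ℝ, 0 < u → 0 < β → 0 < δ₀ → δ₀ < δ₁ → ∀ k : ℕ, 1 ≤ k →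
      ∀ᶠ R in atTop, ∀ ε : ℝ, 0 < ε → ε ≤ R ^ (-β) → ∀ d : ℕ, 3 * R ^ δ₁ ≤ d * ε →
        ∀ S : Finset ℕ, S.card = k → Separated d S → ∀ j ∉ S,
          P.real (⋂ i ∈ insert j S, cellEvent Z ε (threshold P Z u R) i) ≤ R ^ (-(k + η)) := by
  obtain ⟨η₀, hη₀, v, hv, hcl⟩ := h_clustering
  set η := min η₀ 1 with hη_def
  have hη : 0 < η := lt_min hη₀ one_pos
  have hη1 : η ≤ 1 := min_le_right _ _
  have hηη : η ≤ η₀ := min_le_left _ _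
  -- The passage from `3η/8` to `η/4` absorbs the constant 4 for large `R`.
  refine ⟨η / 4, by positivity, ?_⟩
  intro u β δ₀ δ₁ hu hβ hδ₀ hδ₁ k hk
  obtain ⟨c, hc, hdec⟩ := h_decoupling (k + 1) (by omega) δ₁ (hδ₀.trans hδ₁)
  obtain ⟨u', v', hu', hv', hdec'⟩ := hdec _ _ (isPowerOrder_threshold h_decay h_regular hu)
    (isPowerOrder_rpow δ₁)
  obtain ⟨δ', hδ', hsplit⟩ := h_splitting.eventually_abs_sub_le hδ₀
    (isPowerOrder_threshold h_decay h_regular hu) (k + 1)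
  set κ := η / (16 * (k + 1)) with hκ_def
  have hk0 : (0 : ℝ) ≤ k := Nat.cast_nonneg k
  have hk1 : (1 : ℝ) ≤ k := by exact_mod_cast hk
  have hκ : 0 < κ := by positivity
  have hκk : κ * (k + 1) = η / 16 := by
    rw [hκ_def]
    field_simp
  have hκ1 : κ < 1 := by nlinarith
  obtain ⟨a, ha⟩ := eventually_atTop.1 (hcl.and (hv.eventually_const_lt
    (show -(η / 4) < 0 by linarith)))
  filter_upwards [hdec', hsplit (k + 1) le_rfl, gapProb_threshold_sub_le h_decay h_regular hu hβ hκ,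
    deriv_threshold_sub_le h_decay h_regular hu hβ one_pos,
    threshold_le_rpow h_decay h_regular hu hδ₀,
    (tendsto_threshold h_decay h_regular hu).eventually_ge_atTop (a + 1), eventually_ge_atTop 1,
    eventually_mul_rpow_le_rpow 2 hδ₁, eventually_mul_rpow_le_rpow (3 * c) hδ₁,
    hu'.eventually_lt_const (show (0 : ℝ) < η / 8 by positivity),
    hv'.eventually_const_lt (show -κ < 0 by linarith),
    eventually_mul_rpow_le_rpow 4 (show -(k + 3 * η / 8) < -(k + η / 4) by linarith)]
    with R h1 h2 h3 h4 h5 h6 hR h7 h8 h9 h10 h11 ε hε hεR d hd S hS hSd j hj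
  have hR0 : 0 < R := by linarith
  have hε1 : ε ≤ 1 := hεR.trans (Real.rpow_le_one_of_one_le_of_nonpos hR (by linarith))
  obtain ⟨h12, -⟩ := h4 ε hε.le hεR
  set ρ := threshold P Z u R
  set g := gapProb P Z (ρ - ε)
  have hg : 0 < g := h_decay.pos _
  have hg1 : g ≤ 1 := gapProb_le_one _
  have hgR : g ≤ R ^ (-1 + κ) := h3 ε hε.le hεR
  obtain ⟨h13, h14⟩ := ha (ρ - ε) (by linarith)
  have hV : 1 - κ ≤ 1 + v' R := by linarith
  refine (real_iInter_insert_cellEvent_le hZ (c := c) (U := R ^ u' R) (V := 1 + v' R)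
    (W := R ^ (-((k + 1 : ℕ) : ℝ))) hε (by linarith) h5 h7 (by rw [le_div_iff₀ hc]; linarith)
    (Real.rpow_nonneg hR0.le _) (by linarith) (Real.rpow_nonneg hR0.le _) hd
    (fun S a b hS hab => ?_) h1 hS hSd hj).trans ?_
  · have h15 := h2 S a b hS hab
    have h16 : R ^ (-δ') ≤ 1 := Real.rpow_le_one_of_one_le_of_nonpos hR (by linarith)
    have h17 : 0 ≤ ∏ i ∈ S, P.real (gapEvent Z (Set.Icc (a i) (b i))) :=
      Finset.prod_nonneg fun i _ => measureReal_nonneg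
    have h18 := (abs_le.1 h15).2
    nlinarith
  · have hφ : clusteringCoeff P Z (ρ - ε) ≤ g ^ (1 + 3 * η / 4) :=
      h13.trans (Real.rpow_le_rpow_of_exponent_ge hg hg1 (by linarith))
    exact (pair_bound_le_rpow hR hg hgR hη hη1 hk hκ.le hκk (clusteringCoeff_nonneg _) hφ hV
      h9.le).trans h11

end Cells

/-! ### The characteristic functional of a Poisson process -/

section Poisson

variable {E : Type*} [MeasurableSpace E] {Ω : Type v} [MeasurableSpace Ω] {P : Measure Ω}
  [IsProbabilityMeasure P] {N : Ω → Measure E} {μ : Measure E}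

omit [IsProbabilityMeasure P] in
lemma IsPoissonProcess.map_toReal (hN : IsPoissonProcess P N μ) {B : Set E} (hB : MeasurableSet B)
    (hμ : μ B < ∞) :
    P.map (fun ω => (N ω B).toReal) = (poissonMeasure (μ B).toNNReal).map (fun n : ℕ => (n : ℝ)) := by
  have h := congrArg (fun ν : Measure ℝ≥0∞ => ν.map ENNReal.toReal) (hN.poisson B hB hμ)
  have hm : Measurable fun ω => N ω B := (Measure.measurable_coe hB).comp hN.measurable
  rw [Measure.map_map ENNReal.measurable_toReal hm,
    Measure.map_map ENNReal.measurable_toReal (measurable_of_countable _)] at h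
  exact h

omit [IsProbabilityMeasure P] in
lemma IsPoissonProcess.ae_lt_top (hN : IsPoissonProcess P N μ) {B : Set E} (hB : MeasurableSet B)
    (hμ : μ B < ∞) : ∀ᵐ ω ∂P, N ω B < ∞ := by
  have hm : Measurable fun ω => N ω B := (Measure.measurable_coe hB).comp hN.measurable
  have h : ∀ᵐ t ∂(P.map fun ω => N ω B), t < ∞ := by
    rw [hN.poisson B hB hμ, ae_map_iff (measurable_of_countable _).aemeasurable
      (show MeasurableSet {t : ℝ≥0∞ | t < ∞} from measurableSet_Iio)]
    exact Eventually.of_forall fun n => ENNReal.natCast_lt_top n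
  exact ae_of_ae_map hm.aemeasurable h

omit [IsProbabilityMeasure P] in
/-- The characteristic functional of a Poisson process at a simple function. -/
lemma IsPoissonProcess.integral_exp_simpleFunc (hN : IsPoissonProcess P N μ) (s : SimpleFunc E ℝ)
    (hs : Integrable s μ) :
    ∫ ω, Complex.exp ((s.integral (N ω) : ℝ) * Complex.I) ∂P =
      Complex.exp (∫ x, (Complex.exp (s x * Complex.I) - 1) ∂μ) := by
  classical
  -- The level set of the value 0 may have infinite intensity, and contributes nothing.
  set F := s.range.filter (· ≠ 0) with hF
  set n := F.card
  let e : Fin n ≃ F := F.equivFin.symm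
  let B : Fin n → Set E := fun i => s ⁻¹' {(e i : ℝ)}
  have hB : ∀ i, MeasurableSet (B i) := fun i => s.measurableSet_fiber _
  have hμB : ∀ i, μ (B i) < ∞ := fun i =>
    SimpleFunc.integrable_iff.1 hs _ (Finset.mem_filter.1 (e i).2).2
  have hdis : Pairwise fun i j => Disjoint (B i) (B j) := by
    intro i j hij
    refine Set.disjoint_left.2 fun x hx hx' => hij (e.injective (Subtype.ext ?_))
    rw [← Set.mem_singleton_iff.1 hx, ← Set.mem_singleton_iff.1 hx']
  have hm : ∀ i, Measurable fun ω => (N ω (B i)).toReal := fun i =>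
    ((Measure.measurable_coe (hB i)).comp hN.measurable).ennreal_toReal
  let X : Fin n → Ω → ℝ := fun i ω => (e i : ℝ) * (N ω (B i)).toReal
  have hX : iIndepFun X P :=
    (hN.indep n B hB hdis).comp (fun i t => (e i : ℝ) * t.toReal)
      fun i => ENNReal.measurable_toReal.const_mul _
  have hXm : ∀ i, AEMeasurable (X i) P := fun i => ((hm i).const_mul _).aemeasurable
  have hsum : ∀ ω, s.integral (N ω) = ∑ i, X i ω := by
    intro ω
    rw [SimpleFunc.integral_eq_sum_of_subset (s := F) (fun x hx => by simpa [hF] using hx),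
      ← Finset.sum_coe_sort F, ← e.sum_comp]
    exact Finset.sum_congr rfl fun i _ => by
      simp only [X, B, smul_eq_mul, Measure.real]
      ring
  have hXc : ∀ i, charFun (P.map (X i)) 1 =
      Complex.exp (μ.real (B i) * (Complex.exp ((e i : ℝ) * Complex.I) - 1)) := by
    intro i
    rw [show X i = fun ω => (e i : ℝ) * (N ω (B i)).toReal from rfl,
      charFun_map_mul_comp (hm i).aemeasurable, hN.map_toReal (hB i) (hμB i),
      charFun_map_cast_poissonMeasure, mul_one]
    rfl
  have hleft : ∫ ω, Complex.exp ((s.integral (N ω) : ℝ) * Complex.I) ∂P =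
      charFun (P.map fun ω => ∑ i, X i ω) 1 := by
    rw [charFun_apply_real, integral_map (Finset.aemeasurable_fun_sum _ fun i _ => hXm i)
      (by fun_prop)]
    simp only [hsum, Complex.ofReal_one, one_mul]
  have hright : ∫ x, (Complex.exp (s x * Complex.I) - 1) ∂μ =
      ∑ i, (μ.real (B i) : ℂ) * (Complex.exp ((e i : ℝ) * Complex.I) - 1) := by
    let g : ℝ → ℂ := fun y => Complex.exp (y * Complex.I) - 1
    have hg : g 0 = 0 := by simp [g]
    have h1 : ∫ x, (Complex.exp (s x * Complex.I) - 1) ∂μ = (s.map g).integral μ := by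
      rw [SimpleFunc.integral_eq_integral]
      · rfl
      · exact (SimpleFunc.integrable_iff_finMeasSupp.1 hs).map hg |> fun h =>
          SimpleFunc.integrable_iff_finMeasSupp.2 h
    rw [h1, SimpleFunc.map_integral s g hs hg]
    have h2 : ∑ x ∈ s.range, μ.real (s ⁻¹' {x}) • g x = ∑ x ∈ F, μ.real (s ⁻¹' {x}) • g x := by
      refine (Finset.sum_subset (Finset.filter_subset _ _) fun x hx hx' => ?_).symm
      have : x = 0 := by
        by_contra h
        exact hx' (Finset.mem_filter.2 ⟨hx, h⟩)
      rw [this, hg, smul_zero]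
    rw [h2, ← Finset.sum_coe_sort F, ← e.sum_comp]
    refine Finset.sum_congr rfl fun i _ => ?_
    rw [Complex.real_smul]
  rw [hleft, hX.charFun_map_fun_sum_eq_prod hXm, Finset.prod_apply, hright, Complex.exp_sum]
  exact Finset.prod_congr rfl fun i _ => hXc i

omit [IsProbabilityMeasure P] in
lemma IsPoissonProcess.measurable_integral (hN : IsPoissonProcess P N μ) {f : E → ℝ}
    (hf : Measurable f) : Measurable fun ω => ∫ x, f x ∂(N ω) :=
  (StronglyMeasurable.integral_kernel (κ := (⟨N, hN.measurable⟩ : Kernel Ω E))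
    hf.stronglyMeasurable).measurable

lemma norm_exp_mul_I_sub_one_le (x : ℝ) : ‖Complex.exp (x * Complex.I) - 1‖ ≤ |x| := by
  rw [mul_comm]
  exact Real.norm_exp_I_mul_ofReal_sub_one_le

lemma norm_exp_mul_I_sub_exp_mul_I_le (x y : ℝ) :
    ‖Complex.exp (x * Complex.I) - Complex.exp (y * Complex.I)‖ ≤ |x - y| := by
  have : Complex.exp (x * Complex.I) - Complex.exp (y * Complex.I) =
      Complex.exp (y * Complex.I) * (Complex.exp ((x - y : ℝ) * Complex.I) - 1) := by
    rw [mul_sub, ← Complex.exp_add]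
    push_cast
    ring_nf
  rw [this, norm_mul, Complex.norm_exp_ofReal_mul_I, one_mul]
  exact norm_exp_mul_I_sub_one_le _

/-- The characteristic functional of a Poisson process. -/
lemma IsPoissonProcess.integral_exp (hN : IsPoissonProcess P N μ) {f : E → ℝ} (hf : Measurable f)
    {K : Set E} (hK : MeasurableSet K) (hμK : μ K < ∞) (hfK : ∀ x ∉ K, f x = 0) {C : ℝ}
    (hC : ∀ x, |f x| ≤ C) :
    ∫ ω, Complex.exp ((∫ x, f x ∂(N ω) : ℝ) * Complex.I) ∂P =
      Complex.exp (∫ x, (Complex.exp (f x * Complex.I) - 1) ∂μ) := by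
  have hint : ∀ ν : Measure E, ν K < ∞ → Integrable f ν := by
    intro ν hν
    have h1 : IntegrableOn f K ν := by
      have : IsFiniteMeasure (ν.restrict K) := ⟨by rwa [Measure.restrict_apply_univ]⟩
      exact Integrable.of_bound hf.aestronglyMeasurable C (Eventually.of_forall hC)
    exact h1.integrable_of_forall_notMem_eq_zero hfK
  -- Approximating with 0 as base point keeps the simple functions dominated by `2 |f|`, hence
  -- integrable for `μ` and for almost every `N ω`.
  let s : ℕ → SimpleFunc E ℝ := SimpleFunc.approxOn f hf (Set.range f ∪ {0}) 0 (by simp)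
  have hsint : ∀ ν : Measure E, ν K < ∞ → ∀ n, Integrable (s n) ν := fun ν hν n =>
    SimpleFunc.integrable_approxOn hf (hint ν hν) (Or.inr rfl) (integrable_zero _ _ _) n
  have hlim : ∀ ν : Measure E, ν K < ∞ →
      Tendsto (fun n => (s n).integral ν) atTop (𝓝 (∫ x, f x ∂ν)) := fun ν hν =>
    tendsto_integral_approxOn_of_measurable (hint ν hν) hf
      (Eventually.of_forall fun x => subset_closure (Or.inl ⟨x, rfl⟩)) _ (integrable_zero _ _ _)
  have h1 : Tendsto (fun n => ∫ ω, Complex.exp (((s n).integral (N ω) : ℝ) * Complex.I) ∂P) atTop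
      (𝓝 (∫ ω, Complex.exp ((∫ x, f x ∂(N ω) : ℝ) * Complex.I) ∂P)) := by
    refine tendsto_integral_of_dominated_convergence (fun _ => 1) (fun n => ?_)
      (integrable_const 1) (fun n => Eventually.of_forall fun ω => ?_) ?_
    · have : Measurable fun ω => (s n).integral (N ω) := by
        simp only [SimpleFunc.integral_eq]
        refine Finset.measurable_fun_sum _ fun y _ => Measurable.smul_const ?_ y
        exact ((Measure.measurable_coe ((s n).measurableSet_fiber y)).comp
          hN.measurable).ennreal_toReal
      exact (Complex.measurable_exp.comp
        ((Complex.measurable_ofReal.comp this).mul_const _)).aestronglyMeasurable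
    · rw [Complex.norm_exp_ofReal_mul_I]
    · filter_upwards [hN.ae_lt_top hK hμK] with ω hω
      exact (Complex.continuous_exp.tendsto _).comp
        (((Complex.continuous_ofReal.tendsto _).comp (hlim _ hω)).mul_const _)
  have h2 : Tendsto (fun n => ∫ x, (Complex.exp (s n x * Complex.I) - 1) ∂μ) atTop
      (𝓝 (∫ x, (Complex.exp (f x * Complex.I) - 1) ∂μ)) := by
    refine tendsto_integral_of_dominated_convergence (fun x => |f x| + |f x|) (fun n => ?_)
      ((hint μ hμK).abs.add (hint μ hμK).abs) (fun n => Eventually.of_forall fun x => ?_)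
      (Eventually.of_forall fun x => ?_)
    · exact ((Complex.measurable_exp.comp ((Complex.measurable_ofReal.comp
        (s n).measurable).mul_const _)).sub_const 1).aestronglyMeasurable
    · exact (norm_exp_mul_I_sub_one_le _).trans (SimpleFunc.norm_approxOn_zero_le hf (by simp) x n)
    · have := SimpleFunc.tendsto_approxOn hf (s := Set.range f ∪ {0}) (y₀ := 0) (by simp)
        (x := x) (subset_closure (Or.inl ⟨x, rfl⟩))
      exact (((Complex.continuous_exp.tendsto _).comp
        (((Complex.continuous_ofReal.tendsto _).comp this).mul_const _))).sub_const 1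
  refine tendsto_nhds_unique h1 ?_
  simp_rw [fun n => hN.integral_exp_simpleFunc (s n) (hsint μ hμK n)]
  exact (Complex.continuous_exp.tendsto _).comp h2

end Poisson

/-! ### Test functions in the coordinate `u = exp (-y)` -/

section TestFunction

/-- The point `-log u` of `(-∞, +∞]`, for `u ≥ 0`. -/
noncomputable def topMark (u : ℝ) : RealTop :=
  ⟨-ENNReal.log (ENNReal.ofReal u), by
    rw [Set.mem_Ioi, bot_lt_iff_ne_bot, ne_eq, EReal.neg_eq_bot_iff, ENNReal.log_eq_top_iff]
    exact ENNReal.ofReal_ne_top⟩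

lemma continuous_topMark : Continuous topMark :=
  Continuous.subtype_mk
    (continuous_neg.comp (ENNReal.continuous_log.comp ENNReal.continuous_ofReal)) _

lemma topMark_of_pos {u : ℝ} (hu : 0 < u) : topMark u = toRealTop (-Real.log u) := by
  refine Subtype.ext ?_
  simp only [topMark, toRealTop]
  rw [ENNReal.log_ofReal_of_pos hu, EReal.coe_neg]

lemma topMark_of_nonpos {u : ℝ} (hu : u ≤ 0) : topMark u = topMark 0 := by
  refine Subtype.ext ?_
  simp only [topMark]
  rw [ENNReal.ofReal_of_nonpos hu, ENNReal.ofReal_zero]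

/-- A test function in the coordinates `(x, u)`, `u = exp (-y)`. -/
noncomputable def testFun (f : GapSpace → ℝ) (x u : ℝ) : ℝ :=
  f (Set.projIcc (0 : ℝ) 1 zero_le_one x, topMark u)

lemma continuous_testFun {f : GapSpace → ℝ} (hf : Continuous f) :
    Continuous fun p : ℝ × ℝ => testFun f p.1 p.2 :=
  hf.comp ((continuous_projIcc.comp continuous_fst).prodMk
    (continuous_topMark.comp continuous_snd))

/-- A compact subset of `(-∞, +∞]` is bounded below but may contain `+∞`, so `u` is bounded above
while `u = 0` is allowed. -/
lemma exists_testFun_eq_zero {f : GapSpace → ℝ} (hf : HasCompactSupport f) :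
    ∃ U : ℝ, 0 < U ∧ ∀ x u, U ≤ u → testFun f x u = 0 := by
  have hK : IsCompact ((fun p : GapSpace => (p.2 : EReal)) '' tsupport f) :=
    hf.isCompact.image (continuous_subtype_val.comp continuous_snd)
  obtain ⟨y, hy⟩ : ∃ y : ℝ, ∀ p ∈ tsupport f, (y : EReal) < (p.2 : EReal) := by
    rcases (tsupport f).eq_empty_or_nonempty with h | h
    · exact ⟨0, fun p hp => by simp [h] at hp⟩
    · obtain ⟨m, ⟨p, hp, rfl⟩, hmin⟩ := hK.exists_isLeast (h.image _)
      obtain ⟨y, -, hy⟩ := EReal.lt_iff_exists_real_btwn.1 (show (⊥ : EReal) < p.2 from p.2.2)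
      exact ⟨y, fun q hq => hy.trans_le (hmin ⟨q, hq, rfl⟩)⟩
  refine ⟨Real.exp (-y), Real.exp_pos _, fun x u hu => ?_⟩
  have hu0 : 0 < u := (Real.exp_pos _).trans_le hu
  by_contra hne
  have h1 := hy _ (subset_tsupport f hne)
  rw [topMark_of_pos hu0] at h1
  have h2 : y < -Real.log u := EReal.coe_lt_coe_iff.1 h1
  have h3 := (Real.le_log_iff_exp_le hu0).2 hu
  linarith

/-- The function factors through the projections of `x` and `u` to the compact intervals `[0, 1]`
and `[0, U]`, which are contractions. -/
lemma testFun_uniform {f : GapSpace → ℝ} (hf : Continuous f) {U : ℝ} (hU : 0 < U)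
    (hfU : ∀ x u, U ≤ u → testFun f x u = 0) {τ : ℝ} (hτ : 0 < τ) :
    ∃ δ : ℝ, 0 < δ ∧ ∀ x x' u u', |x - x'| ≤ δ → |u - u'| ≤ δ →
      |testFun f x u - testFun f x' u'| ≤ τ := by
  let H : Set.Icc (0 : ℝ) 1 × Set.Icc (0 : ℝ) U → ℝ := fun p => f (p.1, topMark p.2)
  have hH : UniformContinuous H := CompactSpace.uniformContinuous_of_continuous
    (hf.comp (continuous_fst.prodMk (continuous_topMark.comp
      (continuous_subtype_val.comp continuous_snd))))
  have hfH : ∀ x u, testFun f x u =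
      H (Set.projIcc 0 1 zero_le_one x, Set.projIcc 0 U hU.le u) := by
    intro x u
    simp only [H]
    rcases le_or_gt u 0 with h | h
    · rw [Set.projIcc_of_le_left hU.le h, testFun, topMark_of_nonpos h]
    · rcases le_or_gt U u with h' | h'
      · rw [Set.projIcc_of_right_le hU.le h']
        exact (hfU x u h').trans (hfU x U le_rfl).symm
      · rw [Set.projIcc_of_mem hU.le ⟨h.le, h'.le⟩]
        rfl
  obtain ⟨δ, hδ, h⟩ := Metric.uniformContinuous_iff.1 hH τ hτ
  refine ⟨δ / 2, half_pos hδ, fun x x' u u' hx hu => ?_⟩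
  rw [hfH, hfH, ← Real.dist_eq]
  refine (h (max_lt ?_ ?_)).le
  · rw [Subtype.dist_eq, Real.dist_eq]
    exact ((Set.abs_projIcc_sub_projIcc zero_le_one).trans hx).trans_lt (half_lt_self hδ)
  · rw [Subtype.dist_eq, Real.dist_eq]
    exact ((Set.abs_projIcc_sub_projIcc hU.le).trans hu).trans_lt (half_lt_self hδ)

/-- `θ(g) - log R = -log (-R G'(g))`, so the `u`-coordinate of a gap is `-R G'(g)`. -/
lemma apply_gapMark {Ω : Type u} [MeasurableSpace Ω] {P : Measure Ω} {Z : Ω → Set ℝ}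
    (f : GapSpace → ℝ) {R g : ℝ} (hR : 0 < R) (hg : 0 < -deriv (gapProb P Z) g) (z : ℝ) :
    f (gapMark P Z R z g) = testFun f (z / R) (R * -deriv (gapProb P Z) g) := by
  rw [gapMark, testFun, topMark_of_pos (mul_pos hR hg), Real.log_mul hR.ne' hg.ne', scaling]
  congr 3
  ring

end TestFunction

/-! ### The limit intensity and Riemann sums -/

section LimitIntensity

lemma map_neg_log_volume : ((volume : Measure ℝ).restrict (Set.Ioi 0)).map (fun u => -Real.log u) =
    (volume : Measure ℝ).withDensity fun y => ENNReal.ofReal (Real.exp (-y)) := by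
  ext B hB
  rw [Measure.map_apply (by fun_prop) hB, withDensity_apply _ hB,
    Measure.restrict_apply ((by fun_prop : Measurable fun u : ℝ => -Real.log u) hB)]
  have himg : (fun u => -Real.log u) ⁻¹' B ∩ Set.Ioi 0 = (fun y => Real.exp (-y)) '' B := by
    ext u
    constructor
    · rintro ⟨h1, h2⟩
      exact ⟨-Real.log u, h1, by simp [Real.exp_log h2]⟩
    · rintro ⟨y, hy, rfl⟩
      exact ⟨by simpa using hy, Real.exp_pos _⟩
  have hd : ∀ y ∈ B, HasDerivWithinAt (fun y => Real.exp (-y)) (-Real.exp (-y)) B y := by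
    intro y _
    have := ((hasDerivAt_id y).neg.exp).hasDerivWithinAt (s := B)
    simpa using this
  have hinj : Set.InjOn (fun y => Real.exp (-y)) B := fun y _ y' _ h =>
    neg_injective (Real.exp_injective h)
  have := lintegral_image_eq_lintegral_abs_deriv_mul hB hd hinj fun _ => 1
  rw [lintegral_one, Measure.restrict_apply_univ] at this
  rw [himg, this]
  simp [abs_of_pos (Real.exp_pos _)]

/-- The change of variables `u = e^{-y}` turns `e^{-y} dy` into Lebesgue measure on `(0, ∞)`. -/
lemma limitIntensity_eq_map : limitIntensity =
    ((volume : Measure (Set.Icc (0 : ℝ) 1)).prod ((volume : Measure ℝ).restrict (Set.Ioi 0))).map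
      fun p => (p.1, topMark p.2) := by
  have h1 : ((volume : Measure ℝ).withDensity fun y => ENNReal.ofReal (Real.exp (-y))).map toRealTop =
      ((volume : Measure ℝ).restrict (Set.Ioi 0)).map topMark := by
    rw [← map_neg_log_volume, Measure.map_map measurable_toRealTop (by fun_prop)]
    refine Measure.map_congr ?_
    filter_upwards [ae_restrict_mem measurableSet_Ioi] with u hu
    exact (topMark_of_pos hu).symm
  rw [limitIntensity, h1]
  have := Measure.map_prod_map (volume : Measure (Set.Icc (0 : ℝ) 1))
    ((volume : Measure ℝ).restrict (Set.Ioi 0)) measurable_id continuous_topMark.measurable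
  rw [Measure.map_id] at this
  exact this

lemma measurable_prod_topMark :
    Measurable fun p : Set.Icc (0 : ℝ) 1 × ℝ => ((p.1, topMark p.2) : GapSpace) :=
  measurable_fst.prodMk (continuous_topMark.measurable.comp measurable_snd)

lemma limitIntensity_support_lt_top {f : GapSpace → ℝ} (hf : Measurable f) {U : ℝ}
    (hfU : ∀ x u, U ≤ u → testFun f x u = 0) : limitIntensity (Function.support f) < ∞ := by
  rw [limitIntensity_eq_map, Measure.map_apply measurable_prod_topMark (measurableSet_support hf)]
  have hsub : (fun p : Set.Icc (0 : ℝ) 1 × ℝ => ((p.1, topMark p.2) : GapSpace)) ⁻¹'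
      Function.support f ⊆ Set.univ ×ˢ Set.Iio U := by
    rintro ⟨x, u⟩ h
    refine ⟨Set.mem_univ _, show u < U from not_le.1 fun hu => h ?_⟩
    have := hfU x u hu
    rwa [testFun, Set.projIcc_val] at this
  refine (measure_mono hsub).trans_lt ?_
  rw [Measure.prod_prod, Measure.restrict_apply measurableSet_Iio]
  refine ENNReal.mul_lt_top (measure_lt_top _ _) ?_
  rw [Set.inter_comm, Set.Ioi_inter_Iio, Real.volume_Ioo]
  exact ENNReal.ofReal_lt_top

/-- The error of a Riemann sum. -/
lemma norm_integral_sub_riemannSum_le {g : ℝ → ℂ} {L τ : ℝ} (hL : 0 ≤ L) {M : ℕ} (hM : 0 < M)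
    (hg : Continuous g) (v : ℕ → ℂ)
    (h : ∀ j < M, ∀ t, j * (L / M) ≤ t → t ≤ (j + 1) * (L / M) → ‖g t - v j‖ ≤ τ) :
    ‖(∫ t in (0 : ℝ)..L, g t) - ∑ j ∈ Finset.range M, ((L / M : ℝ) : ℂ) * v j‖ ≤ L * τ := by
  have hM' : (0 : ℝ) < M := by exact_mod_cast hM
  have hLM : 0 ≤ L / M := by positivity
  have hsum : ∫ t in (0 : ℝ)..L, g t =
      ∑ j ∈ Finset.range M, ∫ t in (j * (L / M))..((j + 1) * (L / M)), g t := by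
    have := intervalIntegral.sum_integral_adjacent_intervals (f := g) (μ := volume)
      (a := fun j : ℕ => (j : ℝ) * (L / M)) (n := M) fun k _ => hg.intervalIntegrable _ _
    simp only [Nat.cast_zero, zero_mul, Nat.cast_add, Nat.cast_one] at this
    rw [this, mul_div_cancel₀ _ hM'.ne']
  rw [hsum, ← Finset.sum_sub_distrib]
  have hj : ∀ j ∈ Finset.range M, ‖(∫ t in (j * (L / M))..((j + 1) * (L / M)), g t) -
      ((L / M : ℝ) : ℂ) * v j‖ ≤ L / M * τ := by
    intro j hj
    have hle : (j : ℝ) * (L / M) ≤ (j + 1) * (L / M) := by nlinarith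
    have e : (∫ t in (j * (L / M))..((j + 1) * (L / M)), g t) - ((L / M : ℝ) : ℂ) * v j =
        ∫ t in (j * (L / M))..((j + 1) * (L / M)), (g t - v j) := by
      rw [intervalIntegral.integral_sub (hg.intervalIntegrable _ _) (by simp),
        intervalIntegral.integral_const, Complex.real_smul]
      congr 3
      ring
    rw [e]
    refine (intervalIntegral.norm_integral_le_of_norm_le_const (C := τ) fun t ht => ?_).trans_eq ?_
    · rw [Set.uIoc_of_le hle] at ht
      exact h j (Finset.mem_range.1 hj) t ht.1.le ht.2
    · rw [abs_of_nonneg (by linarith)]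
      ring
  refine (norm_sum_le_of_le _ hj).trans_eq ?_
  rw [Finset.sum_const, Finset.card_range, nsmul_eq_mul]
  field_simp

/-- The exponent in the characteristic functional of the limit is close to a Riemann sum. -/
lemma norm_integral_limitIntensity_sub_le {f : GapSpace → ℝ} (hf : Continuous f) {U τ δ : ℝ}
    (hU : 0 < U) (hfU : ∀ x u, U ≤ u → testFun f x u = 0) {n M : ℕ} (hn : 0 < n) (hM : 0 < M)
    (hδ : ∀ x x' u u', |x - x'| ≤ δ → |u - u'| ≤ δ → |testFun f x u - testFun f x' u'| ≤ τ)
    (hnδ : 1 / (n : ℝ) ≤ δ) (hMδ : U / M ≤ δ) :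
    ‖∫ p, (Complex.exp (f p * Complex.I) - 1) ∂limitIntensity -
      ∑ i ∈ Finset.range n, ((1 / n : ℝ) : ℂ) * ∑ j ∈ Finset.range M, ((U / M : ℝ) : ℂ) *
        (Complex.exp (testFun f (i / n) ((j + 1) * (U / M)) * Complex.I) - 1)‖ ≤ U * τ := by
  set W : ℝ → ℝ → ℂ := fun x u => Complex.exp (testFun f x u * Complex.I) - 1 with hW
  have hWc : Continuous fun p : ℝ × ℝ => W p.1 p.2 :=
    ((Complex.continuous_exp.comp ((Complex.continuous_ofReal.comp
      (continuous_testFun hf)).mul continuous_const))).sub continuous_const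
  have hW0 : ∀ x u, U ≤ u → W x u = 0 := fun x u h => by simp [hW, hfU x u h]
  have hW2 : ∀ x u, ‖W x u‖ ≤ 2 := fun x u =>
    (norm_sub_le _ _).trans (by rw [Complex.norm_exp_ofReal_mul_I, norm_one]; norm_num)
  have hWδ : ∀ x x' u u', |x - x'| ≤ δ → |u - u'| ≤ δ → ‖W x u - W x' u'‖ ≤ τ := by
    intro x x' u u' hx hu
    simp only [hW, sub_sub_sub_cancel_right]
    exact (norm_exp_mul_I_sub_exp_mul_I_le _ _).trans (hδ x x' u u' hx hu)
  have hint : ∫ p, (Complex.exp (f p * Complex.I) - 1) ∂limitIntensity =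
      ∫ x in (0 : ℝ)..1, ∫ u in (0 : ℝ)..U, W x u := by
    rw [limitIntensity_eq_map, integral_map measurable_prod_topMark.aemeasurable]
    · have e1 : ∀ p : Set.Icc (0 : ℝ) 1 × ℝ,
          Complex.exp (f (p.1, topMark p.2) * Complex.I) - 1 = W p.1 p.2 := by
        intro p
        simp only [hW, testFun, Set.projIcc_val]
      simp_rw [e1]
      have hi : Integrable (fun p : Set.Icc (0 : ℝ) 1 × ℝ => W p.1 p.2)
          ((volume : Measure (Set.Icc (0 : ℝ) 1)).prod
            ((volume : Measure ℝ).restrict (Set.Ioi 0))) := by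
        have hc : Continuous fun p : Set.Icc (0 : ℝ) 1 × ℝ => W p.1 p.2 :=
          hWc.comp ((continuous_subtype_val.comp continuous_fst).prodMk continuous_snd)
        have h1 : IntegrableOn (fun p : Set.Icc (0 : ℝ) 1 × ℝ => W p.1 p.2)
            (Set.univ ×ˢ Set.Iio U) ((volume : Measure (Set.Icc (0 : ℝ) 1)).prod
            ((volume : Measure ℝ).restrict (Set.Ioi 0))) := by
          refine Measure.integrableOn_of_bounded (M := 2) ?_ hc.aestronglyMeasurable
            (Eventually.of_forall fun p => hW2 _ _)
          rw [Measure.prod_prod, Measure.restrict_apply measurableSet_Iio]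
          refine (ENNReal.mul_lt_top (measure_lt_top _ _) ?_).ne
          rw [Set.inter_comm, Set.Ioi_inter_Iio, Real.volume_Ioo]
          exact ENNReal.ofReal_lt_top
        refine h1.integrable_of_forall_notMem_eq_zero fun p hp => hW0 _ _ ?_
        by_contra! h
        exact hp ⟨Set.mem_univ _, h⟩
      rw [integral_prod _ hi]
      have e2 : ∀ x : ℝ, ∫ u in Set.Ioi 0, W x u = ∫ u in (0 : ℝ)..U, W x u := by
        intro x
        rw [intervalIntegral.integral_of_le hU.le]
        refine setIntegral_eq_of_subset_of_forall_sdiff_eq_zero measurableSet_Ioi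
          Set.Ioc_subset_Ioi_self fun u hu => hW0 x u ?_
        by_contra! h
        exact hu.2 ⟨hu.1, h.le⟩
      simp_rw [e2]
      rw [integral_subtype measurableSet_Icc fun x => ∫ u in (0 : ℝ)..U, W x u,
        integral_Icc_eq_integral_Ioc, intervalIntegral.integral_of_le zero_le_one]
    · exact ((Complex.continuous_exp.comp ((Complex.continuous_ofReal.comp hf).mul
        continuous_const)).sub continuous_const).aestronglyMeasurable
  rw [hint]
  -- The sampling points are left ends in `x` and right ends in `u`, to match the positions of the
  -- cells and the marks `(j + 1) h` of the levels.
  have hinner : ∀ i < n, ∀ x : ℝ, i * (1 / (n : ℝ)) ≤ x → x ≤ (i + 1) * (1 / (n : ℝ)) →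
      ‖(∫ u in (0 : ℝ)..U, W x u) -
        ∑ j ∈ Finset.range M, ((U / M : ℝ) : ℂ) * W (i / n) ((j + 1) * (U / M))‖ ≤ U * τ := by
    intro i _ x hx hx'
    refine norm_integral_sub_riemannSum_le (g := fun u => W x u) hU.le hM
      (hWc.comp (continuous_const.prodMk continuous_id)) _ fun j _ u hu hu' => hWδ _ _ _ _ ?_ ?_
    · rw [div_eq_mul_one_div, abs_le]
      rw [add_mul, one_mul] at hx'
      have : 0 ≤ 1 / (n : ℝ) := by positivity
      constructor <;> linarith
    · rw [abs_le]
      rw [add_mul, one_mul] at hu' ⊢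
      have : 0 ≤ U / (M : ℝ) := by positivity
      constructor <;> linarith
  have := norm_integral_sub_riemannSum_le (g := fun x => ∫ u in (0 : ℝ)..U, W x u)
    zero_le_one hn (intervalIntegral.continuous_parametric_intervalIntegral_of_continuous'
      hWc 0 U) _ hinner
  rwa [one_mul] at this

/-- Summation by parts. It turns the expectation of a cell weight, a combination of increments, into
a Riemann sum, the boundary term vanishing at level `M`. -/
lemma sum_mul_succ_sub (a : ℕ → ℂ) (b : ℂ) (M : ℕ) :
    ∑ j ∈ Finset.range M, (a j - a (j + 1)) * ((j + 1) * b) =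
      ∑ j ∈ Finset.range M, b * a j - M * b * a M := by
  induction M with
  | zero => simp
  | succ M ih =>
    rw [Finset.sum_range_succ, ih, Finset.sum_range_succ]
    push_cast
    ring

end LimitIntensity

/-! ### Telescoping over the levels -/

section Telescope

variable {A : Type*} [AddCommGroup A]

lemma exists_forall_iff_le {M : ℕ} {p : ℕ → Prop} (hp : ∀ j k, j ≤ k → k < M → p j → p k) :
    ∃ m ≤ M, ∀ j < M, p j ↔ m ≤ j := by
  classical
  have hex : ∃ j, j = M ∨ p j := ⟨M, Or.inl rfl⟩
  refine ⟨Nat.find hex, Nat.find_min' hex (Or.inl rfl), fun j hj => ?_⟩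
  refine ⟨fun h => Nat.find_min' hex (Or.inr h), fun h => ?_⟩
  rcases Nat.find_spec hex with h' | h'
  · omega
  · exact hp _ _ h hj h'

/-- The events of a cell increase with the level, so the indicators are those of `m ≤ j` for a first
level `m`, with `m = M` when no event occurs, and the sum telescopes. -/
lemma sum_range_ite_sub_succ (φ : ℕ → A) {m M : ℕ} (hm : m ≤ M) {p : ℕ → Prop} [DecidablePred p]
    (hp : ∀ j < M, p j ↔ m ≤ j) :
    ∑ j ∈ Finset.range M, (if p j then φ j - φ (j + 1) else 0) = φ m - φ M := by
  have h1 : ∀ j ∈ Finset.range M,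
      (if p j then φ j - φ (j + 1) else 0) = φ (max m j) - φ (max m (j + 1)) := by
    intro j hj
    rw [if_congr (hp j (Finset.mem_range.1 hj)) rfl rfl]
    split_ifs with h
    · rw [max_eq_right h, max_eq_right (by omega)]
    · rw [max_eq_left (by omega), max_eq_left (by omega), sub_self]
  rw [Finset.sum_congr rfl h1, Finset.sum_range_sub' fun j => φ (max m j), max_eq_left (Nat.zero_le _),
    max_eq_right hm]

end Telescope

/-! ### Cell weights and the comparison with the rescaled gaps -/

section CellWeight

variable {Ω : Type u} [MeasurableSpace Ω] {P : Measure Ω} {Z : Ω → Set ℝ}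

/-- The gap lengths `r j`, `j < M`, have marks `(j + 1) h`, and the marks vary by at most `h` when
they are shortened by `ε`. -/
structure IsLevelGrid (P : Measure Ω) (Z : Ω → Set ℝ) (R ε h : ℝ) (M : ℕ) (r : ℕ → ℝ) : Prop where
  pos : 0 < R
  eps_pos : 0 < ε
  step_pos : 0 < h
  lt : ∀ j < M, ε < r j
  level : ∀ j < M, R * -deriv (gapProb P Z) (r j) = (j + 1) * h
  level_sub : ∀ j < M, R * -deriv (gapProb P Z) (r j - ε) ≤ (j + 1) * h + h

namespace IsLevelGrid

variable {R ε h : ℝ} {M : ℕ} {r : ℕ → ℝ}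

lemma antitone [IsProbabilityMeasure P] (H : IsLevelGrid P Z R ε h M r) (h_regular : GapRegularity P Z) {j k : ℕ}
    (hjk : j ≤ k) (hk : k < M) : r k ≤ r j := by
  rcases hjk.eq_or_lt with rfl | hlt
  · exact le_rfl
  · refine (threshold_lt_threshold h_regular H.pos (H.eps_pos.trans (H.lt j (hlt.trans hk)))
      (H.eps_pos.trans (H.lt k hk)) (H.level j (hlt.trans hk)) (H.level k hk) ?_).le
    have h1 : (j : ℝ) < k := by exact_mod_cast hlt
    have h2 := H.step_pos
    nlinarith

/-- Higher marks correspond to shorter gap lengths, and a shorter empty interval is a weaker demand.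
-/
lemma cellEvent_subset [IsProbabilityMeasure P] (H : IsLevelGrid P Z R ε h M r) (h_regular : GapRegularity P Z) {j k : ℕ}
    (hjk : j ≤ k) (hk : k < M) (i : ℕ) : cellEvent Z ε (r j) i ⊆ cellEvent Z ε (r k) i := by
  intro ω hω
  rw [mem_cellEvent H.eps_pos (H.lt j (hjk.trans_lt hk)).le] at hω
  rw [mem_cellEvent H.eps_pos (H.lt k hk).le]
  have := H.antitone h_regular hjk hk
  exact ⟨Set.eq_empty_of_subset_empty fun x hx =>
    hω.1.subset ⟨hx.1, hx.2.1, by linarith [hx.2.2]⟩, hω.2⟩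

lemma exists_mem_iff_le [IsProbabilityMeasure P] (H : IsLevelGrid P Z R ε h M r) (h_regular : GapRegularity P Z) (i : ℕ)
    (ω : Ω) : ∃ m ≤ M, ∀ j < M, ω ∈ cellEvent Z ε (r j) i ↔ m ≤ j :=
  exists_forall_iff_le fun _ _ hjk hk hω => H.cellEvent_subset h_regular hjk hk i hω

end IsLevelGrid

/-- The function of a cell that takes the value `W j` if the gap starting in the cell is between
`r j` and `r (j - 1)`. -/
noncomputable def cellWeight (Z : Ω → Set ℝ) (ε : ℝ) (r : ℕ → ℝ) (M : ℕ) (W : ℕ → ℂ) (i : ℕ)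
    (ω : Ω) : ℂ :=
  ∑ j ∈ Finset.range M, (cellEvent Z ε (r j) i).indicator (fun _ => W j - W (j + 1)) ω

omit [MeasurableSpace Ω] in
lemma cellWeight_eq {ε : ℝ} {r : ℕ → ℝ} {M m : ℕ} (hm : m ≤ M) {i : ℕ} {ω : Ω}
    (h : ∀ j < M, ω ∈ cellEvent Z ε (r j) i ↔ m ≤ j) (W : ℕ → ℂ) :
    cellWeight Z ε r M W i ω = W m - W M := by
  classical
  rw [← sum_range_ite_sub_succ W hm h, cellWeight]
  exact Finset.sum_congr rfl fun j _ => Set.indicator_apply _ _ _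

lemma measurable_cellWeight (hZ : IsStationaryPointProcess P Z) (ε : ℝ) (r : ℕ → ℝ) (M : ℕ)
    (W : ℕ → ℂ) (i : ℕ) : Measurable (cellWeight Z ε r M W i) :=
  Finset.measurable_fun_sum _ fun _ _ =>
    measurable_const.indicator (measurableSet_cellEvent hZ _ _ _)

lemma integral_cellWeight [IsProbabilityMeasure P] (hZ : IsStationaryPointProcess P Z) {ε : ℝ}
    (hε : 0 ≤ ε) (r : ℕ → ℝ) (M : ℕ) (W : ℕ → ℂ) (i : ℕ) :
    ∫ ω, cellWeight Z ε r M W i ω ∂P = ∑ j ∈ Finset.range M,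
      (W j - W (j + 1)) * ((gapProb P Z (r j - ε) - gapProb P Z (r j) : ℝ) : ℂ) := by
  simp only [cellWeight]
  rw [integral_finsetSum _ fun j _ =>
    (integrable_const _).indicator (measurableSet_cellEvent hZ _ _ _)]
  refine Finset.sum_congr rfl fun j _ => ?_
  rw [integral_indicator_const _ (measurableSet_cellEvent hZ _ _ _), real_cellEvent hZ hε,
    Complex.real_smul, mul_comm]

omit [MeasurableSpace Ω] in
/-- A cell weight is a linear combination of indicators of gap events. -/
lemma cellWeight_eq_sum_gapEvent {ε : ℝ} (hε : 0 ≤ ε) (r : ℕ → ℝ) (M : ℕ) (W : ℕ → ℂ) (i : ℕ)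
    (ω : Ω) :
    cellWeight Z ε r M W i ω = ∑ t : Fin M × Bool,
      (if t.2 then W t.1 - W (t.1 + 1) else -(W t.1 - W (t.1 + 1))) *
        (gapEvent Z (Set.Icc (i * ε + if t.2 then ε else 0) (i * ε + r t.1))).indicator 1 ω := by
  rw [cellWeight, Fintype.sum_prod_type, ← Fin.sum_univ_eq_sum_range
    fun j => (cellEvent Z ε (r j) i).indicator (fun _ => W j - W (j + 1)) ω]
  refine Finset.sum_congr rfl fun j _ => ?_
  rw [Fintype.sum_bool]
  simp only [if_true, Bool.false_eq_true, if_false, add_zero, cellEvent]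
  by_cases h1 : ω ∈ gapEvent Z (Set.Icc (i * ε) (i * ε + r j))
  · have h2 := gapEvent_cell_subset hε i h1
    simp [h1, h2]
  · by_cases h2 : ω ∈ gapEvent Z (Set.Icc (i * ε + ε) (i * ε + r j)) <;> simp [h1, h2]

/-- The characteristic function of `∫ f dΨ_R` factorizes approximately over the cells. -/
lemma norm_exp_integral_rescaledGaps_sub_prod_le [IsProbabilityMeasure P] (h_decay : GapDecay P Z)
    (h_regular : GapRegularity P Z) {f : GapSpace → ℝ} {R ε h τ δ : ℝ} {n M : ℕ} {r : ℕ → ℝ}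
    (H : IsLevelGrid P Z R ε h M r) (hn : 0 < n) (hM : 0 < M) (hnε : n * ε = R)
    (hfU : ∀ x u, M * h ≤ u → testFun f x u = 0)
    (hδ : ∀ x x' u u', |x - x'| ≤ δ → |u - u'| ≤ δ → |testFun f x u - testFun f x' u'| ≤ τ)
    (hnδ : 1 / (n : ℝ) ≤ δ) (hhδ : h ≤ δ) {ω : Ω} (hS : ∀ a b : ℝ, (Z ω ∩ Set.Icc a b).Finite)
    (hS' : ∀ a : ℝ, (Z ω ∩ Set.Ioi a).Nonempty)  (hτ : 0 ≤ τ) :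
    ‖Complex.exp ((∫ x, f x ∂(rescaledGaps P Z R ω) : ℝ) * Complex.I) -
      ∏ i ∈ Finset.range n, (1 + cellWeight Z ε r M
        (fun j => Complex.exp (testFun f (i / n) ((j + 1) * h) * Complex.I) - 1) i ω)‖ ≤
      τ * ∑ i ∈ Finset.range n, (cellEvent Z ε (r (M - 1)) i).indicator 1 ω +
        2 * (cellEvent Z ε (r (M - 1)) n).indicator 1 ω := by
  classical
  choose m hmM hm using fun i => H.exists_mem_iff_le h_regular i ω
  have hε := H.eps_pos
  have hh := H.step_pos
  have hR := H.pos
  have hn' : (0 : ℝ) < n := by exact_mod_cast hn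
  have hM1 : M - 1 < M := by omega
  have hMr := H.lt _ hM1
  set φ : ℕ → ℕ → ℝ := fun i j => testFun f (i / n) ((j + 1) * h) with hφ
  have hφM : ∀ i, φ i M = 0 := fun i => hfU _ _ (by nlinarith)
  have hone : ∀ i, 1 + cellWeight Z ε r M (fun j => Complex.exp (φ i j * Complex.I) - 1) i ω =
      Complex.exp (φ i (m i) * Complex.I) := by
    intro i
    rw [cellWeight_eq (hmM i) (hm i), hφM]
    simp
  have hprod : ∏ i ∈ Finset.range n,
      (1 + cellWeight Z ε r M (fun j => Complex.exp (φ i j * Complex.I) - 1) i ω) =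
      Complex.exp ((∑ i ∈ Finset.range n, φ i (m i) : ℝ) * Complex.I) := by
    rw [Finset.prod_congr rfl fun i _ => hone i, ← Complex.exp_sum, Complex.ofReal_sum,
      Finset.sum_mul]
  rw [hprod]
  have hsum0 : (0 : ℝ) ≤ ∑ i ∈ Finset.range n, (cellEvent Z ε (r (M - 1)) i).indicator 1 ω :=
    Finset.sum_nonneg fun i _ => Set.indicator_nonneg (fun _ _ => zero_le_one) _
  -- The cells `0, …, n - 1` cover `[0, R)`; the point `R` belongs to cell `n`, whose rare event is
  -- paid for by the trivial bound 2.
  by_cases hlast : ω ∈ cellEvent Z ε (r (M - 1)) n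
  · rw [Set.indicator_of_mem hlast, Pi.one_apply, mul_one]
    refine le_trans ?_ (le_add_of_nonneg_left (mul_nonneg hτ hsum0))
    refine (norm_sub_le _ _).trans ?_
    rw [Complex.norm_exp_ofReal_mul_I, Complex.norm_exp_ofReal_mul_I]
    norm_num
  rw [Set.indicator_of_notMem hlast, mul_zero, add_zero]
  refine (norm_exp_mul_I_sub_exp_mul_I_le _ _).trans ?_
  set D : ℝ → ℝ := fun g => R * -deriv (gapProb P Z) g with hD
  have hDpos : ∀ g, 0 < g → 0 < D g := fun g hg =>
    mul_pos hR (by linarith [h_regular.deriv_neg h_decay hg])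
  have hDanti : ∀ g g', 0 < g → g ≤ g' → D g' ≤ D g := fun g g' hg hgg' =>
    mul_le_mul_of_nonneg_left
      (neg_le_neg (h_regular.monotoneOn_deriv hg (hg.trans_le hgg') hgg')) hR.le
  have hl := isLeast_nextPoint hS hS'
  set F : ℝ → ℝ := fun z => testFun f (z / R) (D (nextPoint (Z ω) z - z)) with hF
  have hint : ∫ x, f x ∂(rescaledGaps P Z R ω) = ∑ z ∈ (hS 0 R).toFinset, F z := by
    rw [integral_rescaledGaps f R hS hS']
    refine Finset.sum_congr rfl fun z _ => apply_gapMark f hR ?_ z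
    linarith [h_regular.deriv_neg h_decay (sub_pos.2 (hl z).1.2)]
  set T := (Finset.range n).filter fun i => ω ∈ cellEvent Z ε (r (M - 1)) i with hT
  have hTM : ∀ i, ω ∈ cellEvent Z ε (r (M - 1)) i ↔ m i < M := fun i => by
    rw [hm i _ hM1]
    omega
  -- The large gap starts at the last point of the cell.
  have hζ : ∀ i, i ∈ T → ∃ z, z ∈ Z ω ∧ i * ε ≤ z ∧ z < i * ε + ε ∧
      i * ε + ε ≤ nextPoint (Z ω) z := by
    intro i hi
    obtain ⟨-, hne⟩ := (mem_cellEvent hε hMr.le).1 (Finset.mem_filter.1 hi).2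
    have hfin : (Z ω ∩ Set.Ico (i * ε) (i * ε + ε)).Finite :=
      (hS (i * ε) (i * ε + ε)).subset (Set.inter_subset_inter_right _ Set.Ico_subset_Icc_self)
    obtain ⟨z, hz, hmax⟩ := Set.exists_max_image _ id hfin hne
    refine ⟨z, hz.1, hz.2.1, hz.2.2, ?_⟩
    by_contra! hlt
    exact (hmax _ ⟨(hl z).1.1, hz.2.1.trans (le_of_lt (hl z).1.2), hlt⟩).not_gt (hl z).1.2
  choose! ζ hζZ hζl hζr hζn using hζ
  have hnext : ∀ i ∈ T, ∀ j < M, ω ∈ cellEvent Z ε (r j) i →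
      i * ε + r j < nextPoint (Z ω) (ζ i) := by
    intro i hi j hj hω
    by_contra! hle
    exact ((mem_cellEvent hε (H.lt j hj).le).1 hω).1.subset
      ⟨(hl (ζ i)).1.1, hζn i hi, hle⟩
  -- The gap is longer than `r m - ε`; and if `m > 0` it is at most `r (m - 1)`, because the event
  -- of level `m - 1` fails. So its mark is between `m h` and `(m + 2) h`, within `h ≤ δ` of the
  -- sampling point.
  have hmark : ∀ i ∈ T, |F (ζ i) - φ i (m i)| ≤ τ := by
    intro i hi
    have hiM := (hTM i).1 (Finset.mem_filter.1 hi).2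
    have h1 := hnext i hi _ hiM ((hm i _ hiM).2 le_rfl)
    have h2 := hζr i hi
    have h3 := hζl i hi
    have h4 := H.lt _ hiM
    have hle : D (nextPoint (Z ω) (ζ i) - ζ i) ≤ (m i + 1) * h + h :=
      (hDanti (r (m i) - ε) _ (by linarith) (by linarith)).trans (H.level_sub _ hiM)
    have hge : m i * h ≤ D (nextPoint (Z ω) (ζ i) - ζ i) := by
      rcases Nat.eq_zero_or_pos (m i) with h0 | h0
      · rw [h0, Nat.cast_zero, zero_mul]
        exact (hDpos _ (sub_pos.2 (hl _).1.2)).le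
      · have hlt : m i - 1 < M := by omega
        have hnot : ω ∉ cellEvent Z ε (r (m i - 1)) i := by
          rw [hm i _ hlt]
          omega
        rw [mem_cellEvent hε (H.lt _ hlt).le, not_and] at hnot
        have hne := ((mem_cellEvent hε hMr.le).1 (Finset.mem_filter.1 hi).2).2
        obtain ⟨y, hy, hy1, hy2⟩ := Set.nonempty_iff_ne_empty.2 fun h => hnot h hne
        have h5 := (hl (ζ i)).2 ⟨hy, show ζ i < y by linarith⟩
        have h6 := hDanti _ (r (m i - 1)) (sub_pos.2 (hl (ζ i)).1.2) (by linarith)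
        rw [hD] at h6
        simp only at h6
        rw [H.level _ hlt, Nat.cast_sub h0] at h6
        rwa [Nat.cast_one, sub_add_cancel] at h6
    refine hδ _ _ _ _ ?_ ?_
    · have e1 : ζ i / R - i / n = (ζ i - i * ε) / R := by
        rw [← hnε]
        field_simp
      have e2 : 1 / (n : ℝ) = ε / R := by
        rw [← hnε]
        field_simp
      rw [e1, abs_of_nonneg (div_nonneg (by linarith) hR.le)]
      refine le_trans ?_ hnδ
      rw [e2]
      exact div_le_div_of_nonneg_right (by linarith) hR.le
    · rw [abs_le]
      constructor <;> linarith
  have hmem : ∀ i ∈ T, ζ i ∈ (hS 0 R).toFinset := by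
    intro i hi
    have h1 : i < n := Finset.mem_range.1 (Finset.mem_filter.1 hi).1
    have h2 : (i : ℝ) + 1 ≤ n := by exact_mod_cast h1
    have h3 := hζl i hi
    have h4 := hζr i hi
    refine (hS 0 R).mem_toFinset.2 ⟨hζZ i hi, le_trans (by positivity) h3, ?_⟩
    rw [← hnε]
    nlinarith
  have hinj : Set.InjOn ζ T := by
    have key : ∀ i ∈ T, ∀ j ∈ T, i < j → ζ i < ζ j := by
      intro i hi j hj hij
      have h1 : (i : ℝ) + 1 ≤ j := by exact_mod_cast hij
      have h3 := hζl j hj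
      have h4 := hζr i hi
      nlinarith
    intro i hi j hj hij
    rcases lt_trichotomy i j with h | h | h
    · exact absurd hij (key i hi j hj h).ne
    · exact h
    · exact absurd hij (key j hj i hi h).ne'
  have hzero : ∀ z ∈ (hS 0 R).toFinset, z ∉ ζ '' T → F z = 0 := by
    intro z hz hzT
    obtain ⟨hzZ, hz0, hzR⟩ := (hS 0 R).mem_toFinset.1 hz
    by_contra hne
    -- A gap of length at most `r (M - 1)` has mark at least `M h`, where the test function
    -- vanishes. A longer one exceeds `ε`, so it starts at the last point of its cell.
    have hgap : r (M - 1) < nextPoint (Z ω) z - z := by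
      by_contra! hle
      refine hne (hfU _ _ ?_)
      have h1 := hDanti _ _ (sub_pos.2 (hl z).1.2) hle
      refine le_trans (le_of_eq ?_) h1
      rw [hD]
      simp only
      rw [H.level _ hM1, Nat.cast_sub hM]
      simp
    set i := ⌊z / ε⌋₊ with hi
    have hil : i * ε ≤ z := by
      rw [← le_div_iff₀ hε]
      exact Nat.floor_le (div_nonneg hz0 hε.le)
    have hir : z < i * ε + ε := by
      have := Nat.lt_floor_add_one (z / ε)
      rw [div_lt_iff₀ hε, ← hi] at this
      linarith
    have hin : i ≤ n := by
      have h1 : (i : ℝ) * ε ≤ n * ε := by linarith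
      exact_mod_cast le_of_mul_le_mul_right h1 hε
    have hcell : ω ∈ cellEvent Z ε (r (M - 1)) i := by
      refine (mem_cellEvent hε hMr.le).2 ⟨Set.eq_empty_iff_forall_notMem.2 fun x hx => ?_,
        z, hzZ, hil, hir⟩
      have h1 := (hl z).2 ⟨hx.1, show z < x by linarith [hx.2.1]⟩
      linarith [hx.2.2]
    have hiT : i ∈ T := by
      refine Finset.mem_filter.2 ⟨Finset.mem_range.2 (lt_of_le_of_ne hin ?_), hcell⟩
      intro h
      rw [h] at hcell
      exact hlast hcell
    refine hzT ⟨i, hiT, ?_⟩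
    rcases lt_trichotomy (ζ i) z with h | h | h
    · have h1 := (hl (ζ i)).2 ⟨hzZ, h⟩
      linarith [hζn i hiT]
    · exact h
    · have h1 := (hl z).2 ⟨hζZ i hiT, h⟩
      linarith [hζr i hiT]
  have hT0 : ∀ i ∈ Finset.range n, i ∉ T → φ i (m i) = 0 := by
    intro i hi hiT
    have h1 : ¬ m i < M := fun h => hiT (Finset.mem_filter.2 ⟨hi, (hTM i).2 h⟩)
    rw [show m i = M by have := hmM i; omega, hφM]
  have e1 : ∑ z ∈ (hS 0 R).toFinset, F z = ∑ i ∈ T, F (ζ i) :=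
    (Finset.sum_of_injOn ζ hinj hmem hzero fun _ _ => rfl).symm
  have e2 : ∑ i ∈ Finset.range n, φ i (m i) = ∑ i ∈ T, φ i (m i) :=
    (Finset.sum_subset (Finset.filter_subset _ _) hT0).symm
  rw [hint, e1, e2, ← Finset.sum_sub_distrib]
  refine (Finset.abs_sum_le_sum_abs _ _).trans ((Finset.sum_le_sum hmark).trans_eq ?_)
  rw [Finset.mul_sum, Finset.sum_filter]
  refine Finset.sum_congr rfl fun i _ => ?_
  rw [Set.indicator_apply, Pi.one_apply]
  split_ifs <;> simp

end CellWeight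

/-! ### Moments of the cell weights -/

variable {Ω : Type u} [MeasurableSpace Ω] {P : Measure Ω} {Z : Ω → Set ℝ}

/-- Weights of cells that are far apart are nearly independent. -/
lemma norm_integral_prod_cellWeight_sub_le [IsProbabilityMeasure P]
    (hZ : IsStationaryPointProcess P Z) {ε C g ρ r₀ s₀ : ℝ} (hε : 0 ≤ ε) {S : Finset ℕ} {r : ℕ → ℝ}
    {M : ℕ} {W : ℕ → ℕ → ℂ} (hρ : 0 ≤ ρ) (hW : ∀ i ∈ S, ∀ j < M, ‖W i j - W i (j + 1)‖ ≤ C)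
    (hg : ∀ j < M, gapProb P Z (r j - ε) ≤ g) (hr : ∀ j < M, ε ≤ r j) (hr₀ : ∀ j < M, r j ≤ r₀)
    (hS : ∀ i ∈ S, ∀ j ∈ S, i < j → i * ε + (r₀ + s₀) ≤ j * ε)
    (hsplit : ∀ a b : ℕ → ℝ, SpacedOut S r₀ s₀ a b →
      |P.real (⋂ i ∈ S, gapEvent Z (Set.Icc (a i) (b i))) -
        ∏ i ∈ S, P.real (gapEvent Z (Set.Icc (a i) (b i)))| ≤
          ρ * ∏ i ∈ S, P.real (gapEvent Z (Set.Icc (a i) (b i)))) :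
    ‖∫ ω, ∏ i ∈ S, cellWeight Z ε r M (W i) i ω ∂P -
        ∏ i ∈ S, ∫ ω, cellWeight Z ε r M (W i) i ω ∂P‖ ≤ ρ * (2 * M * (C * g)) ^ S.card := by
  classical
  simp_rw [cellWeight_eq_sum_gapEvent hε, ← Finset.prod_coe_sort S]
  refine (norm_integral_prod_sum_sub_le
    (fun (i : S) (t : Fin M × Bool) => gapEvent Z (Set.Icc ((i : ℕ) * ε + if t.2 then ε else 0)
      ((i : ℕ) * ε + r t.1))) (fun i t => hZ.measurableSet_gapEvent measurableSet_Icc)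
    (fun i t => if t.2 then W i t.1 - W i (t.1 + 1) else -(W i t.1 - W i (t.1 + 1))) ρ ?_).trans ?_
  · intro p
    -- The choice of events is indexed by `S`; the value 0 outside `S` is never used.
    let a : ℕ → ℝ := fun i => if h : i ∈ S then i * ε + if (p ⟨i, h⟩).2 then ε else 0 else 0
    let b : ℕ → ℝ := fun i => if h : i ∈ S then i * ε + r (p ⟨i, h⟩).1 else 0
    have ha : ∀ i : S, a i = (i : ℕ) * ε + if (p i).2 then ε else 0 := fun i => dif_pos i.2
    have hb : ∀ i : S, b i = (i : ℕ) * ε + r (p i).1 := fun i => dif_pos i.2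
    have hite : ∀ q : Bool, 0 ≤ (if q then ε else 0) ∧ (if q then ε else 0) ≤ ε := by
      intro q
      split_ifs
      · exact ⟨hε, le_rfl⟩
      · exact ⟨le_rfl, hε⟩
    have hsp : SpacedOut S r₀ s₀ a b := by
      refine ⟨fun i hi => ?_, fun i hi => ?_, fun i hi j hj hij => ?_⟩
      · rw [ha ⟨i, hi⟩, hb ⟨i, hi⟩]
        linarith [hr _ (p ⟨i, hi⟩).1.2, (hite (p ⟨i, hi⟩).2).2]
      · rw [ha ⟨i, hi⟩, hb ⟨i, hi⟩]
        linarith [hr₀ _ (p ⟨i, hi⟩).1.2, (hite (p ⟨i, hi⟩).2).1]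
      · rw [ha ⟨j, hj⟩, hb ⟨i, hi⟩]
        linarith [hr₀ _ (p ⟨i, hi⟩).1.2, (hite (p ⟨j, hj⟩).2).1, hS i hi j hj hij]
    have h := hsplit a b hsp
    rw [← Finset.prod_coe_sort S, ← Set.iInter_subtype (fun i => i ∈ S)
      fun i => gapEvent Z (Set.Icc (a i) (b i))] at h
    simp only [ha, hb] at h
    exact h
  · refine mul_le_mul_of_nonneg_left ?_ hρ
    have hone : ∀ i : S, ∑ t : Fin M × Bool,
        ‖(if t.2 then W i t.1 - W i (t.1 + 1) else -(W i t.1 - W i (t.1 + 1)))‖ *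
          P.real (gapEvent Z (Set.Icc ((i : ℕ) * ε + if t.2 then ε else 0)
            ((i : ℕ) * ε + r t.1))) ≤ 2 * M * (C * g) := by
      intro i
      refine (Finset.sum_le_card_nsmul _ _ (C * g) fun t _ => ?_).trans_eq ?_
      · have h1 : ‖(if t.2 then W i t.1 - W i (t.1 + 1) else -(W i t.1 - W i (t.1 + 1)))‖ ≤ C := by
          split_ifs
          · exact hW _ i.2 _ t.1.2
          · rw [norm_neg]
            exact hW _ i.2 _ t.1.2
        refine mul_le_mul h1 ?_ measureReal_nonneg ((norm_nonneg _).trans h1)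
        rw [hZ.real_gapEvent_Icc]
        refine le_trans (gapProb_antitone ?_) (hg _ t.1.2)
        split_ifs <;> linarith
      · rw [Finset.card_univ, Fintype.card_prod, Fintype.card_fin, Fintype.card_bool, nsmul_eq_mul]
        push_cast
        ring
    refine (Finset.prod_le_prod (fun i _ => Finset.sum_nonneg fun t _ =>
      mul_nonneg (norm_nonneg _) measureReal_nonneg) fun i _ => hone i).trans_eq ?_
    rw [Finset.prod_const, Finset.card_univ, Fintype.card_coe]

section Grid

variable [IsProbabilityMeasure P] {R ε h σ : ℝ} {M n : ℕ} {r : ℕ → ℝ}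

/-- By convexity `n (G(r - ε) - G(r))` is between `-R G'(r)` and `-R G'(r - ε)`, as `n ε = R`. -/
lemma IsLevelGrid.abs_mul_real_cellEvent_sub_le (hZ : IsStationaryPointProcess P Z)
    (h_regular : GapRegularity P Z) (H : IsLevelGrid P Z R ε h M r) (hnε : n * ε = R)
    (hσ : ∀ j < M, R * -deriv (gapProb P Z) (r j - ε) ≤ (j + 1) * h + σ) {j : ℕ} (hj : j < M)
    (i : ℕ) : |n * P.real (cellEvent Z ε (r j) i) - (j + 1) * h| ≤ σ := by
  have hε := H.eps_pos
  have hb := h_regular.increment_bounds (sub_pos.2 (H.lt j hj)) (sub_le_self _ hε.le)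
  have h1 := H.level j hj
  have h2 := hσ j hj
  rw [sub_sub_cancel] at hb
  rw [← hnε] at h1 h2
  rw [real_cellEvent hZ hε.le]
  have hn : (0 : ℝ) ≤ n := n.cast_nonneg
  have h3 := mul_le_mul_of_nonneg_left hb.1 hn
  have h4 := mul_le_mul_of_nonneg_left hb.2 hn
  rw [abs_le]
  constructor <;> nlinarith

/-- The levels telescope to `exp(i φ_m)` at the first level `m` that occurs; vanishing of `φ` at `M`
removes the boundary term. -/
lemma norm_one_add_cellWeight (h_regular : GapRegularity P Z) (H : IsLevelGrid P Z R ε h M r)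
    {φ : ℕ → ℝ} (hφ : φ M = 0) (i : ℕ) (ω : Ω) :
    ‖1 + cellWeight Z ε r M (fun j => Complex.exp (φ j * Complex.I) - 1) i ω‖ = 1 := by
  obtain ⟨m, hm, hm'⟩ := H.exists_mem_iff_le h_regular i ω
  rw [cellWeight_eq hm hm', hφ]
  simp [Complex.norm_exp_ofReal_mul_I]

lemma cellWeight_eq_zero (h_regular : GapRegularity P Z) (H : IsLevelGrid P Z R ε h M r)
    (W : ℕ → ℂ) {i : ℕ} {ω : Ω} (hω : ω ∉ cellEvent Z ε (r (M - 1)) i) :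
    cellWeight Z ε r M W i ω = 0 :=
  Finset.sum_eq_zero fun j hj => Set.indicator_of_notMem (fun h' => hω
    (H.cellEvent_subset h_regular (by have := Finset.mem_range.1 hj; omega)
      (by have := Finset.mem_range.1 hj; omega) i h')) _

lemma norm_integral_cellWeight_le (hZ : IsStationaryPointProcess P Z)
    (h_regular : GapRegularity P Z) (H : IsLevelGrid P Z R ε h M r)
    {φ : ℕ → ℝ} (hφ : φ M = 0) (i : ℕ) :
    ‖∫ ω, cellWeight Z ε r M (fun j => Complex.exp (φ j * Complex.I) - 1) i ω ∂P‖ ≤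
      2 * P.real (cellEvent Z ε (r (M - 1)) i) := by
  have hA := measurableSet_cellEvent hZ ε (r (M - 1)) i
  have hint : ∫ ω, (cellEvent Z ε (r (M - 1)) i).indicator (fun _ => (2 : ℝ)) ω ∂P =
      2 * P.real (cellEvent Z ε (r (M - 1)) i) := by
    rw [integral_indicator_const _ hA, smul_eq_mul, mul_comm]
  rw [← hint]
  refine norm_integral_le_of_norm_le ((integrable_const _).indicator hA)
    (Eventually.of_forall fun ω => ?_)
  by_cases hω : ω ∈ cellEvent Z ε (r (M - 1)) i
  · rw [Set.indicator_of_mem hω]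
    have h1 := norm_one_add_cellWeight h_regular H hφ i ω
    have h2 := norm_sub_le
      (1 + cellWeight Z ε r M (fun j => Complex.exp (φ j * Complex.I) - 1) i ω) 1
    rw [h1, norm_one, add_sub_cancel_left] at h2
    linarith
  · rw [Set.indicator_of_notMem hω, cellWeight_eq_zero h_regular H _ hω, norm_zero]

/-- The `j`-th event of a cell has probability `(j + 1) h / n` up to `σ / n`; summation by parts
then produces the Riemann sum of `norm_integral_limitIntensity_sub_le`. -/
lemma norm_sum_integral_cellWeight_sub_le (hZ : IsStationaryPointProcess P Z)
    (h_regular : GapRegularity P Z) (H : IsLevelGrid P Z R ε h M r) (hn : 0 < n) (hnε : n * ε = R)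
    (hσ : ∀ j < M, R * -deriv (gapProb P Z) (r j - ε) ≤ (j + 1) * h + σ) {W : ℕ → ℕ → ℂ}
    (hWM : ∀ i, W i M = 0) (hW : ∀ i j, ‖W i j - W i (j + 1)‖ ≤ 2) :
    ‖∑ i ∈ Finset.range n, ∫ ω, cellWeight Z ε r M (W i) i ω ∂P -
      ∑ i ∈ Finset.range n, ((1 / n : ℝ) : ℂ) * ∑ j ∈ Finset.range M, (h : ℂ) * W i j‖ ≤
        2 * M * σ := by
  have hn' : (n : ℂ) ≠ 0 := by exact_mod_cast hn.ne'
  have hn0 : (0 : ℝ) < n := by exact_mod_cast hn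
  rw [← Finset.sum_sub_distrib]
  have hone : ∀ i ∈ Finset.range n, ‖∫ ω, cellWeight Z ε r M (W i) i ω ∂P -
      ((1 / n : ℝ) : ℂ) * ∑ j ∈ Finset.range M, (h : ℂ) * W i j‖ ≤ 1 / n * (2 * M * σ) := by
    intro i _
    have e1 : ∑ j ∈ Finset.range M, (h : ℂ) * W i j =
        ∑ j ∈ Finset.range M, (W i j - W i (j + 1)) * ((j + 1) * h) := by
      rw [sum_mul_succ_sub, hWM, mul_zero, sub_zero]
    rw [integral_cellWeight hZ H.eps_pos.le, e1, Finset.mul_sum, ← Finset.sum_sub_distrib]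
    have hj : ∀ j ∈ Finset.range M, ‖(W i j - W i (j + 1)) *
        ((gapProb P Z (r j - ε) - gapProb P Z (r j) : ℝ) : ℂ) -
          ((1 / n : ℝ) : ℂ) * ((W i j - W i (j + 1)) * ((j + 1) * h))‖ ≤ 1 / n * (2 * σ) := by
      intro j hj
      have h1 := H.abs_mul_real_cellEvent_sub_le hZ h_regular hnε hσ (Finset.mem_range.1 hj) i
      rw [real_cellEvent hZ H.eps_pos.le] at h1
      have e2 : (W i j - W i (j + 1)) * ((gapProb P Z (r j - ε) - gapProb P Z (r j) : ℝ) : ℂ) -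
          ((1 / n : ℝ) : ℂ) * ((W i j - W i (j + 1)) * ((j + 1) * h)) =
          ((1 / n : ℝ) : ℂ) * ((W i j - W i (j + 1)) *
            ((n * (gapProb P Z (r j - ε) - gapProb P Z (r j)) - (j + 1) * h : ℝ) : ℂ)) := by
        push_cast
        field_simp
      rw [e2, norm_mul, norm_mul, Complex.norm_real, Complex.norm_real, Real.norm_eq_abs,
        Real.norm_eq_abs, abs_of_pos (by positivity : 0 < 1 / (n : ℝ))]
      exact mul_le_mul_of_nonneg_left (mul_le_mul (hW i j) h1 (abs_nonneg _) (by norm_num))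
        (by positivity)
    refine (norm_sum_le_of_le _ hj).trans_eq ?_
    rw [Finset.sum_const, Finset.card_range, nsmul_eq_mul]
    ring
  refine (norm_sum_le_of_le _ hone).trans_eq ?_
  rw [Finset.sum_const, Finset.card_range, nsmul_eq_mul]
  field_simp

lemma norm_exp_sub_exp_le {a b : ℂ} (hb : ‖Complex.exp b‖ ≤ 1) (hab : ‖a - b‖ ≤ 1) :
    ‖Complex.exp a - Complex.exp b‖ ≤ 2 * ‖a - b‖ := by
  have e : Complex.exp a - Complex.exp b = Complex.exp b * (Complex.exp (a - b) - 1) := by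
    rw [mul_sub, ← Complex.exp_add, mul_one, add_sub_cancel]
  rw [e, norm_mul]
  exact (mul_le_of_le_one_left (norm_nonneg _) hb).trans (Complex.norm_exp_sub_one_le hab)

end Grid

lemma norm_exp_mul_I_sub_one_sub_le (x y : ℝ) :
    ‖(Complex.exp (x * Complex.I) - 1) - (Complex.exp (y * Complex.I) - 1)‖ ≤ 2 := by
  rw [sub_sub_sub_cancel_right]
  refine (norm_sub_le _ _).trans ?_
  rw [Complex.norm_exp_ofReal_mul_I, Complex.norm_exp_ofReal_mul_I]
  norm_num

/-! ### From characteristic functions to exponentials of Riemann sums -/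

section Grid

variable [IsProbabilityMeasure P] {R ε h σ : ℝ} {M n : ℕ} {r : ℕ → ℝ}

lemma IsLevelGrid.mul_real_cellEvent_le (hZ : IsStationaryPointProcess P Z)
    (h_regular : GapRegularity P Z) (H : IsLevelGrid P Z R ε h M r) (hM : 0 < M) (hnε : n * ε = R)
    (i : ℕ) : n * P.real (cellEvent Z ε (r (M - 1)) i) ≤ M * h + h := by
  have h1 := (abs_le.1 (H.abs_mul_real_cellEvent_sub_le hZ h_regular hnε H.level_sub
    (show M - 1 < M by omega) i)).2
  rw [Nat.cast_sub hM, Nat.cast_one, sub_add_cancel] at h1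
  linarith

/-- Characteristic functions of linear statistics of the rescaled gaps and of the product over the
cells. -/
lemma norm_integral_exp_sub_integral_prod_le (hZ : IsStationaryPointProcess P Z)
    (h_decay : GapDecay P Z) (h_regular : GapRegularity P Z) {f : GapSpace → ℝ}
    (hf : Measurable f) {τ δ : ℝ} (H : IsLevelGrid P Z R ε h M r) (hn : 0 < n) (hM : 0 < M)
    (hnε : n * ε = R) (hfU : ∀ x u, M * h ≤ u → testFun f x u = 0)
    (hδ : ∀ x x' u u', |x - x'| ≤ δ → |u - u'| ≤ δ → |testFun f x u - testFun f x' u'| ≤ τ)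
    (hnδ : 1 / (n : ℝ) ≤ δ) (hhδ : h ≤ δ) (hτ : 0 ≤ τ) :
    ‖∫ ω, Complex.exp ((∫ x, f x ∂(rescaledGaps P Z R ω) : ℝ) * Complex.I) ∂P -
      ∫ ω, ∏ i ∈ Finset.range n, (1 + cellWeight Z ε r M
        (fun j => Complex.exp (testFun f (i / n) ((j + 1) * h) * Complex.I) - 1) i ω) ∂P‖ ≤
      (M * h + h) * (τ + 2 / n) := by
  have hn' : (0 : ℝ) < n := by exact_mod_cast hn
  have hA := fun i => measurableSet_cellEvent hZ ε (r (M - 1)) i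
  have hφ : ∀ i : ℕ, testFun f (i / n) (((M : ℕ) + 1) * h) = 0 := fun i =>
    hfU _ _ (by nlinarith [H.step_pos])
  have hi1 : Integrable (fun ω =>
      Complex.exp ((∫ x, f x ∂(rescaledGaps P Z R ω) : ℝ) * Complex.I)) P := by
    refine Integrable.of_bound (C := 1) ?_ (Eventually.of_forall fun ω => ?_)
    · exact (Complex.measurable_exp.comp_aemeasurable ((Complex.measurable_ofReal.comp_aemeasurable
        (aemeasurable_integral_rescaledGaps hZ h_decay hf R)).mul_const _)).aestronglyMeasurable
    · rw [Complex.norm_exp_ofReal_mul_I]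
  have hi2 : Integrable (fun ω => ∏ i ∈ Finset.range n, (1 + cellWeight Z ε r M
      (fun j => Complex.exp (testFun f (i / n) ((j + 1) * h) * Complex.I) - 1) i ω)) P := by
    refine Integrable.of_bound (C := 1) ?_ (Eventually.of_forall fun ω => ?_)
    · exact (Finset.measurable_fun_prod _ fun i _ =>
        measurable_const.add (measurable_cellWeight hZ _ _ _ _ _)).aestronglyMeasurable
    · rw [norm_prod]
      exact (Finset.prod_eq_one fun i _ => norm_one_add_cellWeight h_regular H (hφ i) i ω).le
  have hi : ∀ i, Integrable ((cellEvent Z ε (r (M - 1)) i).indicator (1 : Ω → ℝ)) P := fun i =>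
    (integrable_const (1 : ℝ)).indicator (hA i)
  have hib : Integrable (fun ω => τ * ∑ i ∈ Finset.range n,
      (cellEvent Z ε (r (M - 1)) i).indicator (1 : Ω → ℝ) ω +
        2 * (cellEvent Z ε (r (M - 1)) n).indicator (1 : Ω → ℝ) ω) P :=
    ((integrable_finsetSum _ fun i _ => hi i).const_mul τ).add ((hi n).const_mul 2)
  rw [← integral_sub hi1 hi2]
  refine (norm_integral_le_of_norm_le hib ?_).trans ?_
  · filter_upwards [hZ.ae_unbounded h_decay] with ω hω
    exact norm_exp_integral_rescaledGaps_sub_prod_le h_decay h_regular H hn hM hnε hfU hδ hnδ hhδ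
      (hZ.locallyFinite ω) hω hτ
  rw [integral_add ((integrable_finsetSum _ fun i _ => hi i).const_mul τ) ((hi n).const_mul 2),
    integral_const_mul, integral_const_mul, integral_finsetSum _ fun i _ => hi i]
  simp_rw [integral_indicator_one (hA _)]
  have hp : ∀ i, P.real (cellEvent Z ε (r (M - 1)) i) ≤ (M * h + h) / n := fun i => by
    rw [le_div_iff₀ hn', mul_comm]
    exact H.mul_real_cellEvent_le hZ h_regular hM hnε i
  have h1 : ∑ i ∈ Finset.range n, P.real (cellEvent Z ε (r (M - 1)) i) ≤ M * h + h := by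
    refine (Finset.sum_le_card_nsmul _ _ _ fun i _ => hp i).trans_eq ?_
    rw [Finset.card_range, nsmul_eq_mul, mul_div_cancel₀ _ hn'.ne']
  calc _ ≤ τ * (M * h + h) + 2 * ((M * h + h) / n) :=
        add_le_add (mul_le_mul_of_nonneg_left h1 hτ)
          (mul_le_mul_of_nonneg_left (hp n) zero_le_two)
    _ = _ := by ring

/-- The product over the cells has nearly independent factors. -/
lemma norm_integral_prod_one_add_cellWeight_sub_le (hZ : IsStationaryPointProcess P Z)
    (h_regular : GapRegularity P Z) (H : IsLevelGrid P Z R ε h M r) (hn : 0 < n) (hM : 0 < M)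
    (hnε : n * ε = R) (hh : h ≤ 1) {φ : ℕ → ℕ → ℝ} (hφ : ∀ i, φ i M = 0) {g ρ r₀ s₀ e₁ e₂ : ℝ}
    {d K : ℕ} (hd : 0 < d) (hK : 2 ≤ K) (hρ : 0 ≤ ρ) (he₁ : e₁ ≤ 1) (he₂ : 0 ≤ e₂)
    (hg : ∀ j < M, gapProb P Z (r j - ε) ≤ g) (hr₀ : ∀ j < M, r j ≤ r₀)
    (hdε : r₀ + s₀ ≤ d * ε)
    (hsplit : ∀ k ≤ K, ∀ (S : Finset ℕ) (a b : ℕ → ℝ), S.card = k → SpacedOut S r₀ s₀ a b →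
      |P.real (⋂ i ∈ S, gapEvent Z (Set.Icc (a i) (b i))) -
        ∏ i ∈ S, P.real (gapEvent Z (Set.Icc (a i) (b i)))| ≤
          ρ * ∏ i ∈ S, P.real (gapEvent Z (Set.Icc (a i) (b i))))
    (hρe : ∀ k ≤ K, ρ * (4 * M * g * n) ^ k ≤ e₁)
    (hpair : ∀ k < K, 1 ≤ k → ∀ S : Finset ℕ, S.card = k → Separated d S → ∀ j ∉ S,
      P.real (⋂ i ∈ insert j S, cellEvent Z ε (r (M - 1)) i) * (n ^ k * d) ≤ e₂) :
    ‖∫ ω, ∏ i ∈ Finset.range n, (1 + cellWeight Z ε r M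
        (fun j => Complex.exp (φ i j * Complex.I) - 1) i ω) ∂P -
      ∏ i ∈ Finset.range n, (1 + ∫ ω, cellWeight Z ε r M
        (fun j => Complex.exp (φ i j * Complex.I) - 1) i ω ∂P)‖ ≤
      4 * e₂ + 2 * ((2 * (2 * (M * h + 2))) ^ K / K.factorial) +
        K * (2 ^ (K + 1) * K * e₂ + e₁ + 2 * K * d * (2 * (M * h + 2)) ^ K / n) := by
  have hn' : (0 : ℝ) < n := by exact_mod_cast hn
  have hMh : 0 ≤ M * h := mul_nonneg M.cast_nonneg H.step_pos.le
  have hM1 : M - 1 < M := by omega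
  have hA := fun i => measurableSet_cellEvent hZ ε (r (M - 1)) i
  have hg0 : 0 ≤ g := (gapProb_nonneg _).trans (hg _ hM1)
  have hp : ∀ i, n * P.real (cellEvent Z ε (r (M - 1)) i) ≤ M * h + h :=
    H.mul_real_cellEvent_le hZ h_regular hM hnε
  have hgap : ∀ S : Finset ℕ, Separated d S → ∀ i ∈ S, ∀ j ∈ S, i < j →
      i * ε + (r₀ + s₀) ≤ j * ε := by
    intro S hS i hi j hj hij
    have h1 : (i : ℝ) + d ≤ j := by exact_mod_cast hS i hi j hj hij
    nlinarith [H.eps_pos]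
  refine norm_integral_prod_sub_prod_le P n d K hn hd hK (cellEvent Z ε (r (M - 1))) hA
    (fun i => cellWeight Z ε r M (fun j => Complex.exp (φ i j * Complex.I) - 1) i)
    (fun i => measurable_cellWeight hZ _ _ _ _ _)
    (fun i ω hω => cellWeight_eq_zero h_regular H _ hω)
    (fun i ω => norm_one_add_cellWeight h_regular H (hφ i) i ω) (2 * (M * h + 2)) e₁ e₂
    (by linarith) he₂ ?_ ?_ ?_ ?_
  · intro k hk S hS
    obtain ⟨⟨-, hcard⟩, hsep⟩ := mem_sepSets.1 hS
    have h1 := norm_integral_prod_cellWeight_sub_le hZ H.eps_pos.le (S := S) (C := 2)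
      (W := fun i j => Complex.exp (φ i j * Complex.I) - 1) hρ
      (fun i _ j _ => norm_exp_mul_I_sub_one_sub_le _ _) hg (fun j hj => (H.lt j hj).le) hr₀
      (hgap S hsep) fun a b => hsplit k hk.le S a b hcard
    refine (mul_le_mul_of_nonneg_right h1 (by positivity)).trans
      (le_trans (le_of_eq ?_) (hρe k hk.le))
    rw [hcard, mul_assoc, ← mul_pow]
    ring
  · intro S hS
    obtain ⟨⟨-, hcard⟩, hsep⟩ := mem_sepSets.1 hS
    -- With a single level and weight 1 there, the cell weight is the indicator of the event, so the
    -- moment estimate bounds joint probabilities as well.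
    have h1 := norm_integral_prod_cellWeight_sub_le hZ H.eps_pos.le (S := S) (C := 1)
      (r := fun _ => r (M - 1)) (M := 1) (W := fun _ j => if j = 0 then 1 else 0) hρ
      (fun i _ j hj => by rw [Nat.lt_one_iff.1 hj]; simp) (fun _ _ => hg _ hM1)
      (fun _ _ => (H.lt _ hM1).le) (fun _ _ => hr₀ _ hM1)
      (hgap S hsep) fun a b => hsplit K le_rfl S a b hcard
    have e1 : ∀ i ω, cellWeight Z ε (fun _ => r (M - 1)) 1 (fun j => if j = 0 then 1 else 0) i ω =
        (cellEvent Z ε (r (M - 1)) i).indicator (1 : Ω → ℂ) ω := by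
      intro i ω
      simp only [cellWeight, Finset.sum_range_one, if_true, zero_add, one_ne_zero, if_false, sub_zero]
      rfl
    have e2 : ∀ ω, ∏ i ∈ S, (cellEvent Z ε (r (M - 1)) i).indicator (1 : Ω → ℂ) ω =
        (⋂ i ∈ S, cellEvent Z ε (r (M - 1)) i).indicator (1 : Ω → ℂ) ω := by
      intro ω
      classical
      simp only [Set.indicator_apply, Pi.one_apply, Set.mem_iInter₂]
      rw [Finset.prod_ite_zero]
      simp
    have e3 : ∀ F : Set Ω, MeasurableSet F → ∫ ω, F.indicator (1 : Ω → ℂ) ω ∂P = P.real F := by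
      intro F hF
      rw [show (1 : Ω → ℂ) = fun _ => 1 from rfl, integral_indicator_const _ hF]
      simp
    simp_rw [e1, e2, e3 _ (hA _)] at h1
    rw [e3 _ (Finset.measurableSet_biInter _ fun i _ => hA i), ← Complex.ofReal_prod,
      ← Complex.ofReal_sub, Complex.norm_real, Real.norm_eq_abs, hcard] at h1
    have h2 : (∏ i ∈ S, P.real (cellEvent Z ε (r (M - 1)) i)) * n ^ K ≤ (M * h + 2) ^ K := by
      rw [← hcard, ← Finset.prod_const, ← Finset.prod_mul_distrib, ← Finset.prod_const]
      refine Finset.prod_le_prod (fun i _ => mul_nonneg measureReal_nonneg hn'.le) fun i _ => ?_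
      rw [mul_comm]
      linarith [hp i]
    have h3 : ρ * (2 * (1 : ℕ) * (1 * g)) ^ K * n ^ K ≤ 1 := by
      refine le_trans ?_ ((hρe K le_rfl).trans he₁)
      rw [mul_assoc, ← mul_pow]
      refine mul_le_mul_of_nonneg_left (pow_le_pow_left₀ (by positivity) ?_ _) hρ
      have : (1 : ℝ) ≤ M := by exact_mod_cast hM
      have := mul_nonneg hg0 hn'.le
      push_cast
      nlinarith
    have h4 := mul_le_mul_of_nonneg_right (sub_le_iff_le_add.1 ((le_abs_self _).trans h1))
      (by positivity : (0 : ℝ) ≤ n ^ K)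
    rw [add_mul] at h4
    -- The main term is at most `(M h + 2)^K` and the error at most 1; the factor 2 in `B = 2 (M h +
    -- 2)` accommodates their sum.
    have h5 : (1 : ℝ) ≤ (M * h + 2) ^ K := one_le_pow₀ (by linarith)
    have h6 : (2 : ℝ) ≤ 2 ^ K := le_self_pow₀ one_le_two (by omega)
    rw [mul_pow]
    nlinarith
  · intro k hk S hS j hj
    obtain ⟨⟨-, hcard⟩, hsep⟩ := mem_sepSets.1 hS
    obtain ⟨⟨-, hjS⟩, i, hi, -⟩ := mem_near.1 hj
    exact hpair k hk (hcard ▸ Finset.card_pos.2 ⟨i, hi⟩) S hcard hsep j hjS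
  · intro i _
    have h1 := mul_le_mul_of_nonneg_right (norm_integral_cellWeight_le hZ h_regular H (hφ i) i)
      hn'.le
    refine h1.trans ?_
    have := hp i
    linarith

/-- The product over the cells of the expectations is nearly an exponential. -/
lemma norm_prod_one_add_integral_cellWeight_sub_le (hZ : IsStationaryPointProcess P Z)
    (h_regular : GapRegularity P Z) (H : IsLevelGrid P Z R ε h M r) (hn : 0 < n) (hM : 0 < M)
    (hnε : n * ε = R) (hh : h ≤ 1) {φ : ℕ → ℕ → ℝ} (hφ : ∀ i, φ i M = 0)
    (hnM : 2 * (M * h + 2) ≤ n) :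
    ‖∏ i ∈ Finset.range n, (1 + ∫ ω, cellWeight Z ε r M
        (fun j => Complex.exp (φ i j * Complex.I) - 1) i ω ∂P) -
      Complex.exp (∑ i ∈ Finset.range n, ∫ ω, cellWeight Z ε r M
        (fun j => Complex.exp (φ i j * Complex.I) - 1) i ω ∂P)‖ ≤ (2 * (M * h + 2)) ^ 2 / n := by
  have hn' : (0 : ℝ) < n := by exact_mod_cast hn
  have hb : ∀ i, ‖∫ ω, cellWeight Z ε r M (fun j => Complex.exp (φ i j * Complex.I) - 1) i ω ∂P‖ ≤
      2 * (M * h + 2) / n := by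
    intro i
    rw [le_div_iff₀ hn']
    have h1 := mul_le_mul_of_nonneg_right (norm_integral_cellWeight_le hZ h_regular H (hφ i) i)
      hn'.le
    have := H.mul_real_cellEvent_le hZ h_regular hM hnε i
    linarith
  refine (norm_prod_one_add_sub_exp_le _ _ (fun i _ => ?_) fun i _ => ?_).trans ?_
  · have hi : Integrable (cellWeight Z ε r M (fun j => Complex.exp (φ i j * Complex.I) - 1) i) P := by
      refine Integrable.of_bound (C := 2) (measurable_cellWeight hZ _ _ _ _ _).aestronglyMeasurable
        (Eventually.of_forall fun ω => ?_)
      have h2 := norm_sub_le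
        (1 + cellWeight Z ε r M (fun j => Complex.exp (φ i j * Complex.I) - 1) i ω) 1
      rw [norm_one_add_cellWeight h_regular H (hφ i), norm_one, add_sub_cancel_left] at h2
      linarith
    have e : 1 + ∫ ω, cellWeight Z ε r M (fun j => Complex.exp (φ i j * Complex.I) - 1) i ω ∂P =
        ∫ ω, (1 + cellWeight Z ε r M (fun j => Complex.exp (φ i j * Complex.I) - 1) i ω) ∂P := by
      rw [integral_add (integrable_const _) hi]
      simp
    rw [e]
    refine (norm_integral_le_of_norm_le (integrable_const (1 : ℝ)) (Eventually.of_forall fun ω =>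
      (norm_one_add_cellWeight h_regular H (hφ i) i ω).le)).trans_eq ?_
    simp
  · exact (hb i).trans ((div_le_one hn').2 hnM)
  · refine (Finset.sum_le_card_nsmul _ _ ((2 * (M * h + 2) / n) ^ 2) fun i _ =>
      pow_le_pow_left₀ (norm_nonneg _) (hb i) 2).trans_eq ?_
    rw [Finset.card_range, nsmul_eq_mul]
    field_simp

end Grid

/-! ### Choice of parameters and conclusion -/

lemma exists_cell_parameters {R β δ : ℝ} (hR : 1 ≤ R) (hβ : 0 < β) (hδ : 0 < δ) :
    ∃ n d : ℕ, 0 < n ∧ 0 < d ∧ R ^ (1 + β) ≤ n ∧ (n : ℝ) ≤ 2 * R ^ (1 + β) ∧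
      R / n ≤ R ^ (-β) ∧ 3 * R ^ δ ≤ d * (R / n) ∧ (d : ℝ) ≤ 7 * R ^ (δ + β) := by
  have hR0 : 0 < R := one_pos.trans_le hR
  have h1 : 1 ≤ R ^ (1 + β) := Real.one_le_rpow hR (by linarith)
  have h2 : 1 ≤ R ^ (δ + β) := Real.one_le_rpow hR (by linarith)
  have h3 : 0 < R ^ δ := Real.rpow_pos_of_pos hR0 _
  have hn := Nat.le_ceil (R ^ (1 + β))
  have hn' := (Nat.ceil_lt_add_one (by linarith : 0 ≤ R ^ (1 + β))).le
  set n := ⌈R ^ (1 + β)⌉₊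
  have hn0 : (0 : ℝ) < n := by linarith
  have hd := Nat.le_ceil (3 * R ^ δ / (R / n))
  have hd' := (Nat.ceil_lt_add_one (by positivity : 0 ≤ 3 * R ^ δ / (R / n))).le
  set d := ⌈3 * R ^ δ / (R / n)⌉₊
  have hq : 0 < 3 * R ^ δ / (R / n) := by positivity
  refine ⟨n, d, by exact_mod_cast hn0, by exact_mod_cast hq.trans_le hd, hn, by linarith, ?_,
    (div_le_iff₀ (by positivity)).1 hd, ?_⟩
  · rw [div_le_iff₀ hn0]
    calc R = R ^ (-β) * R ^ (1 + β) := by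
          rw [← Real.rpow_add hR0, neg_add_cancel_comm_assoc, Real.rpow_one]
      _ ≤ _ := mul_le_mul_of_nonneg_left hn (Real.rpow_nonneg hR0.le _)
  · have h4 : 3 * R ^ δ / (R / n) ≤ 6 * R ^ (δ + β) := by
      rw [div_div_eq_mul_div, div_le_iff₀ hR0]
      calc 3 * R ^ δ * n ≤ 3 * R ^ δ * (2 * R ^ (1 + β)) := by gcongr; linarith
        _ = 6 * (R ^ δ * R ^ (1 + β)) := by ring
        _ = 6 * (R ^ (δ + β) * R) := by
          rw [← Real.rpow_add hR0, show δ + (1 + β) = (δ + β) + 1 by ring, Real.rpow_add_one hR0.ne']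
        _ = _ := by ring
    linarith

lemma norm_sub_exp_le {a b c s t l : ℂ} {x₁ x₂ x₃ x₄ x₅ : ℝ} (h₁ : ‖a - b‖ ≤ x₁) (h₂ : ‖b - c‖ ≤ x₂)
    (h₃ : ‖c - Complex.exp s‖ ≤ x₃) (h₄ : ‖s - t‖ ≤ x₄) (h₅ : ‖l - t‖ ≤ x₅)
    (hl : ‖Complex.exp l‖ ≤ 1) (hx : x₄ + x₅ ≤ 1) :
    ‖a - Complex.exp l‖ ≤ x₁ + x₂ + x₃ + 2 * (x₄ + x₅) := by
  have h6 := norm_sub_le_norm_sub_add_norm_sub s t l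
  rw [norm_sub_rev t l] at h6
  have h7 := norm_exp_sub_exp_le hl (h6.trans (by linarith))
  have h8 := norm_sub_le_norm_sub_add_norm_sub a b (Complex.exp l)
  have h9 := norm_sub_le_norm_sub_add_norm_sub b c (Complex.exp l)
  have h10 := norm_sub_le_norm_sub_add_norm_sub c (Complex.exp s) (Complex.exp l)
  linarith

lemma eventually_isLevelGrid [IsProbabilityMeasure P] (h_decay : GapDecay P Z)
    (h_regular : GapRegularity P Z) {h σ β κ : ℝ} (hh : 0 < h) (hσ : 0 < σ) (hσh : σ ≤ h)
    (hβ : 0 < β) (hκ : 0 < κ) (M : ℕ) :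
    ∀ᶠ R in atTop, ∀ ε : ℝ, 0 < ε → ε ≤ R ^ (-β) →
      IsLevelGrid P Z R ε h M (fun j => threshold P Z ((j + 1) * h) R) ∧
      ∀ j < M, R * -deriv (gapProb P Z) (threshold P Z ((j + 1) * h) R - ε) ≤ (j + 1) * h + σ ∧
        gapProb P Z (threshold P Z ((j + 1) * h) R - ε) ≤ R ^ (-1 + κ) := by
  have hu : ∀ j : ℕ, 0 < (j + 1) * h := fun j => by positivity
  have h1 : ∀ᶠ R in atTop, ∀ j ∈ Finset.range M, _ := (Finset.eventually_all _).2 fun j _ =>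
    (threshold_spec h_decay h_regular (hu j)).and
      ((deriv_threshold_sub_le h_decay h_regular (hu j) hβ hσ).and
        (gapProb_threshold_sub_le h_decay h_regular (hu j) hβ hκ))
  filter_upwards [h1, eventually_gt_atTop 0] with R h1 hR ε hε hεβ
  have h2 := fun j (hj : j < M) => h1 j (Finset.mem_range.2 hj)
  refine ⟨⟨hR, hε, hh, fun j hj => ?_, fun j hj => (h2 j hj).1.2, fun j hj => ?_⟩, fun j hj =>
    ⟨((h2 j hj).2.1 ε hε.le hεβ).2, (h2 j hj).2.2 ε hε.le hεβ⟩⟩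
  · linarith [((h2 j hj).2.1 ε hε.le hεβ).1]
  · linarith [((h2 j hj).2.1 ε hε.le hεβ).2]

/-- The characteristic function of `∫ f dΨ_R` is asymptotically that of a Poisson integral. -/
lemma eventually_norm_integral_exp_sub_le [IsProbabilityMeasure P]
    (hZ : IsStationaryPointProcess P Z) (h_decay : GapDecay P Z) (h_regular : GapRegularity P Z)
    (h_splitting : PolynomialSplitting P Z) (h_decoupling : ClusteredDecoupling P Z)
    (h_clustering : AbsenceOfClustering P Z) {f : GapSpace → ℝ} (hf : Continuous f) {U : ℝ}
    (hU : 0 < U) (hfU : ∀ x u, U ≤ u → testFun f x u = 0)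
    (hexp : ‖Complex.exp (∫ p, (Complex.exp (f p * Complex.I) - 1) ∂limitIntensity)‖ ≤ 1)
    {τ : ℝ} (hτ : 0 < τ) (hτU : (U + 1) * τ ≤ 1) :
    ∀ᶠ R in atTop, ‖∫ ω, Complex.exp ((∫ x, f x ∂(rescaledGaps P Z R ω) : ℝ) * Complex.I) ∂P -
      Complex.exp (∫ p, (Complex.exp (f p * Complex.I) - 1) ∂limitIntensity)‖ ≤
        (3 * U + 7) * τ := by
  obtain ⟨δ, hδ0, hδ⟩ := testFun_uniform hf hU hfU hτ
  obtain ⟨M, hM⟩ := exists_nat_gt (U / min δ 1)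
  have hδ1 : 0 < min δ 1 := lt_min hδ0 one_pos
  have hM' : (0 : ℝ) < M := (by positivity : 0 < U / min δ 1).trans hM
  have hM0 : 0 < M := by exact_mod_cast hM'
  set h := U / M with hh_def
  have hh : 0 < h := by positivity
  have hhδ : h ≤ min δ 1 := by
    rw [div_lt_iff₀ hδ1] at hM
    rw [hh_def, div_le_iff₀ hM']
    linarith
  have hMh : M * h = U := mul_div_cancel₀ U hM'.ne'
  -- The tolerance `σ ≤ h` suffices for the grid; the second bound keeps the total error `2 M σ` of
  -- the expectations below `τ`.
  set σ := min h (τ / (2 * M)) with hσ_def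
  have hσ : 0 < σ := lt_min hh (by positivity)
  have hσM : 2 * M * σ ≤ τ := by
    have := min_le_right h (τ / (2 * M))
    rw [← hσ_def, le_div_iff₀ (by positivity)] at this
    linarith
  set B := 2 * (U + 2) with hB
  obtain ⟨K, hKτ, hK2⟩ : ∃ K : ℕ, 2 * ((2 * B) ^ K / K.factorial) ≤ τ ∧ 2 ≤ K := by
    have h1 := (FloorSemiring.tendsto_pow_div_factorial_atTop (2 * B)).const_mul 2
    rw [mul_zero] at h1
    exact ((h1.eventually_le_const hτ).and (eventually_ge_atTop 2)).exists
  have hK0 : (0 : ℝ) < K := by exact_mod_cast (by omega : 0 < K)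
  obtain ⟨η, hη, hpair⟩ := eventually_real_iInter_insert_cellEvent_le hZ h_decay h_regular
    h_splitting h_decoupling h_clustering
  -- The window of close cells has length of order `R^{δ₁}`: summing over it must use up only part
  -- of the gain `R^{-η}`, and `δ₁ ≤ 1/2` makes `d / n` negligible.
  set δ₁ := min η 2 / 4 with hδ₁_def
  have hδ₁ : 0 < δ₁ := by positivity
  have hδ₁η : δ₁ ≤ η / 4 := by linarith [min_le_left η 2]
  have hδ₁2 : δ₁ ≤ 1 / 2 := by linarith [min_le_right η 2]
  obtain ⟨δ', hδ', hsplit⟩ := h_splitting.eventually_abs_sub_le (half_pos hδ₁)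
    (isPowerOrder_threshold h_decay h_regular hh) K
  -- Since `n ≈ R^{1+β}`, up to `K` factors lose powers `R^{Kβ}` and `R^{2Kβ}`; these must stay
  -- below the gain from close pairs and the splitting gain `R^{-δ'}`, which is why `β` is chosen
  -- last.
  set β := min δ' η / (4 * K) with hβ_def
  have hβ : 0 < β := by positivity
  have hβK : K * β = min δ' η / 4 := by
    rw [hβ_def]
    field_simp
  have hβδ' : 2 * (K * β) ≤ δ' / 2 := by linarith [min_le_left δ' η]
  have hβη : K * β ≤ η / 4 := by linarith [min_le_right δ' η]
  have hsplit' : ∀ᶠ R in atTop, ∀ k ∈ Finset.range (K + 1), _ := (Finset.eventually_all _).2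
    fun k hk => hsplit k (by have := Finset.mem_range.1 hk; omega)
  have hpair' : ∀ᶠ R in atTop, ∀ k ∈ Finset.Icc 1 K, _ := (Finset.eventually_all _).2
    fun k hk => hpair U β (δ₁ / 2) δ₁ hU hβ (half_pos hδ₁) (half_lt_self hδ₁) k
      (Finset.mem_Icc.1 hk).1
  have hrpow0 : ∀ {a : ℝ}, 0 < a → Tendsto (fun R : ℝ => R ^ (-a)) atTop (𝓝 0) :=
    fun ha => tendsto_rpow_neg_atTop ha
  have he₁ : ∀ᶠ R : ℝ in atTop, (8 * M) ^ K * R ^ (-(δ' / 2)) ≤ 1 := by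
    have := (hrpow0 (half_pos hδ')).const_mul ((8 * M : ℝ) ^ K)
    rw [mul_zero] at this
    exact this.eventually_le_const one_pos
  have herr : ∀ᶠ R : ℝ in atTop, 4 * (7 * 2 ^ K * R ^ (-(η / 2))) +
      K * (2 ^ (K + 1) * K * (7 * 2 ^ K * R ^ (-(η / 2))) + (8 * M) ^ K * R ^ (-(δ' / 2)) +
        2 * K * B ^ K * (7 * R ^ (-(1 / 2) : ℝ))) ≤ τ := by
    have h1 := (hrpow0 (half_pos hη)).const_mul (7 * 2 ^ K)
    have h2 := (hrpow0 (half_pos hδ')).const_mul ((8 * M : ℝ) ^ K)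
    have h3 := (hrpow0 (show (0 : ℝ) < 1 / 2 by norm_num)).const_mul 7
    have h4 := (h1.const_mul 4).add ((((h1.const_mul (2 ^ (K + 1) * K : ℝ)).add h2).add
      (h3.const_mul (2 * K * B ^ K))).const_mul (K : ℝ))
    simp only [mul_zero, add_zero] at h4
    exact h4.eventually_le_const hτ
  filter_upwards [eventually_isLevelGrid h_decay h_regular hh hσ (min_le_left _ _) hβ hβ M, hsplit',
    hpair', he₁, herr, threshold_le_rpow h_decay h_regular hh hδ₁,
    eventually_rpow_le_rpow (half_le_self hδ₁.le), eventually_ge_atTop 1,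
    eventually_ge_atTop (1 / δ), eventually_ge_atTop B, eventually_ge_atTop (2 * (U + 1) / τ),
    eventually_ge_atTop (B ^ 2 / τ)]
    with R hgrid hsplit hpair he₁ herr hthr hδδ hR hRδ hRB hRτ hRτ'
  obtain ⟨n, d, hn, hd, hn1, hn2, hnε, hdε, hd7⟩ := exists_cell_parameters hR hβ hδ₁
  have hR0 : 0 < R := one_pos.trans_le hR
  have hn' : (0 : ℝ) < n := by exact_mod_cast hn
  have hRn : R ≤ n := by
    refine le_trans ?_ hn1
    nth_rw 1 [← Real.rpow_one R]
    exact Real.rpow_le_rpow_of_exponent_le hR (by linarith)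
  obtain ⟨H, hgrid⟩ := hgrid (R / n) (by positivity) hnε
  have hnR : n * (R / n) = R := mul_div_cancel₀ R hn'.ne'
  -- The last level is that of mark `U`, so the pair estimate is applied at the threshold of `U`.
  have hMU : ((M - 1 : ℕ) + 1 : ℝ) * h = U := by
    rw [Nat.cast_sub hM0, Nat.cast_one, sub_add_cancel, hMh]
  have hnδ : 1 / (n : ℝ) ≤ δ := by
    rw [div_le_iff₀ hδ0] at hRδ
    rw [div_le_iff₀ hn']
    linarith [mul_le_mul_of_nonneg_right hRn hδ0.le]
  have hφ : ∀ i : ℕ, testFun f (i / n) (((M : ℕ) + 1) * h) = 0 := fun i =>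
    hfU _ _ (by rw [add_one_mul, hMh]; linarith)
  have h1 := norm_integral_exp_sub_integral_prod_le hZ h_decay h_regular hf.measurable H hn hM0 hnR
    (fun x u hu => hfU x u (hMh ▸ hu)) hδ hnδ (hhδ.trans (min_le_left _ _)) hτ.le
  have h2 := norm_integral_prod_one_add_cellWeight_sub_le hZ h_regular H hn hM0 hnR
    (hhδ.trans (min_le_right _ _)) (φ := fun i j => testFun f (i / n) ((j + 1) * h)) hφ
    (g := R ^ (-1 + β)) (ρ := R ^ (-δ')) (r₀ := threshold P Z h R) (s₀ := R ^ (δ₁ / 2))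
    (e₁ := (8 * M) ^ K * R ^ (-(δ' / 2))) (e₂ := 7 * 2 ^ K * R ^ (-(η / 2))) (d := d) (K := K)
    hd hK2 (Real.rpow_nonneg hR0.le _) he₁ (by positivity) (fun j hj => (hgrid j hj).2)
    (fun j hj => by simpa using H.antitone h_regular (Nat.zero_le j) hj) (by
      have : 0 < R ^ δ₁ := Real.rpow_pos_of_pos hR0 _
      linarith)
    (fun k hk S a b hS hab => hsplit k (Finset.mem_range.2 (by omega)) S a b hS hab)
    (fun k hk => ?_) (fun k hk hk1 S hS hSd j hj => ?_)
  rotate_left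
  · have h3 : 4 * M * R ^ (-1 + β) * n ≤ 8 * M * R ^ (2 * β) := by
      calc 4 * M * R ^ (-1 + β) * n ≤ 4 * M * R ^ (-1 + β) * (2 * R ^ (1 + β)) := by
            gcongr
        _ = 8 * M * (R ^ (-1 + β) * R ^ (1 + β)) := by ring
        _ = _ := by
          rw [← Real.rpow_add hR0]
          congr 2
          ring
    have h4 : 1 ≤ 8 * M * R ^ (2 * β) := by
      have h5 : (1 : ℝ) ≤ M := by exact_mod_cast hM0
      have h6 : 1 ≤ R ^ (2 * β) := Real.one_le_rpow hR (by linarith)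
      exact one_le_mul_of_one_le_of_one_le (by linarith) h6
    calc R ^ (-δ') * (4 * M * R ^ (-1 + β) * n) ^ k
        ≤ R ^ (-δ') * (8 * M * R ^ (2 * β)) ^ K :=
          mul_le_mul_of_nonneg_left ((pow_le_pow_left₀ (by positivity) h3 _).trans
            (pow_le_pow_right₀ h4 hk)) (Real.rpow_nonneg hR0.le _)
      _ = (8 * M) ^ K * R ^ (-δ' + 2 * (K * β)) := by
          rw [mul_pow, ← Real.rpow_mul_natCast hR0.le, Real.rpow_add hR0,
            show 2 * β * (K : ℝ) = 2 * (K * β) by ring]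
          ring
      _ ≤ _ := mul_le_mul_of_nonneg_left
          (Real.rpow_le_rpow_of_exponent_le hR (by linarith)) (by positivity)
  · have h3 := hpair k (Finset.mem_Icc.2 ⟨hk1, hk.le⟩) (R / n) (by positivity) hnε d hdε S hS hSd j hj
    simp only [hMU]
    have hkK : ((k : ℝ) + 1) * β ≤ K * β :=
      mul_le_mul_of_nonneg_right (by exact_mod_cast hk) hβ.le
    calc _ ≤ R ^ (-(k + η)) * ((2 * R ^ (1 + β)) ^ k * (7 * R ^ (δ₁ + β))) := by gcongr
      _ = 7 * 2 ^ k * R ^ (-(k + η) + (1 + β) * k + (δ₁ + β)) := by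
          rw [mul_pow, ← Real.rpow_mul_natCast hR0.le,
            Real.rpow_add hR0 (-(k + η) + (1 + β) * k), Real.rpow_add hR0 (-(k + η))]
          ring
      _ ≤ _ := by
          gcongr
          · exact one_le_two
          · linarith
  have h3 := norm_prod_one_add_integral_cellWeight_sub_le hZ h_regular H hn hM0 hnR
    (hhδ.trans (min_le_right _ _)) (φ := fun i j => testFun f (i / n) ((j + 1) * h)) hφ
    (by rw [hMh]; linarith)
  have h4 := norm_sum_integral_cellWeight_sub_le hZ h_regular H hn hnR
    (fun j hj => (hgrid j hj).1)
    (W := fun i j => Complex.exp (testFun f (i / n) ((j + 1) * h) * Complex.I) - 1)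
    (fun i => by simp [hφ]) (fun i j => norm_exp_mul_I_sub_one_sub_le _ _)
  have h5 := norm_integral_limitIntensity_sub_le hf hU hfU hn hM0 hδ hnδ
    (hhδ.trans (min_le_left _ _))
  rw [hMh] at h1 h2 h3
  have h8 : (U + h) * (τ + 2 / n) ≤ (U + 1) * τ + τ := by
    have hh1 : h ≤ 1 := hhδ.trans (min_le_right _ _)
    have h9 : (U + 1) * (2 / n) ≤ τ := by
      rw [div_le_iff₀ hτ] at hRτ
      rw [mul_div_assoc', div_le_iff₀ hn']
      linarith [mul_le_mul_of_nonneg_right hRn hτ.le]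
    have h10 : (U + h) * (τ + 2 / n) ≤ (U + 1) * (τ + 2 / n) := by gcongr
    rw [mul_add (U + 1)] at h10
    linarith
  have h9 : B ^ 2 / n ≤ τ := by
    rw [div_le_iff₀ hτ] at hRτ'
    rw [div_le_iff₀ hn']
    linarith [mul_le_mul_of_nonneg_right hRn hτ.le]
  have h10 : 2 * K * d * B ^ K / n ≤ 2 * K * B ^ K * (7 * R ^ (-(1 / 2) : ℝ)) := by
    rw [div_le_iff₀ hn']
    calc 2 * K * d * B ^ K ≤ 2 * K * (7 * R ^ (δ₁ + β)) * B ^ K := by gcongr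
      _ ≤ 2 * K * (7 * R ^ (1 / 2 + β)) * B ^ K := by
          gcongr
      _ = 2 * K * B ^ K * (7 * R ^ (-(1 / 2) : ℝ)) * R ^ (1 + β) := by
          rw [show (1 / 2 + β : ℝ) = -(1 / 2) + (1 + β) by ring, Real.rpow_add hR0]
          ring
      _ ≤ _ := by gcongr
  have h11 := mul_le_mul_of_nonneg_left h10 hK0.le
  refine (norm_sub_exp_le h1 h2 h3 h4 h5 hexp (by linarith)).trans ?_
  linarith

lemma tendsto_integral_exp [IsProbabilityMeasure P] (hZ : IsStationaryPointProcess P Z)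
    (h_decay : GapDecay P Z) (h_regular : GapRegularity P Z)
    (h_splitting : PolynomialSplitting P Z) (h_decoupling : ClusteredDecoupling P Z)
    (h_clustering : AbsenceOfClustering P Z) {Ω' : Type v} [MeasurableSpace Ω'] {P' : Measure Ω'}
    [IsProbabilityMeasure P'] {N : Ω' → Measure GapSpace}
    (hN : IsPoissonProcess P' N limitIntensity) {f : GapSpace → ℝ} (hf : Continuous f)
    (hfc : HasCompactSupport f) :
    Tendsto (fun R => ∫ ω, Complex.exp ((∫ x, f x ∂(rescaledGaps P Z R ω) : ℝ) * Complex.I) ∂P)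
      atTop (𝓝 (∫ ω, Complex.exp ((∫ x, f x ∂(N ω) : ℝ) * Complex.I) ∂P')) := by
  obtain ⟨U, hU, hfU⟩ := exists_testFun_eq_zero hfc
  obtain ⟨C, hC⟩ := hf.bounded_above_of_compact_support hfc
  have hexp := hN.integral_exp hf.measurable (measurableSet_support hf.measurable)
    (limitIntensity_support_lt_top hf.measurable hfU) (fun x hx => Function.notMem_support.1 hx)
    fun x => (Real.norm_eq_abs _).symm.trans_le (hC x)
  -- Being a characteristic function, the limit has modulus at most one; rewriting it as an
  -- exponential supplies the bound on `exp` needed for comparing exponents.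
  have hle : ‖∫ ω, Complex.exp ((∫ x, f x ∂(N ω) : ℝ) * Complex.I) ∂P'‖ ≤ 1 := by
    refine (norm_integral_le_of_norm_le (integrable_const (1 : ℝ)) (Eventually.of_forall fun ω =>
      (Complex.norm_exp_ofReal_mul_I _).le)).trans_eq ?_
    simp
  rw [hexp] at hle ⊢
  rw [Metric.tendsto_nhds]
  intro e he
  set τ := min (1 / (U + 1)) (e / (2 * (3 * U + 7))) with hτ_def
  have hτ : 0 < τ := lt_min (by positivity) (by positivity)
  have hτU : (U + 1) * τ ≤ 1 := by
    have := min_le_left (1 / (U + 1)) (e / (2 * (3 * U + 7)))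
    rw [← hτ_def, le_div_iff₀ (by positivity)] at this
    linarith
  have hτe : (3 * U + 7) * τ < e := by
    have := min_le_right (1 / (U + 1)) (e / (2 * (3 * U + 7)))
    rw [← hτ_def, le_div_iff₀ (by positivity)] at this
    linarith
  filter_upwards [eventually_norm_integral_exp_sub_le hZ h_decay h_regular h_splitting h_decoupling
    h_clustering hf hU hfU hle hτ hτU] with R hR
  rw [dist_eq_norm]
  exact hR.trans_lt hτe

end LargeGaps

theorem proposition5p3 {Ω : Type u} [MeasurableSpace Ω] (P : Measure Ω) [IsProbabilityMeasure P]
    (Z : Ω → Set ℝ) (hZ : LargeGaps.IsStationaryPointProcess P Z)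
    (h_decay : LargeGaps.GapDecay P Z)
    (h_regular : LargeGaps.GapRegularity P Z)
    (h_splitting : LargeGaps.PolynomialSplitting P Z)
    (h_decoupling : LargeGaps.ClusteredDecoupling P Z)
    (h_clustering : LargeGaps.AbsenceOfClustering P Z) :
    LargeGaps.PoissonApproximation.{u, v} P Z := by
  intro Ω' _ P' _ N hN f hf hfc
  have hX := fun R : ℝ =>
    LargeGaps.aemeasurable_integral_rescaledGaps hZ h_decay hf.measurable R
  have hY := (hN.measurable_integral hf.measurable).aemeasurable (μ := P')
  -- The continuity theorem is applied along sequences `R k → ∞`; the value at `t` of the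
  -- characteristic function is the characteristic functional at `t f`.
  refine ⟨hX, hY, tendsto_of_seq_tendsto fun R hR => ?_⟩
  refine ProbabilityMeasure.tendsto_iff_tendsto_charFun.2 fun t => ?_
  have key := (LargeGaps.tendsto_integral_exp hZ h_decay h_regular h_splitting h_decoupling
    h_clustering hN (f := fun x => t * f x) (continuous_const.mul hf) hfc.mul_left).comp hR
  have hm : Measurable fun x : ℝ => Complex.exp (t * x * Complex.I) := by fun_prop
  have e1 : ∀ R : ℝ, charFun (P.map fun ω => ∫ x, f x ∂(LargeGaps.rescaledGaps P Z R ω)) t =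
      ∫ ω, Complex.exp ((∫ x, t * f x ∂(LargeGaps.rescaledGaps P Z R ω) : ℝ) * Complex.I) ∂P := by
    intro R
    rw [charFun_apply_real, integral_map (hX R) hm.aestronglyMeasurable]
    simp_rw [integral_const_mul, Complex.ofReal_mul]
  have e2 : charFun (P'.map fun ω => ∫ x, f x ∂(N ω)) t =
      ∫ ω, Complex.exp ((∫ x, t * f x ∂(N ω) : ℝ) * Complex.I) ∂P' := by
    rw [charFun_apply_real, integral_map hY hm.aestronglyMeasurable]
    simp_rw [integral_const_mul, Complex.ofReal_mul]
  change Tendsto (fun k => charFun (P.map fun ω =>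
    ∫ x, f x ∂(LargeGaps.rescaledGaps P Z (R k) ω)) t) atTop
      (𝓝 (charFun (P'.map fun ω => ∫ x, f x ∂(N ω)) t))
  simp_rw [e1, e2]
  exact key
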